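/- Let $\mathscr D$ be the standard dyadic system on $\mathbb R$, i.e. the intervals $2^{-k}[j,j+1)$, $j,k\in\mathbb Z$. For $I\in\mathscr D$ let $I_-,I_+$ be its left and right dyadic children, $\widehat I$ its dyadic parent, $I^{(j)}$ its $j$-th dyadic ancestor, and $\mathscr D_j(I)=\{J\in\mathscr D: J^{(j)}=I\}$. Put $\operatorname{dist}_{\mathscr D}(I,J)=\min\{a+b: I^{(a)}=J^{(b)}\}$ ($=\infty$ if there is no common ancestor). Let $\mu$ be a locally finite Borel measure on $\mathbb R$ without atoms that is balanced: $\mu(I)>0$ for all $I\in\mathscr D$ and, with $m(I)=\mu(I_-)\mu(I_+)/\mu(I)$, there is a constant $c$ such that $c^{-1}m(\widehat I)\le m(I)\le c\,m(\widehat I)$ for all $I\in\mathscr D$. Write $\langle f\rangle_I=\frac1{\mu(I)}\int_I f\,d\mu$, $\langle f,g\rangle=\int fg\,d\mu$ and $h_I=\sqrt{m(I)}\left(\frac{1_{I_-}}{\mu(I_-)}-\frac{1_{I_+}}{\mu(I_+)}\right)$. All functions are real-valued, and $\mathbb N=\{0,1,2,\dots\}$. For $s,t\in\mathbb N$, $\mathrm{HS}(s,t)$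 is the set of operators on $L^2(\mu)$ of the form $$Tf=\sum_{I\in\mathscr D}\ \sum_{J\in\mathscr D_s(I)}\ \sum_{K\in\mathscr D_t(I)}\alpha^I_{J,K}\,\langle f,h_J\rangle\, h_K,\qquad |\alpha^I_{J,K}|\le 1,$$ where the series converges in $L^2(\mu)$. For $p\ge 1$ let $c^b_p(I,J)=1$ if $I=J$ and $c^b_p(I,J)=\dfrac{m(I)^{p/2}m(J)^{p/2}}{\mu(J)\,\mu(I)^{p-1}}$ otherwise, and for $N\in\mathbb N$ let $$\mathcal M^Nf(x)=\sup_{\operatorname{dist}_{\mathscr D}(I,J)\le N+2} c^b_1(I,J)\,\langle|f|\rangle_I\,1_J(x).$$ A weight is a locally $\mu$-integrable, $\mu$-a.e. positive function $w$. For $1<p<\infty$ and $p'=p/(p-1)$ set (with values in $[0,\infty]$) $$[w]_{A_p(\mu)}=\sup_{I\in\mathscr D}\langle w\rangle_I\langle w^{1-p'}\rangle_I^{p-1},\qquad [w]_{A^N_p(\mu)}=\sup_{\operatorname{dist}_{\mathscr D}(I,J)\le N+2}c^b_p(I,J)\langle w\rangle_I\langle w^{1-p'}\rangle_J^{p-1},$$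 $$[w]_{A^N_1(\mu)}=\sup_{\operatorname{dist}_{\mathscr D}(I,J)\le N+2}c^b_1(I,J)\langle w\rangle_I\|w^{-1}\|_{L^\infty(J,\mu)}.$$ Let $N\in\mathbb N$. (i) For every $1<p<\infty$ there is a constant $C=C(\mu,N,p)$ such that for every weight $w$, and for $T=\mathcal M^N$ or any $T\in\mathrm{HS}(s,t)$ with $s+t\le N$, $$\|Tf\|_{L^p(w\,d\mu)}\le C\left([w]_{A_p(\mu)}^{\max\{1,\frac1{p-1}\}}+[w]_{A_p(\mu)}^{\frac{(p-1)^2+1}{p(p-1)}}\,[w]_{A^N_p(\mu)}^{\frac1p}\right)\|f\|_{L^p(w\,d\mu)}.$$ (ii) There is a constant $C=C(\mu,N)$ such that for every weight $w$ and for the same operators $T$, $$\sup_{\lambda>0}\lambda\, w\big(\{|Tf|>\lambda\}\big)\le C\,[w]_{A^N_1(\mu)}^2\,\|f\|_{L^1(w\,d\mu)},$$ where $w(E)=\int_E w\,d\mu$. Here $f$ ranges over all $\mu$-measurable functions if $T=\mathcal M^N$, and over all of $L^2(\mu)$ if $T\in\mathrm{HS}(s,t)$. An inequality whose right-hand side is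 infinite is trivially true, and $\infty\cdot0=0$. -/

import Mathlib

open MeasureTheory Set
open scoped ENNReal NNReal

noncomputable section

namespace HaarShift

/-- The dyadic interval `[pos * 2⁻ᵏ, (pos + 1) * 2⁻ᵏ)` of the standard dyadic system of `ℝ`,
with `k = scale`. Distinct pairs `(scale, pos)` give distinct intervals. -/
@[ext] structure Dyadic where
  scale : ℤ
  pos : ℤ
  deriving DecidableEq

namespace Dyadic

/-- The half-open interval itself. -/
def toSet (I : Dyadic) : Set ℝ :=
  Ico ((I.pos : ℝ) * (2 : ℝ) ^ (-I.scale)) (((I.pos : ℝ) + 1) * (2 : ℝ) ^ (-I.scale))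

/-- The left dyadic child `I₋`. -/
def left (I : Dyadic) : Dyadic := ⟨I.scale + 1, 2 * I.pos⟩

/-- The right dyadic child `I₊`. -/
def right (I : Dyadic) : Dyadic := ⟨I.scale + 1, 2 * I.pos + 1⟩

/-- The dyadic parent `Î`. -/
def parent (I : Dyadic) : Dyadic := ⟨I.scale - 1, I.pos / 2⟩

/-- The `j`-th dyadic ancestor `I^(j)`. -/
def ancestor (j : ℕ) (I : Dyadic) : Dyadic := parent^[j] I

/-- The `m`-th descendant (from the left) of `I`, `j` generations down, `0 ≤ m < 2 ^ j`. -/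
def sub (j m : ℕ) (I : Dyadic) : Dyadic := ⟨I.scale + j, 2 ^ j * I.pos + m⟩

/-- The set `𝒟_j(I)` of the `2 ^ j` dyadic intervals whose `j`-th ancestor is `I`
(see `mem_descendants`). -/
def descendants (j : ℕ) (I : Dyadic) : Finset Dyadic :=
  (Finset.range (2 ^ j)).image fun m => sub j m I

/-- The dyadic distance: the least `a + b` with `I^(a) = J^(b)`, and `∞` if `I` and `J` have
no common ancestor. -/
def dist (I J : Dyadic) : ℕ∞ :=
  ⨅ (a : ℕ) (b : ℕ) (_ : ancestor a I = ancestor b J), ((a + b : ℕ) : ℕ∞)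

theorem ancestor_eq (j : ℕ) (I : Dyadic) : ancestor j I = ⟨I.scale - j, I.pos / 2 ^ j⟩ := by
  induction j with
  | zero => simp [ancestor]
  | succ j ih =>
    have h : ancestor (j + 1) I = parent (ancestor j I) := by
      simp only [ancestor, Function.iterate_succ_apply']
    rw [h, ih]
    ext
    · simp only [parent]; push_cast; ring
    · simp only [parent]
      rw [Int.ediv_ediv_of_nonneg (by positivity), pow_succ]

theorem mem_descendants {j : ℕ} {I J : Dyadic} : J ∈ descendants j I ↔ ancestor j J = I := by
  have h2 : (0 : ℤ) < 2 ^ j := by positivity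
  simp only [descendants, Finset.mem_image, Finset.mem_range, ancestor_eq]
  constructor
  · rintro ⟨m, hm, rfl⟩
    ext
    · simp [sub]
    · simp only [sub]
      rw [Int.add_comm, Int.add_mul_ediv_left _ _ h2.ne',
        Int.ediv_eq_zero_of_lt (by positivity) (by exact_mod_cast hm), zero_add]
  · intro h
    refine ⟨(J.pos % 2 ^ j).toNat, ?_, ?_⟩
    · have := Int.emod_lt_of_pos J.pos h2
      zify
      rw [Int.toNat_of_nonneg (Int.emod_nonneg _ h2.ne')]
      exact this
    · rw [← h]
      ext
      · simp [sub]
      · simp only [sub]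
        rw [Int.toNat_of_nonneg (Int.emod_nonneg _ h2.ne')]
        exact Int.mul_ediv_add_emod _ _

theorem sub_injective (j m : ℕ) : Function.Injective (sub j m) := by
  rintro ⟨a, b⟩ ⟨c, d⟩ h
  simp only [sub, mk.injEq] at h
  have h2 : (2 : ℤ) ^ j ≠ 0 := by positivity
  ext
  · simpa using h.1
  · have := h.2
    simpa [h2] using this

theorem measurableSet_toSet (I : Dyadic) : MeasurableSet I.toSet := measurableSet_Ico

theorem mem_toSet {I : Dyadic} {x : ℝ} : x ∈ I.toSet ↔ ⌊x * (2 : ℝ) ^ I.scale⌋ = I.pos := by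
  have h : (0 : ℝ) < (2 : ℝ) ^ I.scale := by positivity
  rw [toSet, mem_Ico, Int.floor_eq_iff, zpow_neg, ← div_eq_mul_inv, ← div_eq_mul_inv,
    div_le_iff₀ h, lt_div_iff₀ h]

theorem floor_eq (x : ℝ) (k : ℤ) (n : ℕ) :
    ⌊x * (2 : ℝ) ^ k⌋ = ⌊x * (2 : ℝ) ^ (k + n)⌋ / 2 ^ n := by
  have : x * (2 : ℝ) ^ k = x * (2 : ℝ) ^ (k + n) / ((2 ^ n : ℕ) : ℝ) := by
    rw [zpow_add₀ (by norm_num)]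
    push_cast
    rw [zpow_natCast]
    field_simp
  rw [this, Int.floor_div_natCast]
  push_cast
  rfl

theorem subset_or_disjoint {I J : Dyadic} (h : I.scale ≤ J.scale) :
    J.toSet ⊆ I.toSet ∨ Disjoint J.toSet I.toSet := by
  obtain ⟨n, hn⟩ := Int.le.dest h
  have key : ∀ x ∈ J.toSet, ⌊x * (2 : ℝ) ^ I.scale⌋ = J.pos / 2 ^ n := by
    intro x hx
    rw [floor_eq x I.scale n, hn, mem_toSet.1 hx]
  by_cases hp : J.pos / 2 ^ n = I.pos
  · exact Or.inl fun x hx => mem_toSet.2 ((key x hx).trans hp)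
  · exact Or.inr (disjoint_left.2 fun x hx hx' => hp ((key x hx).symm.trans (mem_toSet.1 hx')))

theorem disjoint_of_scale_eq {I J : Dyadic} (h : I.scale = J.scale) (hne : I ≠ J) :
    Disjoint J.toSet I.toSet := by
  refine disjoint_left.2 fun x hx hx' => hne ?_
  rw [mem_toSet] at hx hx'
  ext
  · exact h
  · rw [← hx, ← hx', h]

theorem disjoint_children (I : Dyadic) : Disjoint I.left.toSet I.right.toSet :=
  disjoint_of_scale_eq rfl (by simp [left, right])

theorem toSet_eq_union (I : Dyadic) : I.toSet = I.left.toSet ∪ I.right.toSet := by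
  ext x
  have h := floor_eq x I.scale 1
  simp only [mem_union, mem_toSet, left, right]
  push_cast at h
  rw [h]
  omega

end Dyadic

variable (μ : Measure ℝ)

/-- `m(I) = μ(I₋) μ(I₊) / μ(I)`. -/
def m (I : Dyadic) : ℝ := μ.real I.left.toSet * μ.real I.right.toSet / μ.real I.toSet

/-- `μ` is balanced: `m(I) ∼ m(Î)` for all dyadic `I`, where every dyadic interval has positive
measure, so that `m` and the Haar functions are defined. (Freedom from atoms is asked for
separately.) -/
structure IsBalanced : Prop where
  pos : ∀ I : Dyadic, 0 < μ I.toSet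
  comparable : ∃ C : ℝ, ∀ I : Dyadic, m μ I ≤ C * m μ I.parent ∧ m μ I.parent ≤ C * m μ I

/-- The Haar function `h_I`. -/
def haar (I : Dyadic) (x : ℝ) : ℝ :=
  √(m μ I) * (I.left.toSet.indicator 1 x / μ.real I.left.toSet
    - I.right.toSet.indicator 1 x / μ.real I.right.toSet)

theorem measure_toSet_lt_top [IsLocallyFiniteMeasure μ] (I : Dyadic) : μ I.toSet < ∞ :=
  measure_Ico_lt_top

theorem haar_memLp [IsLocallyFiniteMeasure μ] (I : Dyadic) : MemLp (haar μ I) 2 μ := by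
  have h : ∀ J : Dyadic, MemLp (J.toSet.indicator (1 : ℝ → ℝ)) 2 μ := fun J =>
    memLp_indicator_const 2 J.measurableSet_toSet 1 (Or.inr (measure_toSet_lt_top μ J).ne)
  have := (((h I.left).const_mul (μ.real I.left.toSet)⁻¹).sub
    ((h I.right).const_mul (μ.real I.right.toSet)⁻¹)).const_mul (√(m μ I))
  refine this.ae_eq (Filter.Eventually.of_forall fun x => ?_)
  simp only [haar, Pi.sub_apply, div_eq_inv_mul]

/-- The Haar function as an element of `L²(μ)`. -/
def haarLp [IsLocallyFiniteMeasure μ] (I : Dyadic) : Lp ℝ 2 μ := (haar_memLp μ I).toLp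

/-- The Haar shift of complexity `(s, t)` with coefficients `α`,
`f ↦ ∑_I ∑_{J ∈ 𝒟_s(I)} ∑_{K ∈ 𝒟_t(I)} α^I_{J,K} ⟨f, h_J⟩ h_K` on `L²(μ)`. The series converges
unconditionally in `L²(μ)`, see `hasSum_haarShift`. -/
def haarShift [IsLocallyFiniteMeasure μ] (s t : ℕ) (α : Dyadic → Dyadic → Dyadic → ℝ)
    (f : Lp ℝ 2 μ) : Lp ℝ 2 μ :=
  ∑' I : Dyadic, ∑ J ∈ I.descendants s, ∑ K ∈ I.descendants t,
    (α I J K * ∫ x, f x * haar μ J x ∂μ) • haarLp μ K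

/-- The family `HS(s, t)` of Haar shifts of complexity `(s, t)` with `‖α‖_∞ ≤ 1`. -/
def HS [IsLocallyFiniteMeasure μ] (s t : ℕ) : Set (Lp ℝ 2 μ → Lp ℝ 2 μ) :=
  {T | ∃ α : Dyadic → Dyadic → Dyadic → ℝ, (∀ I J K, |α I J K| ≤ 1) ∧ T = haarShift μ s t α}

theorem haar_eq_of_mem {I J : Dyadic} (h : I.scale ≤ J.scale) (hne : I ≠ J) :
    ∃ c : ℝ, ∀ x ∈ J.toSet, haar μ I x = c := by
  rcases h.eq_or_lt with h | h
  · refine ⟨0, fun x hx => ?_⟩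
    have hx' : x ∉ I.toSet := disjoint_left.1 (Dyadic.disjoint_of_scale_eq h hne) hx
    rw [Dyadic.toSet_eq_union, mem_union, not_or] at hx'
    simp [haar, hx'.1, hx'.2]
  · have hc : ∀ C : Dyadic, C.scale ≤ J.scale →
        ∃ c : ℝ, ∀ x ∈ J.toSet, C.toSet.indicator (1 : ℝ → ℝ) x = c := by
      intro C hC
      rcases Dyadic.subset_or_disjoint hC with h1 | h1
      · exact ⟨1, fun x hx => by simp [h1 hx]⟩
      · exact ⟨0, fun x hx => by simp [disjoint_left.1 h1 hx]⟩
    obtain ⟨a, ha⟩ := hc I.left (by simp only [Dyadic.left]; omega)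
    obtain ⟨b, hb⟩ := hc I.right (by simp only [Dyadic.right]; omega)
    exact ⟨_, fun x hx => by rw [haar, ha x hx, hb x hx]⟩

theorem haar_eq_zero {I : Dyadic} {x : ℝ} (hx : x ∉ I.toSet) : haar μ I x = 0 := by
  rw [Dyadic.toSet_eq_union, mem_union, not_or] at hx
  simp [haar, hx.1, hx.2]

section

variable {μ} [IsLocallyFiniteMeasure μ]

theorem real_pos (hμ : ∀ I : Dyadic, 0 < μ I.toSet) (I : Dyadic) : 0 < μ.real I.toSet :=
  ENNReal.toReal_pos (hμ I).ne' (measure_toSet_lt_top μ I).ne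

theorem integrable_indicator (I : Dyadic) : Integrable (I.toSet.indicator (1 : ℝ → ℝ)) μ :=
  (integrable_indicator_iff I.measurableSet_toSet).2
    (integrableOn_const (measure_toSet_lt_top μ I).ne)

theorem integral_haar (hμ : ∀ I : Dyadic, 0 < μ I.toSet) (I : Dyadic) :
    ∫ x, haar μ I x ∂μ = 0 := by
  have h1 := (real_pos hμ I.left).ne'
  have h2 := (real_pos hμ I.right).ne'
  simp only [haar]
  rw [integral_const_mul, integral_sub ((integrable_indicator _).div_const _)
    ((integrable_indicator _).div_const _), integral_div, integral_div,
    integral_indicator_one I.left.measurableSet_toSet,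
    integral_indicator_one I.right.measurableSet_toSet, div_self h1, div_self h2]
  simp

theorem integral_haar_mul_haar_of_ne (hμ : ∀ I : Dyadic, 0 < μ I.toSet) {I J : Dyadic}
    (h : I.scale ≤ J.scale) (hne : I ≠ J) : ∫ x, haar μ I x * haar μ J x ∂μ = 0 := by
  obtain ⟨c, hc⟩ := haar_eq_of_mem μ h hne
  have : ∀ x, haar μ I x * haar μ J x = c * haar μ J x := by
    intro x
    by_cases hx : x ∈ J.toSet
    · rw [hc x hx]
    · simp [haar_eq_zero μ hx]
  simp only [this, integral_const_mul, integral_haar hμ, mul_zero]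

theorem integral_haar_mul_self (hμ : ∀ I : Dyadic, 0 < μ I.toSet) (I : Dyadic) :
    ∫ x, haar μ I x * haar μ I x ∂μ = 1 := by
  have h1 := real_pos hμ I.left
  have h2 := real_pos hμ I.right
  have hI : μ.real I.toSet = μ.real I.left.toSet + μ.real I.right.toSet := by
    rw [I.toSet_eq_union, measureReal_union I.disjoint_children I.right.measurableSet_toSet
      (measure_toSet_lt_top μ _).ne (measure_toSet_lt_top μ _).ne]
  have hm : 0 ≤ m μ I := by unfold m; positivity
  have : ∀ x, haar μ I x * haar μ I x
      = m μ I * (I.left.toSet.indicator 1 x / μ.real I.left.toSet ^ 2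
        + I.right.toSet.indicator 1 x / μ.real I.right.toSet ^ 2) := by
    intro x
    have hs := Real.mul_self_sqrt hm
    have hd : x ∈ I.left.toSet → x ∉ I.right.toSet :=
      fun h => disjoint_left.1 I.disjoint_children h
    unfold haar
    rw [mul_mul_mul_comm, hs]
    by_cases hl : x ∈ I.left.toSet
    · simp [hl, hd hl, pow_two]
    · by_cases hr : x ∈ I.right.toSet <;> simp [hl, hr, pow_two]
  simp only [this]
  rw [integral_const_mul, integral_add ((integrable_indicator _).div_const _)
    ((integrable_indicator _).div_const _), integral_div, integral_div,
    integral_indicator_one I.left.measurableSet_toSet,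
    integral_indicator_one I.right.measurableSet_toSet, m, hI]
  field_simp
  ring

theorem inner_haarLp (f : Lp ℝ 2 μ) (J : Dyadic) :
    inner ℝ (haarLp μ J) f = ∫ x, f x * haar μ J x ∂μ := by
  rw [L2.inner_def]
  refine integral_congr_ae ?_
  filter_upwards [(haar_memLp μ J).coeFn_toLp] with x hx
  rw [haarLp, hx]
  rfl

theorem orthonormal_haarLp (hμ : ∀ I : Dyadic, 0 < μ I.toSet) : Orthonormal ℝ (haarLp μ) := by
  have key : ∀ I J, inner ℝ (haarLp μ I) (haarLp μ J) = ∫ x, haar μ J x * haar μ I x ∂μ := by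
    intro I J
    rw [inner_haarLp]
    refine integral_congr_ae ?_
    filter_upwards [(haar_memLp μ J).coeFn_toLp] with x hx
    rw [haarLp, hx]
  rw [orthonormal_iff_ite]
  intro I J
  rw [key]
  split_ifs with h
  · rw [h]; exact integral_haar_mul_self hμ J
  · rcases le_total I.scale J.scale with hs | hs
    · simp only [mul_comm (haar μ J _)]
      exact integral_haar_mul_haar_of_ne hμ hs h
    · exact integral_haar_mul_haar_of_ne hμ hs (Ne.symm h)

/-- The series that defines a Haar shift converges unconditionally in `L²(μ)`. -/
theorem hasSum_haarShift (hμ : ∀ I : Dyadic, 0 < μ I.toSet) (s t : ℕ)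
    {α : Dyadic → Dyadic → Dyadic → ℝ} (hα : ∀ I J K, |α I J K| ≤ 1) (f : Lp ℝ 2 μ) :
    HasSum (fun I : Dyadic => ∑ J ∈ I.descendants s, ∑ K ∈ I.descendants t,
      (α I J K * ∫ x, f x * haar μ J x ∂μ) • haarLp μ K) (haarShift μ s t α f) := by
  refine Summable.hasSum ?_
  have ho := orthonormal_haarLp hμ
  have hinj : ∀ (j : ℕ) (I : Dyadic), Function.Injective fun n : ℕ => Dyadic.sub j n I := by
    intro j I a b h
    simpa [Dyadic.sub] using h
  have hsum : ∀ (j : ℕ) (I : Dyadic) (F : Dyadic → Lp ℝ 2 μ),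
      ∑ J ∈ I.descendants j, F J = ∑ n ∈ Finset.range (2 ^ j), F (Dyadic.sub j n I) := by
    intro j I F
    rw [Dyadic.descendants, Finset.sum_image (fun a _ b _ h => hinj j I h)]
  simp only [hsum]
  refine summable_sum fun a _ => summable_sum fun b _ => ?_
  have ho' : Orthonormal ℝ (fun I => haarLp μ (Dyadic.sub t b I)) :=
    ho.comp _ (Dyadic.sub_injective t b)
  have hsq : Summable fun I => ‖inner ℝ (haarLp μ (Dyadic.sub s a I)) f‖ ^ 2 :=
    (ho.inner_products_summable (x := f)).comp_injective (Dyadic.sub_injective s a)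
  have := (ho'.orthogonalFamily).summable_iff_norm_sq_summable
    (fun I => α I (Dyadic.sub s a I) (Dyadic.sub t b I)
      * ∫ x, f x * haar μ (Dyadic.sub s a I) x ∂μ)
  simp only [LinearIsometry.toSpanSingleton_apply] at this
  rw [this]
  refine Summable.of_nonneg_of_le (fun _ => by positivity) (fun I => ?_) hsq
  rw [norm_mul, inner_haarLp, mul_pow]
  refine mul_le_of_le_one_left (by positivity) ?_
  exact pow_le_one₀ (by positivity) (hα _ _ _)

end

/-- The factor `c_p^b(I, J)`. -/
def cb (p : ℝ) (I J : Dyadic) : ℝ≥0∞ :=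
  if I = J then 1 else
    ENNReal.ofReal (m μ I ^ (p / 2) * m μ J ^ (p / 2)
      / (μ.real J.toSet * μ.real I.toSet ^ (p - 1)))

/-- The modified dyadic maximal function `𝓜^N f`. -/
def maximal (N : ℕ) (f : ℝ → ℝ) (x : ℝ) : ℝ≥0∞ :=
  ⨆ (I : Dyadic) (J : Dyadic) (_ : I.dist J ≤ ((N + 2 : ℕ) : ℕ∞)),
    J.toSet.indicator (fun _ => cb μ 1 I J * ⨍⁻ y in I.toSet, ‖f y‖ₑ ∂μ) x

/-- A weight: a locally integrable, almost everywhere positive function. -/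
structure IsWeight (w : ℝ → ℝ) : Prop where
  locallyIntegrable : LocallyIntegrable w μ
  pos : ∀ᵐ x ∂μ, 0 < w x

/-- The measure `w dμ`. -/
def weighted (w : ℝ → ℝ) : Measure ℝ := μ.withDensity fun x => ENNReal.ofReal (w x)

/-- `⟨w⟩_I ⟨w^{1-p'}⟩_J^{p-1}` for `1 < p`, where `1 - p' = -1/(p-1)`. -/
def apProduct (p : ℝ) (w : ℝ → ℝ) (I J : Dyadic) : ℝ≥0∞ :=
  (⨍⁻ x in I.toSet, ENNReal.ofReal (w x) ∂μ)
    * (⨍⁻ x in J.toSet, ENNReal.ofReal (w x) ^ (1 - p / (p - 1)) ∂μ) ^ (p - 1)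

/-- The dyadic Muckenhoupt characteristic `[w]_{A_p(μ)}`, `1 < p < ∞`. -/
def apChar (p : ℝ) (w : ℝ → ℝ) : ℝ≥0∞ := ⨆ I : Dyadic, apProduct μ p w I I

/-- The characteristic `[w]_{A_p^N(μ)}`, `1 < p < ∞`. -/
def apNChar (p : ℝ) (N : ℕ) (w : ℝ → ℝ) : ℝ≥0∞ :=
  ⨆ (I : Dyadic) (J : Dyadic) (_ : I.dist J ≤ ((N + 2 : ℕ) : ℕ∞)),
    cb μ p I J * apProduct μ p w I J

/-- The characteristic `[w]_{A_1^N(μ)}`. -/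
def a1NChar (N : ℕ) (w : ℝ → ℝ) : ℝ≥0∞ :=
  ⨆ (I : Dyadic) (J : Dyadic) (_ : I.dist J ≤ ((N + 2 : ℕ) : ℕ∞)),
    cb μ 1 I J * (⨍⁻ x in I.toSet, ENNReal.ofReal (w x) ∂μ)
      * eLpNorm (fun x => (w x)⁻¹) ∞ (μ.restrict J.toSet)

/-- The weak quasinorm of `L^{1,∞}(ν)`: `sup_{λ > 0} λ ν{|g| > λ}`. -/
def weakL1Norm {E : Type*} [ENorm E] (g : ℝ → E) (ν : Measure ℝ) : ℝ≥0∞ :=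
  ⨆ r : ℝ≥0, (r : ℝ≥0∞) * ν {x | (r : ℝ≥0∞) < ‖g x‖ₑ}

end HaarShift

end

/-! Everything is first proved on a finite dyadic tree below an interval `Q₀`, with constants
independent of the tree. There `f` enters only through the additive interval functions F = ∫ f and
F₁ = ∫ |f|, because ⟨f, h_J⟩ = √m(J) (⟨f⟩_{J₋} - ⟨f⟩_{J₊}).

Sparse domination (`domination`). To bound ∑_I ∑_J |⟨f, h_J⟩| ∑_K |⟨g, h_K⟩|, a new stopping
interval is opened whenever the average of |f| or of |g| has grown by more than a factor 4. Let I
have stopping interval Q. The averages that enter at I are taken over intervals of 𝒟_{s+1}(I) and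
𝒟_{t+1}(I). Those whose stopping interval is still Q are good: they are at most four times the
average over Q. The others are bad: since μ need not be doubling, nothing bounds them by the average
over Q. Good against good is Cauchy–Schwarz together with a Bessel inequality for truncated averages
(`bessel`). In good against bad, only the masses of the bad intervals matter, and these intervals
have bounded overlap because they lie at most N + 1 generations below an interval that still belongs
to Q. Bad against bad survives as a genuinely off-diagonal term: two intervals at dyadic distance at
most N + 2, with coefficient √m(J) √m(K). This is the source of c^b_p, of `kap`, and of the need for
[w]_{A_p^N}. Balance of μ is what allows m to be moved between near intervals. The intervals that
occur form a sparse family (`isSparse_sparseFam`).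

Strong type. Let σ = w^{1-p'}. The A_p^N condition bounds `kap` by [w]_{A_p^N}^{1/p} times the
factors that normalise the averages with respect to σ and w. Hölder over near pairs then reduces the
form (`sum_form_le`) to two sparse sums. By sparseness and A_p they are bounded through the Carleson
embedding theorem (`carleson_embedding`) for σ and for w, at the cost of [w]_{A_p}^{1/(p-1)} and
[w]_{A_p}. Diagonal pairs are included in A_p^N, so for finite [w]_{A_p} the second summand of the
theorem already suffices. The form is tested with the (p-1)-st power of the finite shift itself,
whose norm is then absorbed. For the maximal function, I is replaced by its stopping ancestor
(`cb_mul_laverage_le`) and the supremum by a sum.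

Weak type. Let A = [w]_{A_1^N} and cut at height r = λ/A. Instead of decomposing f, the averages are
masked: those over intervals inside some interval of average > r are separated from the rest. The
masked operator still obeys sparse domination, and in L²(w) it satisfies a bound A³ r ‖f‖_{L¹(w)}
(`lintegral_stepFun_sq_le`). Outside the level set {Mf > r} the removed part involves only intervals
just below the maximal selected ones, and its L¹(w) norm is at most a multiple of A ‖f‖_{L¹(w)}
(`lintegral_badMajorant_le`). The level set has weight at most A ‖f‖_{L¹(w)}/r. With r = λ/A each
contribution is at most a multiple of A² ‖f‖_{L¹(w)}/λ.

Finally the trees below [0, 2ⁿ) and [-2ⁿ, 0) exhaust the dyadic system, and Fatou's lemma gives the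
full operators. -/

open MeasureTheory Set
open scoped ENNReal NNReal

noncomputable section

namespace HaarShift

/-! ### Combinatorics of the dyadic tree. -/

namespace Dyadic

@[simp] theorem parent_left (I : Dyadic) : I.left.parent = I := by
  ext
  · simp [parent, left]
  · simp [parent, left]

@[simp] theorem parent_right (I : Dyadic) : I.right.parent = I := by
  ext
  · simp [parent, right]
  · simp only [parent, right]; omega

theorem eq_left_or_right (I : Dyadic) : I = I.parent.left ∨ I = I.parent.right := by
  rcases Int.emod_two_eq_zero_or_one I.pos with h | h
  · left; ext <;> simp only [parent, left] <;> omega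
  · right; ext <;> simp only [parent, right] <;> omega

theorem left_ne_right (I : Dyadic) : I.left ≠ I.right := by
  simp [left, right]

@[simp] theorem ancestor_zero (I : Dyadic) : ancestor 0 I = I := rfl

theorem ancestor_succ (j : ℕ) (I : Dyadic) : ancestor (j + 1) I = ancestor j I.parent := rfl

theorem ancestor_succ' (j : ℕ) (I : Dyadic) : ancestor (j + 1) I = (ancestor j I).parent := by
  simp only [ancestor, Function.iterate_succ_apply']

theorem ancestor_add (i j : ℕ) (I : Dyadic) : ancestor (i + j) I = ancestor i (ancestor j I) := by
  simp only [ancestor, Function.iterate_add_apply]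

theorem scale_ancestor (j : ℕ) (I : Dyadic) : (ancestor j I).scale = I.scale - j := by
  rw [ancestor_eq]

/-- `R` is a (not necessarily proper) dyadic descendant of `Q`. -/
def Sub (R Q : Dyadic) : Prop := ∃ j, ancestor j R = Q

theorem Sub.refl (R : Dyadic) : Sub R R := ⟨0, rfl⟩

theorem Sub.trans {A B C : Dyadic} (h : Sub A B) (h' : Sub B C) : Sub A C := by
  obtain ⟨i, rfl⟩ := h
  obtain ⟨j, rfl⟩ := h'
  exact ⟨j + i, ancestor_add _ _ _⟩

theorem sub_ancestor (j : ℕ) (R : Dyadic) : Sub R (ancestor j R) := ⟨j, rfl⟩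

theorem sub_parent (R : Dyadic) : Sub R R.parent := ⟨1, rfl⟩

theorem left_sub (R : Dyadic) : Sub R.left R := ⟨1, by simp [ancestor]⟩

theorem right_sub (R : Dyadic) : Sub R.right R := ⟨1, by simp [ancestor]⟩

theorem Sub.left {R Q : Dyadic} (h : Sub R Q) : Sub R.left Q := (left_sub R).trans h

theorem Sub.right {R Q : Dyadic} (h : Sub R Q) : Sub R.right Q := (right_sub R).trans h

theorem Sub.scale_le {R Q : Dyadic} (h : Sub R Q) : Q.scale ≤ R.scale := by
  obtain ⟨j, rfl⟩ := h
  rw [scale_ancestor]; omega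

theorem Sub.ancestor_eq' {R Q : Dyadic} (h : Sub R Q) :
    ancestor (R.scale - Q.scale).toNat R = Q := by
  obtain ⟨j, rfl⟩ := h
  rw [scale_ancestor]
  congr 1
  omega

theorem Sub.eq_of_scale {R Q : Dyadic} (h : Sub R Q) (hs : R.scale = Q.scale) : R = Q := by
  have := h.ancestor_eq'
  simpa [hs] using this

theorem Sub.of_scale_le {A B R : Dyadic} (hA : Sub R A) (hB : Sub R B)
    (h : B.scale ≤ A.scale) : Sub A B := by
  obtain ⟨i, rfl⟩ := hA
  obtain ⟨j, rfl⟩ := hB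
  simp only [scale_ancestor] at h
  refine ⟨j - i, ?_⟩
  rw [← ancestor_add]
  congr 1
  omega

theorem Sub.total {A B R : Dyadic} (hA : Sub R A) (hB : Sub R B) : Sub A B ∨ Sub B A :=
  (le_total B.scale A.scale).imp (hA.of_scale_le hB) (hB.of_scale_le hA)

theorem Sub.parent_of_ne {R Q : Dyadic} (h : Sub R Q) (hne : R ≠ Q) : Sub R.parent Q := by
  obtain ⟨j, rfl⟩ := h
  cases j with
  | zero => exact absurd rfl hne
  | succ j => exact ⟨j, rfl⟩

theorem Sub.parent_of_lt {R Q : Dyadic} (h : Sub R Q) (hne : Q.scale < R.scale) :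
    Sub R.parent Q :=
  h.parent_of_ne (by rintro rfl; exact lt_irrefl _ hne)

theorem toSet_left_subset (I : Dyadic) : I.left.toSet ⊆ I.toSet := by
  rw [toSet_eq_union I]; exact subset_union_left

theorem toSet_right_subset (I : Dyadic) : I.right.toSet ⊆ I.toSet := by
  rw [toSet_eq_union I]; exact subset_union_right

theorem toSet_subset_parent (I : Dyadic) : I.toSet ⊆ I.parent.toSet := by
  rcases eq_left_or_right I with h | h
  · conv_lhs => rw [h]
    exact toSet_left_subset _
  · conv_lhs => rw [h]
    exact toSet_right_subset _

theorem Sub.subset {R Q : Dyadic} (h : Sub R Q) : R.toSet ⊆ Q.toSet := by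
  obtain ⟨j, rfl⟩ := h
  induction j with
  | zero => exact subset_rfl
  | succ j ih => rw [ancestor_succ']; exact ih.trans (toSet_subset_parent _)

/-- The dyadic interval of scale `k` that contains `x`. -/
def cubeAt (k : ℤ) (x : ℝ) : Dyadic := ⟨k, ⌊x * (2 : ℝ) ^ k⌋⟩

theorem mem_iff_cubeAt {I : Dyadic} {x : ℝ} : x ∈ I.toSet ↔ cubeAt I.scale x = I := by
  rw [mem_toSet]
  constructor
  · intro h; ext
    · rfl
    · exact h
  · intro h; rw [← h]; rfl

theorem eq_of_mem_of_scale_eq {I J : Dyadic} {x : ℝ} (hI : x ∈ I.toSet) (hJ : x ∈ J.toSet)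
    (h : I.scale = J.scale) : I = J := by
  rw [mem_iff_cubeAt] at hI hJ
  rw [← hI, ← hJ, h]

theorem measurable_cubeAt (k : ℤ) (s : Set Dyadic) : MeasurableSet {x | cubeAt k x ∈ s} := by
  have : {x | cubeAt k x ∈ s} = (fun x : ℝ => ⌊x * (2 : ℝ) ^ k⌋) ⁻¹' {n | (⟨k, n⟩ : Dyadic) ∈ s} := rfl
  rw [this]
  exact (Int.measurable_floor.comp (measurable_id.mul_const _)) (MeasurableSet.of_discrete)

/-- The descendants of `R` of fewer than `n` generations. -/
def tree : ℕ → Dyadic → Finset Dyadic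
  | 0, _ => ∅
  | n + 1, R => insert R (tree n R.left ∪ tree n R.right)

theorem Sub.eq_or_left_or_right {I R : Dyadic} {j : ℕ} (h : ancestor (j + 1) I = R) :
    ancestor j I = R.left ∨ ancestor j I = R.right := by
  rw [ancestor_succ'] at h
  rw [← h]
  exact eq_left_or_right _

theorem mem_tree {n : ℕ} {R I : Dyadic} : I ∈ tree n R ↔ ∃ j < n, ancestor j I = R := by
  induction n generalizing R with
  | zero => simp [tree]
  | succ n ih =>
    simp only [tree, Finset.mem_insert, Finset.mem_union, ih]
    constructor
    · rintro (rfl | ⟨j, hj, h⟩ | ⟨j, hj, h⟩)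
      · exact ⟨0, by omega, rfl⟩
      · exact ⟨j + 1, by omega, by rw [ancestor_succ', h, parent_left]⟩
      · exact ⟨j + 1, by omega, by rw [ancestor_succ', h, parent_right]⟩
    · rintro ⟨j, hj, h⟩
      cases j with
      | zero => exact Or.inl h
      | succ j =>
        right
        rcases Sub.eq_or_left_or_right h with h | h
        · exact Or.inl ⟨j, by omega, h⟩
        · exact Or.inr ⟨j, by omega, h⟩

theorem mem_tree_iff {n : ℕ} {R I : Dyadic} : I ∈ tree n R ↔ Sub I R ∧ I.scale < R.scale + n := by
  rw [mem_tree]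
  constructor
  · rintro ⟨j, hj, rfl⟩
    refine ⟨sub_ancestor _ _, ?_⟩
    rw [scale_ancestor]; omega
  · rintro ⟨⟨j, rfl⟩, hs⟩
    rw [scale_ancestor] at hs
    exact ⟨j, by omega, rfl⟩

theorem disjoint_of_sub {A B : Dyadic} {I : Dyadic} (hs : A.scale = B.scale) (hne : A ≠ B)
    (hA : Sub I A) (hB : Sub I B) : False := by
  exact hne ((hA.of_scale_le hB hs.ge).eq_of_scale hs)

theorem sum_tree_succ (n : ℕ) (R : Dyadic) {M : Type*} [AddCommMonoid M] (φ : Dyadic → M) :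
    ∑ I ∈ tree (n + 1) R, φ I = φ R + (∑ I ∈ tree n R.left, φ I + ∑ I ∈ tree n R.right, φ I) := by
  have h1 : R ∉ tree n R.left ∪ tree n R.right := by
    simp only [Finset.mem_union, mem_tree_iff, not_or, not_and]
    constructor
    · intro h; have := h.scale_le; simp only [left] at this; omega
    · intro h; have := h.scale_le; simp only [right] at this; omega
  have h2 : Disjoint (tree n R.left) (tree n R.right) := by
    rw [Finset.disjoint_left]
    intro I h h'
    rw [mem_tree_iff] at h h'
    exact disjoint_of_sub (A := R.left) (B := R.right) rfl (left_ne_right R) h.1 h'.1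
  rw [tree, Finset.sum_insert h1, Finset.sum_union h2]

theorem descendants_zero (R : Dyadic) : descendants 0 R = {R} := by
  ext I; simp [mem_descendants]

theorem descendants_succ (j : ℕ) (R : Dyadic) :
    descendants (j + 1) R = descendants j R.left ∪ descendants j R.right := by
  ext I
  simp only [Finset.mem_union, mem_descendants]
  constructor
  · exact Sub.eq_or_left_or_right
  · rintro (h | h)
    · rw [ancestor_succ', h, parent_left]
    · rw [ancestor_succ', h, parent_right]

theorem sum_descendants_succ (j : ℕ) (R : Dyadic) {M : Type*} [AddCommMonoid M] (φ : Dyadic → M) :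
    ∑ I ∈ descendants (j + 1) R, φ I
      = ∑ I ∈ descendants j R.left, φ I + ∑ I ∈ descendants j R.right, φ I := by
  rw [descendants_succ, Finset.sum_union]
  rw [Finset.disjoint_left]
  intro I h h'
  rw [mem_descendants] at h h'
  exact left_ne_right R (h.symm.trans h')

theorem sum_descendants_succ' (j : ℕ) (R : Dyadic) {M : Type*} [AddCommMonoid M]
    (φ : Dyadic → M) :
    ∑ I ∈ descendants (j + 1) R, φ I = ∑ I ∈ descendants j R, (φ I.left + φ I.right) := by
  induction j generalizing R with
  | zero => simp [descendants_succ, descendants_zero, Finset.sum_pair (left_ne_right R)]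
  | succ j ih => rw [sum_descendants_succ, ih, ih, ← sum_descendants_succ]

theorem card_descendants (j : ℕ) (R : Dyadic) : (descendants j R).card = 2 ^ j := by
  induction j generalizing R with
  | zero => simp [descendants_zero]
  | succ j ih =>
    have := sum_descendants_succ j R (fun _ => (1 : ℕ))
    simp only [Finset.sum_const, smul_eq_mul, mul_one] at this
    rw [this, ih, ih]; ring

/-- An interval has only one `s`-th ancestor, so no `J` is counted twice on the left. -/
theorem sum_tree_descendants_le {M : Type*} [AddCommMonoid M] [PartialOrder M]
    [IsOrderedAddMonoid M] (n s : ℕ) (R : Dyadic) {φ : Dyadic → M} (hφ : ∀ J, 0 ≤ φ J) :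
    ∑ I ∈ tree n R, ∑ J ∈ descendants s I, φ J ≤ ∑ J ∈ tree (n + s) R, φ J := by
  rw [← Finset.sum_biUnion]
  · refine Finset.sum_le_sum_of_subset_of_nonneg ?_ fun _ _ _ => hφ _
    intro J hJ
    rw [Finset.mem_biUnion] at hJ
    obtain ⟨I, hI, hJ⟩ := hJ
    rw [mem_descendants] at hJ
    rw [mem_tree_iff] at *
    subst hJ
    refine ⟨(sub_ancestor _ _).trans hI.1, ?_⟩
    have := hI.2
    rw [scale_ancestor] at this
    push_cast; omega
  · intro I _ I' _ hne
    rw [Function.onFun, Finset.disjoint_left]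
    intro J h h'
    rw [mem_descendants] at h h'
    exact hne (h.symm.trans h')

/-- Additive functions of dyadic intervals. -/
def Additive (φ : Dyadic → ℝ) : Prop := ∀ I, φ I = φ I.left + φ I.right

theorem Additive.sub_le {φ : Dyadic → ℝ} (h : Additive φ) (h0 : ∀ I, 0 ≤ φ I) {R Q : Dyadic}
    (hs : Sub R Q) : φ R ≤ φ Q := by
  obtain ⟨j, rfl⟩ := hs
  induction j with
  | zero => exact le_rfl
  | succ j ih =>
    rw [ancestor_succ']
    refine ih.trans ?_
    set A := ancestor j R
    have h1 := h A.parent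
    rcases eq_left_or_right A with h2 | h2
    · rw [← h2] at h1; linarith [h0 A.parent.right]
    · rw [← h2] at h1; linarith [h0 A.parent.left]

theorem Additive.sum_tree {φ : Dyadic → ℝ} (h : Additive φ) (n : ℕ) (R : Dyadic) :
    ∑ I ∈ tree n R, φ I = n * φ R := by
  induction n generalizing R with
  | zero => simp [tree]
  | succ n ih => rw [sum_tree_succ, ih, ih, h R]; push_cast; ring

open Classical in
/-- A family in which chains have at most `d` generations has overlap at most `d`. -/
theorem Additive.sum_filter_le {φ : Dyadic → ℝ} (h : Additive φ) (h0 : ∀ I, 0 ≤ φ I)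
    {P : Dyadic → Prop} {d : ℕ} (hP : ∀ I, P I → ∀ i, d ≤ i → ¬ P (ancestor i I))
    (n : ℕ) (R : Dyadic) :
    ∑ I ∈ tree n R with P I, φ I ≤ d * φ R := by
  induction n generalizing R with
  | zero => simp only [tree, Finset.filter_empty, Finset.sum_empty]; exact mul_nonneg (by positivity) (h0 R)
  | succ n ih =>
    -- A member `R` excludes members `d` or more generations below it, and each generation below `R`
    -- has total mass `φ R`. If `R` is not a member, the bounds for its children add up.
    by_cases hR : P R
    · calc ∑ I ∈ tree (n + 1) R with P I, φ I ≤ ∑ I ∈ tree d R, φ I := by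
            refine Finset.sum_le_sum_of_subset_of_nonneg ?_ fun _ _ _ => h0 _
            intro I hI
            rw [Finset.mem_filter, mem_tree] at hI
            obtain ⟨⟨j, hj, hjR⟩, hPI⟩ := hI
            rw [mem_tree]
            refine ⟨j, ?_, hjR⟩
            by_contra hd
            exact hP I hPI j (by omega) (hjR ▸ hR)
        _ = d * φ R := h.sum_tree d R
    · rw [Finset.sum_filter, sum_tree_succ, if_neg hR, zero_add, ← Finset.sum_filter,
        ← Finset.sum_filter, h R, mul_add]
      exact add_le_add (ih _) (ih _)

/-- `I` and `J` have dyadic distance at most `n`. -/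
def Near (n : ℕ) (I J : Dyadic) : Prop := ∃ a b, a + b ≤ n ∧ ancestor a I = ancestor b J

theorem Near.symm {n : ℕ} {I J : Dyadic} (h : Near n I J) : Near n J I := by
  obtain ⟨a, b, h, h'⟩ := h
  exact ⟨b, a, by omega, h'.symm⟩

theorem Near.refl (n : ℕ) (I : Dyadic) : Near n I I := ⟨0, 0, by omega, rfl⟩

theorem dist_le_iff {n : ℕ} {I J : Dyadic} : dist I J ≤ (n : ℕ∞) ↔ Near n I J := by
  constructor
  · intro h
    by_contra hn
    have : ((n + 1 : ℕ) : ℕ∞) ≤ dist I J := by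
      refine le_iInf fun a => le_iInf fun b => le_iInf fun hab => ?_
      rw [Nat.cast_le]
      by_contra hlt
      exact hn ⟨a, b, by omega, hab⟩
    have h2 := this.trans h
    rw [Nat.cast_le] at h2
    omega
  · rintro ⟨a, b, hab, h⟩
    refine (iInf_le_of_le a (iInf_le_of_le b (iInf_le _ h))).trans ?_
    exact_mod_cast hab

/-- The finite set of intervals at dyadic distance at most `n` from `I`. -/
def nbhd (n : ℕ) (I : Dyadic) : Finset Dyadic :=
  (Finset.range (n + 1)).biUnion fun a => (Finset.range (n + 1 - a)).biUnion fun b =>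
    descendants b (ancestor a I)

theorem mem_nbhd {n : ℕ} {I J : Dyadic} : J ∈ nbhd n I ↔ Near n I J := by
  simp only [nbhd, Finset.mem_biUnion, Finset.mem_range, mem_descendants, Near]
  constructor
  · rintro ⟨a, ha, b, hb, h⟩
    exact ⟨a, b, by omega, h.symm⟩
  · rintro ⟨a, b, hab, h⟩
    exact ⟨a, by omega, b, by omega, h.symm⟩

theorem card_nbhd_le (n : ℕ) (I : Dyadic) : (nbhd n I).card ≤ (n + 1) ^ 2 * 2 ^ n := by
  refine (Finset.card_biUnion_le_card_mul _ _ ((n + 1) * 2 ^ n) fun a _ => ?_).trans ?_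
  · refine (Finset.card_biUnion_le_card_mul _ _ (2 ^ n) fun b hb => ?_).trans ?_
    · rw [card_descendants]
      rw [Finset.mem_range] at hb
      exact Nat.pow_le_pow_right (by norm_num) (by omega)
    · rw [Finset.card_range]
      exact Nat.mul_le_mul_right _ (by omega)
  · rw [Finset.card_range, pow_two, mul_assoc]

end Dyadic

/-! ### Stopping intervals. -/

open HaarShift.Dyadic

open Classical in
/-- The stopping ancestor of `I`, for the stopping rule `st` started `j` generations above `I`. -/
def stopAnc (st : Dyadic → Dyadic → Prop) : ℕ → Dyadic → Dyadic
  | 0, I => I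
  | j + 1, I => if st (stopAnc st j I.parent) I then I else stopAnc st j I.parent

/-- The minimal stopping interval containing `I`, for the rule `st` started at `Q₀`. -/
def stp (st : Dyadic → Dyadic → Prop) (Q₀ I : Dyadic) : Dyadic :=
  stopAnc st (I.scale - Q₀.scale).toNat I

section stopping

variable {st : Dyadic → Dyadic → Prop} {Q₀ : Dyadic}

theorem stp_root : stp st Q₀ Q₀ = Q₀ := by simp [stp, stopAnc]

-- `Int.toNat` truncates, so an interval no finer than `Q₀` is its own stopping interval; the
-- recursion therefore needs the parent to lie inside `Q₀`.
open Classical in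
theorem stp_eq {I : Dyadic} (h : Sub I.parent Q₀) :
    stp st Q₀ I = if st (stp st Q₀ I.parent) I then I else stp st Q₀ I.parent := by
  have hs := h.scale_le
  have h1 : I.parent.scale = I.scale - 1 := rfl
  have h2 : (I.scale - Q₀.scale).toNat = (I.parent.scale - Q₀.scale).toNat + 1 := by omega
  simp only [stp]
  rw [h2, stopAnc]
  congr

theorem stp_eq_or {I : Dyadic} (h : Sub I.parent Q₀) :
    (st (stp st Q₀ I.parent) I ∧ stp st Q₀ I = I) ∨
      (¬ st (stp st Q₀ I.parent) I ∧ stp st Q₀ I = stp st Q₀ I.parent) := by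
  rw [stp_eq h]
  by_cases hst : st (stp st Q₀ I.parent) I <;> simp [hst]

theorem sub_induction {Q₀ : Dyadic} {P : Dyadic → Prop} (h0 : P Q₀)
    (h1 : ∀ I, Sub I.parent Q₀ → P I.parent → P I) {I : Dyadic} (h : Sub I Q₀) : P I := by
  obtain ⟨j, hj⟩ := h
  induction j generalizing I with
  | zero => rw [← hj] at h0; exact h0
  | succ j ih => exact h1 I ⟨j, hj⟩ (ih hj)

theorem sub_stp {I : Dyadic} (h : Sub I Q₀) : Sub I (stp st Q₀ I) := by
  refine sub_induction (P := fun I => Sub I (stp st Q₀ I))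
    (by rw [stp_root]; exact Sub.refl _) (fun I hI ih => ?_) h
  rcases stp_eq_or (st := st) hI with h | h
  · rw [h.2]; exact Sub.refl _
  · rw [h.2]; exact (sub_parent I).trans ih

theorem stp_sub {I : Dyadic} (h : Sub I Q₀) : Sub (stp st Q₀ I) Q₀ := by
  refine sub_induction (P := fun I => Sub (stp st Q₀ I) Q₀)
    (by rw [stp_root]; exact Sub.refl _) (fun I hI ih => ?_) h
  rcases stp_eq_or (st := st) hI with h | h
  · rw [h.2]; exact (sub_parent I).trans hI
  · rw [h.2]; exact ih

theorem stp_stp {I : Dyadic} (h : Sub I Q₀) : stp st Q₀ (stp st Q₀ I) = stp st Q₀ I := by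
  refine sub_induction (P := fun I => stp st Q₀ (stp st Q₀ I) = stp st Q₀ I)
    (by rw [stp_root, stp_root]) (fun I hI ih => ?_) h
  rcases stp_eq_or (st := st) hI with h | h
  · rw [h.2, h.2]
  · rw [h.2]; exact ih

theorem stp_eq_self_or {I : Dyadic} (h : Sub I Q₀) :
    stp st Q₀ I = I ∨ ¬ st (stp st Q₀ I) I := by
  by_cases hI : I = Q₀
  · left; rw [hI, stp_root]
  · rcases stp_eq_or (st := st) (h.parent_of_ne hI) with h | h
    · exact Or.inl h.2
    · right; rw [h.2]; exact h.1

/-- The set of intervals with a given stopping ancestor is convex. -/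
theorem stp_convex {I A : Dyadic} (hI : Sub I Q₀) (hIA : Sub I A) (hA : Sub A (stp st Q₀ I)) :
    stp st Q₀ A = stp st Q₀ I := by
  obtain ⟨j, hj⟩ := hIA
  induction j generalizing I with
  | zero => rw [← hj]; rfl
  | succ j ih =>
    have h1 : A.scale < I.scale := by rw [← hj, scale_ancestor]; push_cast; omega
    have h2 := hA.scale_le
    have hQ : Sub I.parent Q₀ :=
      hI.parent_of_lt (((stp_sub hI).scale_le.trans h2).trans_lt h1)
    rcases stp_eq_or (st := st) hQ with h | h
    · rw [h.2] at h2; omega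
    · rw [h.2] at hA ⊢
      exact ih hQ hA hj

end stopping

/-! ### Truncated averages and Bessel's inequality. -/

/-- The average of an additive function with respect to `V`. -/
def avg (V F : Dyadic → ℝ) (I : Dyadic) : ℝ := F I / V I

/-- `V(I₋) V(I₊) / V(I)`. -/
def hm (V : Dyadic → ℝ) (I : Dyadic) : ℝ := V I.left * V I.right / V I

open Classical in
/-- The coefficients of the form that dominates Haar shifts. -/
def kap (V : Dyadic → ℝ) (J K : Dyadic) : ℝ :=
  if J = K then V J else √(hm V J) * √(hm V K)

section forms

variable {V F F₁ H H₁ : Dyadic → ℝ}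

theorem hm_nonneg (hV0 : ∀ I, 0 < V I) (I : Dyadic) : 0 ≤ hm V I :=
  div_nonneg (mul_nonneg (hV0 _).le (hV0 _).le) (hV0 _).le

theorem hm_pos (hV0 : ∀ I, 0 < V I) (I : Dyadic) : 0 < hm V I :=
  div_pos (mul_pos (hV0 _) (hV0 _)) (hV0 _)

/-- `hm V I` is comparable to the smaller of the two children. Boundedness by either child is what
makes it affordable to cut off just one of them in `bessel_one`. -/
theorem hm_le_left (hV : Additive V) (hV0 : ∀ I, 0 < V I) (I : Dyadic) : hm V I ≤ V I.left := by
  rw [hm, div_le_iff₀ (hV0 I)]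
  have := hV I
  have := hV0 I.left
  nlinarith

theorem hm_le_right (hV : Additive V) (hV0 : ∀ I, 0 < V I) (I : Dyadic) :
    hm V I ≤ V I.right := by
  rw [hm, div_le_iff₀ (hV0 I)]
  have := hV I
  have := hV0 I.right
  nlinarith

theorem hm_le (hV : Additive V) (hV0 : ∀ I, 0 < V I) (I : Dyadic) : hm V I ≤ V I :=
  (hm_le_left hV hV0 I).trans (by rw [hV I]; linarith [hV0 I.right])

theorem kap_nonneg (hV0 : ∀ I, 0 < V I) (J K : Dyadic) : 0 ≤ kap V J K := by
  unfold kap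
  split_ifs
  · exact (hV0 _).le
  · positivity

theorem avg_nonneg (hV0 : ∀ I, 0 < V I) (hF : ∀ I, 0 ≤ F I) (I : Dyadic) : 0 ≤ avg V F I :=
  div_nonneg (hF I) (hV0 I).le

theorem abs_avg_le (hV0 : ∀ I, 0 < V I) (hF : ∀ I, |F I| ≤ F₁ I) (I : Dyadic) :
    |avg V F I| ≤ avg V F₁ I := by
  rw [avg, abs_div, abs_of_pos (hV0 I)]
  exact div_le_div_of_nonneg_right (hF I) (hV0 I).le

theorem avg_mul (hV0 : ∀ I, 0 < V I) (F : Dyadic → ℝ) (I : Dyadic) : V I * avg V F I = F I := by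
  rw [avg, mul_div_cancel₀ _ (hV0 I).ne']

open Classical in
/-- The average, put to zero outside a family of intervals. -/
def mavg (V F : Dyadic → ℝ) (P : Dyadic → Prop) (I : Dyadic) : ℝ := if P I then avg V F I else 0

theorem mavg_nonneg (hV0 : ∀ I, 0 < V I) (hF : ∀ I, 0 ≤ F I) (P : Dyadic → Prop) (I : Dyadic) :
    0 ≤ mavg V F P I := by
  unfold mavg
  split_ifs
  · exact avg_nonneg hV0 hF I
  · exact le_rfl

/-- The square of a Haar coefficient is the increase of the energy F²/V from an interval to its
children, so the sum over a tree telescopes. -/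
theorem bessel_both {V1 V2 F1 F2 : ℝ} (h1 : 0 < V1) (h2 : 0 < V2) :
    V1 * V2 / (V1 + V2) * (F1 / V1 - F2 / V2) ^ 2
      = F1 ^ 2 / V1 + F2 ^ 2 / V2 - (F1 + F2) ^ 2 / (V1 + V2) := by
  field_simp
  ring

/-- When the second child is cut off, its average is uncontrolled and only its mass `G2` is usable.
The surviving average costs M (F1/V1)² ≤ a² V2. With r the average over the parent, the energy lost
is 2 r F2 minus squares, hence at most 2 a G2. -/
theorem bessel_one {V1 V2 F1 F2 G1 G2 a M : ℝ} (h1 : 0 < V1) (h2 : 0 < V2)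
    (hF2 : |F2| ≤ G2) (hM : M ≤ V2) (ha : 0 ≤ a)
    (hF1 : |F1 / V1| ≤ a) (hF : |(F1 + F2) / (V1 + V2)| ≤ a) :
    M * (F1 / V1) ^ 2 + (a ^ 2 * V1 + 2 * a * G1 - F1 ^ 2 / V1)
      ≤ a ^ 2 * (V1 + V2) + 2 * a * (G1 + G2) - (F1 + F2) ^ 2 / (V1 + V2) := by
  set r := (F1 + F2) / (V1 + V2) with hr
  set q := F1 / V1 with hq
  have e1 : F1 = q * V1 := by rw [hq]; field_simp
  have e2 : F1 + F2 = r * (V1 + V2) := by rw [hr]; field_simp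
  have e3 : F1 ^ 2 / V1 = q ^ 2 * V1 := by rw [e1]; field_simp
  have e4 : (F1 + F2) ^ 2 / (V1 + V2) = r ^ 2 * (V1 + V2) := by rw [e2]; field_simp
  rw [e3, e4]
  have hq2 : q ^ 2 ≤ a ^ 2 := sq_le_sq' (abs_le.1 hF1).1 (abs_le.1 hF1).2
  have h3 : M * q ^ 2 ≤ V2 * a ^ 2 := by
    calc M * q ^ 2 ≤ V2 * q ^ 2 := by gcongr
      _ ≤ _ := by gcongr
  have h4 : r * F2 ≤ a * G2 := by
    calc r * F2 ≤ |r| * |F2| := by rw [← abs_mul]; exact le_abs_self _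
      _ ≤ _ := by gcongr
  have h5 : r ^ 2 * (V1 + V2) = r * (F1 + F2) := by rw [e2]; ring
  have h6 : F1 + F2 = r * V1 + r * V2 := by rw [e2]; ring
  have h7 : r ^ 2 * (V1 + V2) = 2 * (r * (q * V1)) + 2 * (r * F2) - r ^ 2 * V1 - r ^ 2 * V2 := by
    rw [← e1]; linear_combination 2 * h5
  have h8 := mul_nonneg h1.le (sq_nonneg (q - r))
  have h9 := mul_nonneg h2.le (sq_nonneg r)
  linarith

/-- Bessel's inequality for truncated martingale differences. -/
theorem bessel (hV : Additive V) (hV0 : ∀ I, 0 < V I) (hF : Additive F) (hF₁ : Additive F₁)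
    (hFF : ∀ I, |F I| ≤ F₁ I) {a : ℝ} (ha : 0 ≤ a) {G : Dyadic → Prop} {Q : Dyadic}
    (hG : ∀ R, Sub R Q → ¬ G R → ¬ G R.left ∧ ¬ G R.right)
    (hGa : ∀ R, Sub R Q → G R → avg V F₁ R ≤ a) (n : ℕ) {R : Dyadic} (hR : Sub R Q) :
    ∑ J ∈ tree n R, hm V J * (mavg V F G J.left - mavg V F G J.right) ^ 2 ≤ 3 * a ^ 2 * V R := by
  classical
  have hF0 : ∀ I, 0 ≤ F₁ I := fun I => (abs_nonneg _).trans (hFF I)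
  have hGa' : ∀ R, Sub R Q → G R → |F R / V R| ≤ a := fun R h h' =>
    (abs_avg_le hV0 hFF R).trans (hGa R h h')
  -- Potential for the induction: the energy -F²/V telescopes, and a² V + 2 a F₁ is an additive
  -- budget that pays for every cut-off child.
  have key : ∀ n R, Sub R Q →
      ∑ J ∈ tree n R, hm V J * (mavg V F G J.left - mavg V F G J.right) ^ 2
        ≤ if G R then a ^ 2 * V R + 2 * a * F₁ R - F R ^ 2 / V R else 0 := by
    intro n
    have hpos : ∀ R, Sub R Q → G R → 0 ≤ a ^ 2 * V R + 2 * a * F₁ R - F R ^ 2 / V R := by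
      intro R hR hGR
      have h1 := hGa' R hR hGR
      have h2 : F R ^ 2 / V R = (F R / V R) ^ 2 * V R := by
        have := (hV0 R).ne'
        field_simp
      rw [h2]
      have h3 : (F R / V R) ^ 2 ≤ a ^ 2 := sq_le_sq' (abs_le.1 h1).1 (abs_le.1 h1).2
      have := mul_le_mul_of_nonneg_right h3 (hV0 R).le
      have := mul_nonneg ha (hF0 R)
      linarith
    induction n with
    | zero =>
      intro R hR
      simp only [tree, Finset.sum_empty]
      split_ifs with h
      · exact hpos R hR h
      · exact le_rfl
    | succ n ih =>
      intro R hR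
      rw [sum_tree_succ]
      have hl := ih R.left hR.left
      have hr := ih R.right hR.right
      by_cases hGR : G R
      · rw [if_pos hGR]
        have hRa := hGa' R hR hGR
        have hVR := hV R
        have hFR := hF R
        have hF₁R := hF₁ R
        rw [hVR, hFR] at hRa
        by_cases h1 : G R.left <;> by_cases h2 : G R.right
        · rw [if_pos h1] at hl
          rw [if_pos h2] at hr
          have e : hm V R * (mavg V F G R.left - mavg V F G R.right) ^ 2 =
              F R.left ^ 2 / V R.left + F R.right ^ 2 / V R.right - F R ^ 2 / V R := by
            simp only [mavg, if_pos h1, if_pos h2, avg, hm]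
            rw [hVR, hFR]
            exact bessel_both (hV0 _) (hV0 _)
          rw [e, hF₁R, hVR]
          rw [hVR] at *
          linarith
        · rw [if_pos h1] at hl
          rw [if_neg h2] at hr
          have := bessel_one (G1 := F₁ R.left) (hV0 R.left) (hV0 R.right) (hFF R.right) (hm_le_right hV hV0 R) ha
            (hGa' _ hR.left h1) hRa
          simp only [mavg, if_pos h1, if_neg h2, avg, sub_zero] at hl hr ⊢
          rw [hF₁R, hVR, hFR]
          linarith
        · rw [if_neg h1] at hl
          rw [if_pos h2] at hr
          have := bessel_one (G1 := F₁ R.right) (hV0 R.right) (hV0 R.left) (hFF R.left) (hm_le_left hV hV0 R) ha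
            (hGa' _ hR.right h2) (by rw [add_comm, add_comm (V R.right)]; exact hRa)
          simp only [mavg, if_pos h2, if_neg h1, avg, zero_sub, neg_sq] at hl hr ⊢
          rw [hF₁R, hVR, hFR]
          rw [add_comm (V R.left), add_comm (F₁ R.left), add_comm (F R.left)]
          linarith
        · rw [if_neg h1] at hl
          rw [if_neg h2] at hr
          have := hpos R hR hGR
          simp only [mavg, if_neg h1, if_neg h2, sub_zero] at hl hr ⊢
          simp only [ne_eq, OfNat.ofNat_ne_zero, not_false_eq_true, zero_pow, mul_zero]
          linarith
      · obtain ⟨h1, h2⟩ := hG R hR hGR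
        rw [if_neg h1] at hl
        rw [if_neg h2] at hr
        rw [if_neg hGR]
        simp only [mavg, if_neg h1, if_neg h2, sub_zero] at hl hr ⊢
        simp only [ne_eq, OfNat.ofNat_ne_zero, not_false_eq_true, zero_pow, mul_zero]
        linarith
  -- At the root F₁ ≤ a V, so the budget is at most 3 a² V.
  refine (key n R hR).trans ?_
  split_ifs with h
  · have h1 := hGa R hR h
    rw [avg, div_le_iff₀ (hV0 R)] at h1
    have h2 : 0 ≤ F R ^ 2 / V R := div_nonneg (sq_nonneg _) (hV0 R).le
    have h3 := mul_le_mul_of_nonneg_left h1 ha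
    linarith
  · have := (hV0 R).le
    positivity

end forms

/-! ### Sparse domination of Haar shifts. -/

/-- The part of the mask `W` where the stopping ancestor is `Q`. -/
def goodMask (st : Dyadic → Dyadic → Prop) (Q₀ : Dyadic) (W : Dyadic → Prop) (Q R : Dyadic) :
    Prop := stp st Q₀ R = Q ∧ W R

/-- The part of the mask `W` where the stopping ancestor is not `Q`. -/
def badMask (st : Dyadic → Dyadic → Prop) (Q₀ : Dyadic) (W : Dyadic → Prop) (Q R : Dyadic) :
    Prop := stp st Q₀ R ≠ Q ∧ W R

/-- `∑_{J ∈ 𝒟_s(I)} |⟨F, h_J⟩|` with the averages truncated to `P`. -/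
def diffSum (V F : Dyadic → ℝ) (P : Dyadic → Prop) (s : ℕ) (I : Dyadic) : ℝ :=
  ∑ J ∈ descendants s I, √(hm V J) * |mavg V F P J.left - mavg V F P J.right|

/-- The analogue of `diffSum` with a sum in place of a difference. -/
def addSum (V F : Dyadic → ℝ) (P : Dyadic → Prop) (s : ℕ) (I : Dyadic) : ℝ :=
  ∑ J ∈ descendants s I, √(hm V J) * (mavg V F P J.left + mavg V F P J.right)

theorem addSum_eq (V F : Dyadic → ℝ) (P : Dyadic → Prop) (s : ℕ) (I : Dyadic) :
    addSum V F P s I = ∑ J ∈ descendants (s + 1) I, √(hm V J.parent) * mavg V F P J := by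
  rw [sum_descendants_succ']
  simp only [addSum, parent_left, parent_right, mul_add]

theorem mask_ancestor {W : Dyadic → Prop} (hW : ∀ I, W I → W I.parent) {I A : Dyadic}
    (h : Sub I A) (hI : W I) : W A := by
  obtain ⟨j, rfl⟩ := h
  induction j with
  | zero => exact hI
  | succ j ih => rw [ancestor_succ']; exact hW _ ih

theorem sum_filter_tree_le {Q₀ Q : Dyadic} {st : Dyadic → Dyadic → Prop} [DecidablePred fun I => stp st Q₀ I = Q] (hQ : Sub Q Q₀) (n : ℕ)
    {φ : Dyadic → ℝ} (hφ : ∀ I, 0 ≤ φ I) :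
    ∑ I ∈ tree n Q₀ with stp st Q₀ I = Q, φ I ≤ ∑ I ∈ tree n Q, φ I := by
  refine Finset.sum_le_sum_of_subset_of_nonneg ?_ fun _ _ _ => hφ _
  intro I hI
  rw [Finset.mem_filter, mem_tree_iff] at hI
  rw [mem_tree_iff]
  have h1 := sub_stp (st := st) hI.1.1
  rw [hI.2] at h1
  have := hQ.scale_le
  exact ⟨h1, by omega⟩

section

variable {V F F₁ H H₁ : Dyadic → ℝ} {st : Dyadic → Dyadic → Prop} {Q₀ : Dyadic}
  {WF WH W : Dyadic → Prop} {D : ℝ} {N s t : ℕ}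

theorem addSum_nonneg (hV0 : ∀ I, 0 < V I) (hF : ∀ I, 0 ≤ F I) (P : Dyadic → Prop) (s : ℕ)
    (I : Dyadic) : 0 ≤ addSum V F P s I :=
  Finset.sum_nonneg fun _ _ => mul_nonneg (Real.sqrt_nonneg _)
    (add_nonneg (mavg_nonneg hV0 hF _ _) (mavg_nonneg hV0 hF _ _))

theorem diffSum_nonneg (P : Dyadic → Prop) (s : ℕ)
    (I : Dyadic) : 0 ≤ diffSum V F P s I :=
  Finset.sum_nonneg fun _ _ => mul_nonneg (Real.sqrt_nonneg _) (abs_nonneg _)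

/-- Cancellation is kept only where averages are controlled by those of `Q`. The uncontrolled part
is estimated by size. -/
theorem diffSum_le (hV0 : ∀ I, 0 < V I) (hFF : ∀ I, |F I| ≤ F₁ I) (Q : Dyadic) (s : ℕ)
    (I : Dyadic) :
    diffSum V F W s I ≤
      diffSum V F (goodMask st Q₀ W Q) s I + addSum V F₁ (badMask st Q₀ W Q) s I := by
  have hsplit : ∀ R, mavg V F W R
      = mavg V F (goodMask st Q₀ W Q) R + mavg V F (badMask st Q₀ W Q) R := by
    intro R
    unfold mavg goodMask badMask
    by_cases h1 : W R <;> by_cases h2 : stp st Q₀ R = Q <;> simp [h1, h2]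
  have hle : ∀ R, |mavg V F (badMask st Q₀ W Q) R| ≤ mavg V F₁ (badMask st Q₀ W Q) R := by
    intro R
    unfold mavg
    split_ifs
    · exact abs_avg_le hV0 hFF R
    · simp
  unfold diffSum addSum
  rw [← Finset.sum_add_distrib]
  refine Finset.sum_le_sum fun J _ => ?_
  rw [← mul_add, hsplit J.left, hsplit J.right]
  refine mul_le_mul_of_nonneg_left ?_ (Real.sqrt_nonneg _)
  set a := mavg V F (goodMask st Q₀ W Q) J.left
  set b := mavg V F (goodMask st Q₀ W Q) J.right
  have h1 := hle J.left
  have h2 := hle J.right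
  set c := mavg V F (badMask st Q₀ W Q) J.left
  set d := mavg V F (badMask st Q₀ W Q) J.right
  calc |a + c - (b + d)| = |(a - b) + (c - d)| := by ring_nf
    _ ≤ |a - b| + |c - d| := abs_add_le _ _
    _ ≤ |a - b| + (|c| + |d|) := by gcongr; exact abs_sub _ _
    _ ≤ _ := by linarith

-- Bessel's inequality with a equal to four times the average over `Q`; 48 = 3 · 4², and 2 ^ N comes
-- from Cauchy–Schwarz over the 2 ^ s intervals `J`. If the mask fails at `Q` it fails everywhere
-- below, so the masked average may stand on the right.
open Classical in
theorem sum_sq_diffSum_le (hV : Additive V) (hV0 : ∀ I, 0 < V I) (hF : Additive F)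
    (hF₁ : Additive F₁) (hFF : ∀ I, |F I| ≤ F₁ I) (hW : ∀ I, W I → W I.parent)
    (h4 : ∀ I, Sub I Q₀ → avg V F₁ I ≤ 4 * avg V F₁ (stp st Q₀ I)) {Q : Dyadic} (hQ : Sub Q Q₀)
    (hs : s ≤ N) (n : ℕ) :
    ∑ I ∈ tree n Q₀ with stp st Q₀ I = Q, diffSum V F (goodMask st Q₀ W Q) s I ^ 2
      ≤ 2 ^ N * (48 * mavg V F₁ W Q ^ 2 * V Q) := by
  have hF0 : ∀ I, 0 ≤ F₁ I := fun I => (abs_nonneg _).trans (hFF I)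
  set P := goodMask st Q₀ W Q with hP
  have h1 : ∀ I, diffSum V F P s I ^ 2 ≤ 2 ^ N * ∑ J ∈ descendants s I,
      hm V J * (mavg V F P J.left - mavg V F P J.right) ^ 2 := by
    intro I
    refine sq_sum_le_card_mul_sum_sq.trans ?_
    rw [card_descendants]
    push_cast
    have : ∀ J, (√(hm V J) * |mavg V F P J.left - mavg V F P J.right|) ^ 2
        = hm V J * (mavg V F P J.left - mavg V F P J.right) ^ 2 := fun J => by
      rw [mul_pow, sq_abs, Real.sq_sqrt (hm_nonneg hV0 J)]
    simp only [this]
    refine mul_le_mul_of_nonneg_right ?_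
      (Finset.sum_nonneg fun J _ => mul_nonneg (hm_nonneg hV0 J) (sq_nonneg _))
    exact pow_le_pow_right₀ (by norm_num) hs
  refine (Finset.sum_le_sum fun I _ => h1 I).trans ?_
  rw [← Finset.mul_sum]
  refine mul_le_mul_of_nonneg_left ?_ (by positivity)
  refine (sum_filter_tree_le hQ n fun I => Finset.sum_nonneg fun J _ =>
    mul_nonneg (hm_nonneg hV0 J) (sq_nonneg _)).trans ?_
  refine (sum_tree_descendants_le n s Q fun J =>
    mul_nonneg (hm_nonneg hV0 J) (sq_nonneg _)).trans ?_
  have hchild : ∀ R C, Sub R Q → C.parent = R → ¬ P R → ¬ P C := by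
    rintro R C hR rfl hn ⟨hC, hWC⟩
    refine hn ⟨?_, hW _ hWC⟩
    have hCQ : Sub C Q₀ := (sub_parent C).trans (hR.trans hQ)
    have := stp_convex (st := st) hCQ (sub_parent C) (by rw [hC]; exact hR)
    rw [this, hC]
  have := bessel hV hV0 hF hF₁ hFF (a := 4 * mavg V F₁ W Q) (G := P) (Q := Q)
    (mul_nonneg (by norm_num) (mavg_nonneg hV0 hF0 _ _))
    (fun R hR hn => ⟨hchild R _ hR (parent_left R) hn, hchild R _ hR (parent_right R) hn⟩)
    (fun R hR hG => ?_) (n + s) (Sub.refl Q)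
  · refine this.trans (le_of_eq ?_)
    ring
  · have h := h4 R (hR.trans hQ)
    rw [hG.1] at h
    rwa [mavg, if_pos (mask_ancestor hW hR hG.2)]

open Classical in
theorem sum_diffSum_mul_diffSum_le (hV : Additive V) (hV0 : ∀ I, 0 < V I) (hF : Additive F)
    (hF₁ : Additive F₁) (hFF : ∀ I, |F I| ≤ F₁ I) (hH : Additive H)
    (hH₁ : Additive H₁) (hHH : ∀ I, |H I| ≤ H₁ I)
    (hWF : ∀ I, WF I → WF I.parent) (hWH : ∀ I, WH I → WH I.parent)
    (hF4 : ∀ I, Sub I Q₀ → avg V F₁ I ≤ 4 * avg V F₁ (stp st Q₀ I))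
    (hH4 : ∀ I, Sub I Q₀ → avg V H₁ I ≤ 4 * avg V H₁ (stp st Q₀ I))
    {Q : Dyadic} (hQ : Sub Q Q₀) (hst : s + t ≤ N) (n : ℕ) :
    ∑ I ∈ tree n Q₀ with stp st Q₀ I = Q,
        diffSum V F (goodMask st Q₀ WF Q) s I * diffSum V H (goodMask st Q₀ WH Q) t I
      ≤ 48 * 2 ^ N * (V Q * mavg V F₁ WF Q * mavg V H₁ WH Q) := by
  have h1 := sum_sq_diffSum_le hV hV0 hF hF₁ hFF hWF hF4 hQ (by omega : s ≤ N) n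
  have h2 := sum_sq_diffSum_le hV hV0 hH hH₁ hHH hWH hH4 hQ (by omega : t ≤ N) n
  refine (Real.sum_mul_le_sqrt_mul_sqrt _ _ _).trans ?_
  refine (mul_le_mul (Real.sqrt_le_sqrt h1) (Real.sqrt_le_sqrt h2) (Real.sqrt_nonneg _)
    (Real.sqrt_nonneg _)).trans (le_of_eq ?_)
  have hα := mavg_nonneg hV0 (fun I => (abs_nonneg _).trans (hFF I)) WF Q
  have hβ := mavg_nonneg hV0 (fun I => (abs_nonneg _).trans (hHH I)) WH Q
  have hVQ := hV0 Q
  rw [← Real.sqrt_mul (by positivity), Real.sqrt_eq_iff_mul_self_eq (by positivity) (by positivity)]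
  ring

/-- The form in which balance is used: both values of `hm` are moved to the same near interval `J`.
-/
theorem sqrt_hm_mul_le (hV0 : ∀ I, 0 < V I) (hD : ∀ I J, Near (N + 2) I J → hm V I ≤ D * hm V J)
    {A B J : Dyadic} (hA : Near (N + 2) A J) (hB : Near (N + 2) B J) :
    √(hm V A) * √(hm V B) ≤ D * hm V J := by
  rw [← Real.sqrt_mul (hm_nonneg hV0 _)]
  have h1 := hD _ _ hA
  have h2 := hD _ _ hB
  have h0 := (hm_nonneg hV0 A).trans h1
  refine Real.sqrt_le_iff.2 ⟨h0, ?_⟩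
  rw [sq]
  exact mul_le_mul h1 h2 (hm_nonneg hV0 _) h0

-- A good difference is at most 8 times the average of `H₁` over `Q`. Balance gives √m(J.parent)
-- √m(K) ≤ D V(J) for each bad `J`, so the average over `J` becomes the mass `F₁ J`. There are at
-- most 2 ^ N intervals `K`, and the bad `J` overlap at most N + 1 times inside `Q`.
open Classical in
theorem sum_addSum_mul_diffSum_le (hV : Additive V) (hV0 : ∀ I, 0 < V I)
    (hF₁ : Additive F₁) (hF0 : ∀ I, 0 ≤ F₁ I) (hHH : ∀ I, |H I| ≤ H₁ I)
    (hWF : ∀ I, WF I → WF I.parent) (hWH : ∀ I, WH I → WH I.parent)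
    (hH4 : ∀ I, Sub I Q₀ → avg V H₁ I ≤ 4 * avg V H₁ (stp st Q₀ I))
    (hD1 : 0 ≤ D) (hD : ∀ I J, Near (N + 2) I J → hm V I ≤ D * hm V J)
    {Q : Dyadic} (hQ : Sub Q Q₀) (hst : s + t ≤ N) (n : ℕ) :
    ∑ I ∈ tree n Q₀ with stp st Q₀ I = Q,
        addSum V F₁ (badMask st Q₀ WF Q) s I * diffSum V H (goodMask st Q₀ WH Q) t I
      ≤ 8 * 2 ^ N * D * (N + 1) * (V Q * mavg V F₁ WF Q * mavg V H₁ WH Q) := by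
  set P := badMask st Q₀ WF Q with hP
  set β := mavg V H₁ WH Q with hβ
  have hβ0 : 0 ≤ β := mavg_nonneg hV0 (fun I => (abs_nonneg _).trans (hHH I)) WH Q
  have hgood : ∀ R, Sub R Q₀ → |mavg V H (goodMask st Q₀ WH Q) R| ≤ 4 * β := by
    intro R hR
    unfold mavg
    split_ifs with h
    · refine (abs_avg_le hV0 hHH R).trans ((hH4 R hR).trans ?_)
      have h1 := sub_stp (st := st) hR
      rw [h.1] at h1
      rw [h.1, hβ, mavg, if_pos (mask_ancestor hWH h1 h.2)]
    · simp only [abs_zero]; positivity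
  have h1 : ∀ I, Sub I Q₀ →
      addSum V F₁ P s I * diffSum V H (goodMask st Q₀ WH Q) t I
        ≤ 8 * 2 ^ N * D * β * ∑ J ∈ descendants (s + 1) I, if P J then F₁ J else 0 := by
    intro I hI
    rw [addSum_eq, diffSum, Finset.sum_mul_sum, Finset.mul_sum]
    refine Finset.sum_le_sum fun J hJ => ?_
    rw [mem_descendants] at hJ
    have hJ' : ancestor s J.parent = I := hJ
    have hterm : ∀ K ∈ descendants t I, √(hm V J.parent) * mavg V F₁ P J *
        (√(hm V K) * |mavg V H (goodMask st Q₀ WH Q) K.left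
          - mavg V H (goodMask st Q₀ WH Q) K.right|)
        ≤ 8 * D * β * (if P J then F₁ J else 0) := by
      intro K hK
      rw [mem_descendants] at hK
      have hKQ : Sub K Q₀ := Sub.trans ⟨t, hK⟩ hI
      have e1 : |mavg V H (goodMask st Q₀ WH Q) K.left - mavg V H (goodMask st Q₀ WH Q) K.right|
          ≤ 8 * β := by
        refine (abs_sub _ _).trans ?_
        have := hgood _ hKQ.left
        have := hgood _ hKQ.right
        linarith
      have e2 : √(hm V J.parent) * √(hm V K) ≤ D * V J := by
        refine (sqrt_hm_mul_le hV0 hD (J := J) ?_ ?_).trans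
          (mul_le_mul_of_nonneg_left (hm_le hV hV0 J) hD1)
        · exact ⟨0, 1, by omega, rfl⟩
        · exact ⟨t, s + 1, by omega, hK.trans hJ.symm⟩
      have e3 : V J * mavg V F₁ P J = if P J then F₁ J else 0 := by
        unfold mavg
        split_ifs
        · exact avg_mul hV0 _ _
        · simp
      have e4 : 0 ≤ mavg V F₁ P J := mavg_nonneg hV0 hF0 _ _
      have e0 := (hV0 J).le
      calc _ = (√(hm V J.parent) * √(hm V K)) * mavg V F₁ P J * |mavg V H (goodMask st Q₀ WH Q) K.left
            - mavg V H (goodMask st Q₀ WH Q) K.right| := by ring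
        _ ≤ (D * V J) * mavg V F₁ P J * (8 * β) := by gcongr
        _ = 8 * D * β * (V J * mavg V F₁ P J) := by ring
        _ = _ := by rw [e3]
    refine (Finset.sum_le_sum hterm).trans ?_
    rw [Finset.sum_const, card_descendants, nsmul_eq_mul]
    have e5 : 0 ≤ (if P J then F₁ J else 0) := by split_ifs; exacts [hF0 J, le_rfl]
    have e6 : ((2 ^ t : ℕ) : ℝ) ≤ 2 ^ N := by
      push_cast
      exact pow_le_pow_right₀ (by norm_num) (by omega)
    calc _ ≤ (2 : ℝ) ^ N * (8 * D * β * (if P J then F₁ J else 0)) := by gcongr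
      _ = _ := by ring
  have h2 : ∑ I ∈ tree n Q₀ with stp st Q₀ I = Q, ∑ J ∈ descendants (s + 1) I,
      (if P J then F₁ J else 0) ≤ (N + 1) * (V Q * mavg V F₁ WF Q) := by
    have hnn : ∀ J, 0 ≤ (if P J then F₁ J else 0) := by
      intro J; split_ifs; exacts [hF0 J, le_rfl]
    by_cases hWQ : WF Q
    · rw [mavg, if_pos hWQ, avg_mul hV0]
      set P' : Dyadic → Prop := fun J => P J ∧ stp st Q₀ (ancestor (s + 1) J) = Q ∧
        Sub (ancestor (s + 1) J) Q₀ with hP'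
      have e1 : ∑ I ∈ tree n Q₀ with stp st Q₀ I = Q, ∑ J ∈ descendants (s + 1) I,
          (if P J then F₁ J else 0) = ∑ I ∈ tree n Q₀ with stp st Q₀ I = Q,
            ∑ J ∈ descendants (s + 1) I, (if P' J then F₁ J else 0) := by
        refine Finset.sum_congr rfl fun I hI => Finset.sum_congr rfl fun J hJ => ?_
        rw [mem_descendants] at hJ
        rw [Finset.mem_filter, mem_tree_iff] at hI
        have : P' J ↔ P J := by simp [hP', hJ, hI.2, hI.1.1]
        simp only [this]
      rw [e1]
      have hnn' : ∀ J, 0 ≤ (if P' J then F₁ J else 0) := by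
        intro J; split_ifs; exacts [hF0 J, le_rfl]
      refine (sum_filter_tree_le hQ n fun I => Finset.sum_nonneg fun J _ => hnn' J).trans ?_
      refine (sum_tree_descendants_le n (s + 1) Q hnn').trans ?_
      rw [← Finset.sum_filter]
      -- An ancestor of `J` at least s + 1 generations up contains an interval that belongs to `Q`.
      -- If the ancestor also lies inside `Q`, convexity makes it belong to `Q`, so it cannot be
      -- bad.
      have hcnt : ∀ J, P' J → ∀ i, s + 1 ≤ i → ¬ P' (ancestor i J) := by
        rintro J ⟨hPJ, hJQ, hJ0⟩ i hi ⟨hPi, hiQ, hi0⟩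
        refine hPi.1 ?_
        have h5 : Sub (ancestor (s + 1) J) (ancestor i J) :=
          ⟨i - (s + 1), by rw [← ancestor_add]; congr 1; omega⟩
        have h6 := stp_convex (st := st) hJ0 h5 (by
          rw [hJQ]
          have h7 := sub_stp (st := st) hi0
          rw [hiQ] at h7
          exact (sub_ancestor _ _).trans h7)
        rw [h6, hJQ]
      have hle := hF₁.sum_filter_le hF0 hcnt (n + (s + 1)) Q
      refine le_trans (le_of_eq ?_) (hle.trans ?_)
      · congr
      · have : ((s + 1 : ℕ) : ℝ) ≤ N + 1 := by
          have : s ≤ N := by omega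
          push_cast
          have : (s : ℝ) ≤ N := by exact_mod_cast this
          linarith
        exact mul_le_mul_of_nonneg_right this (hF0 Q)
    · rw [mavg, if_neg hWQ, mul_zero, mul_zero]
      refine (Finset.sum_nonpos fun I hI => Finset.sum_nonpos fun J hJ => ?_)
      rw [mem_descendants] at hJ
      rw [Finset.mem_filter, mem_tree_iff] at hI
      rw [if_neg]
      intro hPJ
      have h7 := sub_stp (st := st) hI.1.1
      rw [hI.2] at h7
      exact hWQ (mask_ancestor hWF (Sub.trans ⟨_, hJ⟩ h7) hPJ.2)
  refine (Finset.sum_le_sum fun I hI => h1 I ?_).trans ?_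
  · rw [Finset.mem_filter, mem_tree_iff] at hI
    exact hI.1.1
  · rw [← Finset.mul_sum]
    calc _ ≤ 8 * 2 ^ N * D * β * ((N + 1) * (V Q * mavg V F₁ WF Q)) := by gcongr
      _ = _ := by ring

open Classical in
/-- The sparse family: the intervals at most `N + 1` generations below their stopping ancestor. -/
def sparseFam (st : Dyadic → Dyadic → Prop) (Q₀ : Dyadic) (N n : ℕ) : Finset Dyadic :=
  (tree (n + N + 2) Q₀).filter fun J => J.scale ≤ (stp st Q₀ J).scale + N + 1

/-- The constant of the domination theorem. -/
def domConst (N : ℕ) (D : ℝ) : ℝ := 48 * 2 ^ N + 16 * 2 ^ N * D * (N + 1) + D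

open Classical in
/-- The form that dominates Haar shifts. -/
def domForm (V F₁ H₁ : Dyadic → ℝ) (WF WH : Dyadic → Prop) (N : ℕ) (S : Finset Dyadic) : ℝ :=
  ∑ J ∈ S, ∑ K ∈ S with Near (N + 2) J K, kap V J K * mavg V F₁ WF J * mavg V H₁ WH K

-- Bad intervals of `I` have a stopping interval strictly inside `I`, hence only a few generations
-- above them, and this puts them into `sparseFam`. They are s + 1 and t + 1 generations below `I`,
-- which is the origin of the distance N + 2.
open Classical in
theorem addSum_mul_addSum_le (hV : Additive V) (hV0 : ∀ I, 0 < V I) (hF0 : ∀ I, 0 ≤ F₁ I)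
    (hH0 : ∀ I, 0 ≤ H₁ I) (hD1 : 0 ≤ D)
    (hD : ∀ I J, Near (N + 2) I J → hm V I ≤ D * hm V J) (hst : s + t ≤ N) {n : ℕ} {I : Dyadic}
    (hI : I ∈ tree n Q₀) :
    addSum V F₁ (badMask st Q₀ WF (stp st Q₀ I)) s I
        * addSum V H₁ (badMask st Q₀ WH (stp st Q₀ I)) t I
      ≤ D * ∑ J ∈ descendants (s + 1) I, if J ∈ sparseFam st Q₀ N n then
          (∑ K ∈ sparseFam st Q₀ N n with Near (N + 2) J K,
            kap V J K * mavg V F₁ WF J * mavg V H₁ WH K) else 0 := by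
  have hIt := mem_tree_iff.1 hI
  set Q := stp st Q₀ I with hQ
  have hfam : ∀ (i : ℕ) (J : Dyadic) (W : Dyadic → Prop), i ≤ N → ancestor (i + 1) J = I →
      badMask st Q₀ W Q J → J ∈ sparseFam st Q₀ N n := by
    intro i J W hi hJ hb
    have hsc : J.scale = I.scale + (i + 1) := by rw [← hJ, scale_ancestor]; push_cast; ring
    have hJ0 : Sub J Q₀ := Sub.trans ⟨_, hJ⟩ hIt.1
    rw [sparseFam, Finset.mem_filter, mem_tree_iff]
    refine ⟨⟨hJ0, ?_⟩, ?_⟩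
    · have := hIt.2; push_cast; omega
    -- Otherwise `I` would lie between `J` and its stopping interval, and by convexity `I` and `J`
    -- would have the same one.
    · have h1 : I.scale < (stp st Q₀ J).scale := by
        by_contra hlt
        have h2 := (show Sub J I from ⟨_, hJ⟩).of_scale_le (sub_stp (st := st) hJ0) (by omega)
        exact hb.1 (stp_convex hJ0 ⟨_, hJ⟩ h2).symm
      omega
  have hnn : ∀ J K, 0 ≤ kap V J K * mavg V F₁ WF J * mavg V H₁ WH K := fun J K =>
    mul_nonneg (mul_nonneg (kap_nonneg hV0 _ _) (mavg_nonneg hV0 hF0 _ _))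
      (mavg_nonneg hV0 hH0 _ _)
  have hm1 : ∀ (G : Dyadic → ℝ) (W : Dyadic → Prop) J, badMask st Q₀ W Q J →
      mavg V G (badMask st Q₀ W Q) J = mavg V G W J := by
    intro G W J h
    simp only [mavg, if_pos h, if_pos h.2]
  rw [addSum_eq, addSum_eq, Finset.sum_mul_sum, Finset.mul_sum]
  refine Finset.sum_le_sum fun J hJ => ?_
  rw [mem_descendants] at hJ
  by_cases hb : badMask st Q₀ WF Q J
  · rw [if_pos (hfam s J WF (by omega) hJ hb), Finset.mul_sum]
    have hle : ∀ K ∈ descendants (t + 1) I, √(hm V J.parent) * mavg V F₁ (badMask st Q₀ WF Q) J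
        * (√(hm V K.parent) * mavg V H₁ (badMask st Q₀ WH Q) K) ≤
        if K ∈ (sparseFam st Q₀ N n).filter (fun K => Near (N + 2) J K) then
          D * (kap V J K * mavg V F₁ WF J * mavg V H₁ WH K) else 0 := by
      intro K hK
      rw [mem_descendants] at hK
      by_cases hbK : badMask st Q₀ WH Q K
      · have hJK : Near (N + 2) J K := ⟨s + 1, t + 1, by omega, hJ.trans hK.symm⟩
        rw [if_pos (Finset.mem_filter.2 ⟨hfam t K WH (by omega) hK hbK, hJK⟩), hm1 _ _ _ hb,
          hm1 _ _ _ hbK]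
        -- On the diagonal the bound through `hm V J ≤ V J` is wasteful but free, since the good
        -- parts require the coefficient `V J` there anyway.
        have e : √(hm V J.parent) * √(hm V K.parent) ≤ D * kap V J K := by
          unfold kap
          split_ifs with hJKe
          · refine (sqrt_hm_mul_le hV0 hD (J := J) ⟨0, 1, by omega, rfl⟩
              ⟨0, 1, by omega, by rw [hJKe]; rfl⟩).trans ?_
            exact mul_le_mul_of_nonneg_left (hm_le hV hV0 J) hD1
          · have a1 : √(hm V J.parent) ≤ √D * √(hm V J) := by
              rw [← Real.sqrt_mul hD1]
              exact Real.sqrt_le_sqrt (hD _ _ ⟨0, 1, by omega, rfl⟩)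
            have a2 : √(hm V K.parent) ≤ √D * √(hm V K) := by
              rw [← Real.sqrt_mul hD1]
              exact Real.sqrt_le_sqrt (hD _ _ ⟨0, 1, by omega, rfl⟩)
            calc _ ≤ (√D * √(hm V J)) * (√D * √(hm V K)) := by gcongr
              _ = (√D * √D) * (√(hm V J) * √(hm V K)) := by ring
              _ = _ := by rw [Real.mul_self_sqrt hD1]
        have e4 : 0 ≤ mavg V F₁ WF J := mavg_nonneg hV0 hF0 _ _
        have e5 : 0 ≤ mavg V H₁ WH K := mavg_nonneg hV0 hH0 _ _
        calc _ = (√(hm V J.parent) * √(hm V K.parent)) * mavg V F₁ WF J * mavg V H₁ WH K := by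
              ring
          _ ≤ (D * kap V J K) * mavg V F₁ WF J * mavg V H₁ WH K := by gcongr
          _ = _ := by ring
      · have : mavg V H₁ (badMask st Q₀ WH Q) K = 0 := by rw [mavg, if_neg hbK]
        rw [this]
        simp only [mul_zero]
        split_ifs
        · exact mul_nonneg hD1 (hnn _ _)
        · exact le_rfl
    refine (Finset.sum_le_sum hle).trans ?_
    rw [← Finset.sum_filter]
    refine Finset.sum_le_sum_of_subset_of_nonneg ?_ fun _ _ _ => mul_nonneg hD1 (hnn _ _)
    intro K hK
    exact (Finset.mem_filter.1 hK).2
  · have : mavg V F₁ (badMask st Q₀ WF Q) J = 0 := by rw [mavg, if_neg hb]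
    rw [this]
    simp only [mul_zero, zero_mul, Finset.sum_const_zero]
    refine mul_nonneg hD1 ?_
    split_ifs
    · exact Finset.sum_nonneg fun K _ => hnn _ _
    · exact le_rfl

open Classical in
/-- Sparse domination of the absolute form of a Haar shift. -/
theorem domination (hV : Additive V) (hV0 : ∀ I, 0 < V I) (hF : Additive F)
    (hF₁ : Additive F₁) (hFF : ∀ I, |F I| ≤ F₁ I) (hH : Additive H)
    (hH₁ : Additive H₁) (hHH : ∀ I, |H I| ≤ H₁ I)
    (hWF : ∀ I, WF I → WF I.parent) (hWH : ∀ I, WH I → WH I.parent)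
    (hF4 : ∀ I, Sub I Q₀ → avg V F₁ I ≤ 4 * avg V F₁ (stp st Q₀ I))
    (hH4 : ∀ I, Sub I Q₀ → avg V H₁ I ≤ 4 * avg V H₁ (stp st Q₀ I))
    (hD1 : 0 ≤ D) (hD : ∀ I J, Near (N + 2) I J → hm V I ≤ D * hm V J)
    (hst : s + t ≤ N) (n : ℕ) :
    ∑ I ∈ tree n Q₀, diffSum V F WF s I * diffSum V H WH t I
      ≤ domConst N D * domForm V F₁ H₁ WF WH N (sparseFam st Q₀ N n) := by
  have hF0 : ∀ I, 0 ≤ F₁ I := fun I => (abs_nonneg _).trans (hFF I)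
  have hH0 : ∀ I, 0 ≤ H₁ I := fun I => (abs_nonneg _).trans (hHH I)
  set S := sparseFam st Q₀ N n with hS
  set Λ := domForm V F₁ H₁ WF WH N S with hΛ
  have hnn : ∀ J K, 0 ≤ kap V J K * mavg V F₁ WF J * mavg V H₁ WH K := fun J K =>
    mul_nonneg (mul_nonneg (kap_nonneg hV0 _ _) (mavg_nonneg hV0 hF0 _ _))
      (mavg_nonneg hV0 hH0 _ _)
  set g : Dyadic → Dyadic → ℝ := fun Q I =>
    diffSum V F (goodMask st Q₀ WF Q) s I * diffSum V H (goodMask st Q₀ WH Q) t I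
      + addSum V F₁ (badMask st Q₀ WF Q) s I * diffSum V H (goodMask st Q₀ WH Q) t I
      + addSum V H₁ (badMask st Q₀ WH Q) t I * diffSum V F (goodMask st Q₀ WF Q) s I with hg
  have hsplit : ∀ I ∈ tree n Q₀, diffSum V F WF s I * diffSum V H WH t I ≤
      g (stp st Q₀ I) I + D * ∑ J ∈ descendants (s + 1) I, if J ∈ S then
          (∑ K ∈ S with Near (N + 2) J K,
            kap V J K * mavg V F₁ WF J * mavg V H₁ WH K) else 0 := by
    intro I hI
    refine le_trans ?_ (add_le_add le_rfl (addSum_mul_addSum_le hV hV0 hF0 hH0 hD1 hD hst hI))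
    refine (mul_le_mul (diffSum_le (st := st) (Q₀ := Q₀) hV0 hFF (stp st Q₀ I) s I)
      (diffSum_le (st := st) (Q₀ := Q₀) hV0 hHH (stp st Q₀ I) t I) (diffSum_nonneg _ _ _)
      (add_nonneg (diffSum_nonneg _ _ _) (addSum_nonneg hV0 hF0 _ _ _))).trans (le_of_eq ?_)
    simp only [hg]
    ring
  refine (Finset.sum_le_sum hsplit).trans ?_
  rw [Finset.sum_add_distrib, ← Finset.mul_sum]
  have hbad : ∑ I ∈ tree n Q₀, ∑ J ∈ descendants (s + 1) I, (if J ∈ S then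
          (∑ K ∈ S with Near (N + 2) J K,
            kap V J K * mavg V F₁ WF J * mavg V H₁ WH K) else 0) ≤ Λ := by
    refine (sum_tree_descendants_le n (s + 1) Q₀ (fun J => ?_)).trans ?_
    · split_ifs
      · exact Finset.sum_nonneg fun K _ => hnn _ _
      · exact le_rfl
    · rw [← Finset.sum_filter]
      refine Finset.sum_le_sum_of_subset_of_nonneg ?_ fun J _ _ =>
        Finset.sum_nonneg fun K _ => hnn _ _
      intro J hJ
      exact (Finset.mem_filter.1 hJ).2
  have hdiag : ∑ Q ∈ S, V Q * mavg V F₁ WF Q * mavg V H₁ WH Q ≤ Λ := by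
    refine Finset.sum_le_sum fun Q hQ => ?_
    have : V Q = kap V Q Q := by simp [kap]
    rw [this]
    exact Finset.single_le_sum (f := fun K => kap V Q K * mavg V F₁ WF Q * mavg V H₁ WH K)
      (fun K _ => hnn _ _) (Finset.mem_filter.2 ⟨hQ, Near.refl _ _⟩)
  -- The intervals `I` are grouped by their stopping interval; 48 comes from good against good, and
  -- 16 = 8 + 8 from the two mixed terms.
  have hgood : ∑ I ∈ tree n Q₀, g (stp st Q₀ I) I ≤
      (48 * 2 ^ N + 16 * 2 ^ N * D * (N + 1)) *
        ∑ Q ∈ S, V Q * mavg V F₁ WF Q * mavg V H₁ WH Q := by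
    have hmaps : ∀ I ∈ tree n Q₀, stp st Q₀ I ∈ S := by
      intro I hI
      rw [mem_tree_iff] at hI
      rw [hS, sparseFam, Finset.mem_filter, mem_tree_iff, stp_stp hI.1]
      have := (sub_stp (st := st) hI.1).scale_le
      refine ⟨⟨stp_sub hI.1, ?_⟩, ?_⟩ <;> push_cast <;> omega
    rw [← Finset.sum_fiberwise_of_maps_to hmaps, Finset.mul_sum]
    refine Finset.sum_le_sum fun Q hQ => ?_
    rw [hS, sparseFam, Finset.mem_filter, mem_tree_iff] at hQ
    have hQ0 := hQ.1.1
    have e1 := sum_diffSum_mul_diffSum_le hV hV0 hF hF₁ hFF hH hH₁ hHH hWF hWH hF4 hH4 hQ0 hst n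
    have e2 := sum_addSum_mul_diffSum_le hV hV0 hF₁ hF0 hHH hWF hWH hH4 hD1 hD hQ0 hst n
    have e3 := sum_addSum_mul_diffSum_le hV hV0 hH₁ hH0 hFF hWH hWF hF4 hD1 hD hQ0
      (by omega : t + s ≤ N) n
    have e4 : ∑ I ∈ tree n Q₀ with stp st Q₀ I = Q, g (stp st Q₀ I) I
        = ∑ I ∈ tree n Q₀ with stp st Q₀ I = Q, g Q I := by
      refine Finset.sum_congr rfl fun I hI => ?_
      rw [(Finset.mem_filter.1 hI).2]
    rw [e4]
    simp only [hg, Finset.sum_add_distrib]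
    linarith
  have hc : (0 : ℝ) ≤ 48 * 2 ^ N + 16 * 2 ^ N * D * (N + 1) := by positivity
  have := mul_le_mul_of_nonneg_left hdiag hc
  have := mul_le_mul_of_nonneg_left hbad hD1
  rw [domConst]
  linarith

end

/-! ### Sparseness of the stopping family. -/

/-- The measure of a dyadic interval, as a real number. -/
def vol (μ : Measure ℝ) (I : Dyadic) : ℝ := μ.real I.toSet

/-- Stop when the average of `F` or of `H` has grown by a factor `4`. -/
def stopRule (V F H : Dyadic → ℝ) (q I : Dyadic) : Prop :=
  4 * avg V F q < avg V F I ∨ 4 * avg V H q < avg V H I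

theorem stopRule_symm (V F H : Dyadic → ℝ) : stopRule V F H = stopRule V H F := by
  ext q I; exact or_comm

theorem avg_le_of_stopRule {V F H : Dyadic → ℝ} {Q₀ : Dyadic} (hV0 : ∀ I, 0 < V I)
    (hF : ∀ I, 0 ≤ F I) (I : Dyadic) (hI : Sub I Q₀) :
    avg V F I ≤ 4 * avg V F (stp (stopRule V F H) Q₀ I) := by
  rcases stp_eq_self_or (st := stopRule V F H) hI with h | h
  · rw [h]; linarith [avg_nonneg hV0 hF I]
  · exact not_lt.1 fun hlt => h (Or.inl hlt)

theorem avg_le_of_stopRule' {V F H : Dyadic → ℝ} {Q₀ : Dyadic} (hV0 : ∀ I, 0 < V I)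
    (hH : ∀ I, 0 ≤ H I) (I : Dyadic) (hI : Sub I Q₀) :
    avg V H I ≤ 4 * avg V H (stp (stopRule V F H) Q₀ I) := by
  rw [stopRule_symm]; exact avg_le_of_stopRule hV0 hH I hI

/-- The points whose stopping interval, seen from scale `k`, is `Q`. -/
def stopSet (st : Dyadic → Dyadic → Prop) (Q₀ : Dyadic) (k : ℤ) (Q : Dyadic) : Set ℝ :=
  {x | stp st Q₀ (cubeAt k x) = Q}

/-- The points whose stopping interval, seen from scale `k`, is `Q` or a stopping child of `Q`. -/
def stopSet₂ (st : Dyadic → Dyadic → Prop) (Q₀ : Dyadic) (k : ℤ) (Q : Dyadic) : Set ℝ :=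
  {x | stp st Q₀ (cubeAt k x) = Q ∨ stp st Q₀ (stp st Q₀ (cubeAt k x)).parent = Q}

section

variable {μ : Measure ℝ} [IsLocallyFiniteMeasure μ] {F H : Dyadic → ℝ} {Q₀ : Dyadic}

theorem measurableSet_stopSet (st : Dyadic → Dyadic → Prop) (Q₀ : Dyadic) (k : ℤ) (Q : Dyadic) :
    MeasurableSet (stopSet st Q₀ k Q) := measurable_cubeAt k {I | stp st Q₀ I = Q}

theorem measurableSet_stopSet₂ (st : Dyadic → Dyadic → Prop) (Q₀ : Dyadic) (k : ℤ) (Q : Dyadic) :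
    MeasurableSet (stopSet₂ st Q₀ k Q) :=
  measurable_cubeAt k {I | stp st Q₀ I = Q ∨ stp st Q₀ (stp st Q₀ I).parent = Q}

theorem additive_real_inter {A : Set ℝ} (hA : MeasurableSet A) :
    Additive fun I => μ.real (I.toSet ∩ A) := by
  intro I
  have h : I.toSet ∩ A = (I.left.toSet ∩ A) ∪ (I.right.toSet ∩ A) := by
    rw [I.toSet_eq_union, union_inter_distrib_right]
  have hfin : ∀ J : Dyadic, μ (J.toSet ∩ A) ≠ ∞ := fun J =>
    ((measure_mono inter_subset_left).trans_lt (measure_toSet_lt_top μ J)).ne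
  change μ.real (I.toSet ∩ A) = _
  rw [h, measureReal_union (I.disjoint_children.mono inter_subset_left inter_subset_left)
    (I.right.measurableSet_toSet.inter hA) (hfin _) (hfin _)]

theorem additive_vol : Additive (vol μ) := by
  have := additive_real_inter (μ := μ) MeasurableSet.univ
  simp only [inter_univ] at this
  exact this

/-- A stopping child `C` of `Q` has measure at most F(C)/(4⟨F⟩_Q) or H(C)/(4⟨H⟩_Q), so the stopping
children fill at most a quarter plus a quarter of `Q`. The remainder is observed at a finite scale
`k`, which avoids limits. -/
theorem vol_le_stopSet (hμ : ∀ I : Dyadic, 0 < μ I.toSet) (hF : Additive F) (hF0 : ∀ I, 0 ≤ F I)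
    (hH : Additive H) (hH0 : ∀ I, 0 ≤ H I) {Q : Dyadic} (hQ : Sub Q Q₀)
    (hQQ : stp (stopRule (vol μ) F H) Q₀ Q = Q) {k : ℤ} (hk : Q.scale ≤ k) :
    vol μ Q ≤ 2 * μ.real (Q.toSet ∩ stopSet (stopRule (vol μ) F H) Q₀ k Q) := by
  set st := stopRule (vol μ) F H with hst
  have hV := additive_vol (μ := μ)
  have hV0 : ∀ I, 0 < vol μ I := real_pos hμ
  -- If the average of `G` over `Q` is zero, `G` vanishes below `Q` and never causes a stop; the
  -- convention 1/0 = 0 then makes its term disappear.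
  have key : ∀ (G : Dyadic → ℝ), Additive G → (∀ I, 0 ≤ G I) → ∀ C, Sub C Q →
      4 * avg (vol μ) G Q < avg (vol μ) G C → vol μ C ≤ 1 / (4 * avg (vol μ) G Q) * G C := by
    intro G hG hG0 C hC h
    rcases (avg_nonneg hV0 hG0 Q).eq_or_lt with h0 | h0
    · have h1 : G Q = 0 := by rw [← avg_mul hV0 G Q, ← h0, mul_zero]
      have h2 : G C = 0 := le_antisymm (h1 ▸ hG.sub_le hG0 hC) (hG0 C)
      rw [← h0, avg, h2] at h
      simp at h
    · rw [one_div, inv_mul_eq_div, le_div_iff₀ (by positivity)]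
      rw [avg, avg, lt_div_iff₀ (hV0 C)] at h
      rw [mul_comm]
      exact h.le
  have main : ∀ n : ℕ, ∀ R, R.scale + n = k → Sub R Q₀ → stp st Q₀ R = Q →
      vol μ R ≤ μ.real (R.toSet ∩ stopSet st Q₀ k Q)
        + (1 / (4 * avg (vol μ) F Q) * F R + 1 / (4 * avg (vol μ) H Q) * H R) := by
    have hterm : ∀ R, 0 ≤ 1 / (4 * avg (vol μ) F Q) * F R + 1 / (4 * avg (vol μ) H Q) * H R := by
      intro R
      have := avg_nonneg hV0 hF0 Q
      have := avg_nonneg hV0 hH0 Q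
      have := hF0 R
      have := hH0 R
      positivity
    intro n
    induction n with
    | zero =>
      intro R hR hR0 hRQ
      have : R.toSet ∩ stopSet st Q₀ k Q = R.toSet := by
        refine inter_eq_left.2 fun x hx => ?_
        rw [mem_iff_cubeAt] at hx
        simp only [Nat.cast_zero, add_zero] at hR
        rw [hR] at hx
        simp only [stopSet, mem_ofPred_eq, hx, hRQ]
      rw [this]
      have := hterm R
      simp only [vol] at *
      linarith
    | succ n ih =>
      intro R hR hR0 hRQ
      have hchild : ∀ C, C.parent = R → C.scale = R.scale + 1 →
          vol μ C ≤ μ.real (C.toSet ∩ stopSet st Q₀ k Q)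
            + (1 / (4 * avg (vol μ) F Q) * F C + 1 / (4 * avg (vol μ) H Q) * H C) := by
        intro C hCR hCs
        have hCR0 : Sub C.parent Q₀ := hCR ▸ hR0
        have hC0 : Sub C Q₀ := (sub_parent C).trans hCR0
        have hCQ : Sub C Q := by
          have := sub_stp (st := st) hR0
          rw [hRQ] at this
          exact (sub_parent C).trans (hCR ▸ this)
        rcases stp_eq_or (st := st) hCR0 with h | h
        · rw [hCR, hRQ] at h
          have h0 : 0 ≤ μ.real (C.toSet ∩ stopSet st Q₀ k Q) := measureReal_nonneg
          have h1 := hF0 C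
          have h2 := hH0 C
          have h3 := avg_nonneg hV0 hF0 Q
          have h4 := avg_nonneg hV0 hH0 Q
          have h5 : 0 ≤ 1 / (4 * avg (vol μ) F Q) * F C := by positivity
          have h6 : 0 ≤ 1 / (4 * avg (vol μ) H Q) * H C := by positivity
          rcases h.1 with h | h
          · have := key F hF hF0 C hCQ h; linarith
          · have := key H hH hH0 C hCQ h; linarith
        · refine ih C ?_ hC0 ?_
          · rw [hCs]; push_cast at hR; linarith
          · rw [h.2, hCR, hRQ]
      have hl := hchild R.left (parent_left R) rfl
      have hr := hchild R.right (parent_right R) rfl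
      have e := additive_real_inter (μ := μ) (measurableSet_stopSet st Q₀ k Q) R
      rw [hV R, hF R, hH R]
      simp only at e
      rw [e]
      linarith
  have h := main (k - Q.scale).toNat Q (by omega) hQ hQQ
  have e : ∀ (G : Dyadic → ℝ), (∀ I, 0 ≤ G I) →
      1 / (4 * avg (vol μ) G Q) * G Q ≤ vol μ Q / 4 := by
    intro G hG0
    rcases (avg_nonneg hV0 hG0 Q).eq_or_lt with h0 | h0
    · rw [← h0]; have := (hV0 Q).le; simp only [mul_zero, div_zero, zero_mul]; positivity
    · rw [← avg_mul hV0 G Q]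
      refine le_of_eq ?_
      field_simp
  have := e F hF0
  have := e H hH0
  linarith

/-- `J` need not be a stopping interval, and the stopping children of its stopping interval may fill
it completely. Each such child inside `J` gives half of its own mass by `vol_le_stopSet`; for this
reason `stopSet₂` reaches one stopping level further down. -/
theorem vol_le_stopSet₂ (hμ : ∀ I : Dyadic, 0 < μ I.toSet) (hF : Additive F)
    (hF0 : ∀ I, 0 ≤ F I) (hH : Additive H) (hH0 : ∀ I, 0 ≤ H I) {k : ℤ} {J : Dyadic}
    (hJ : Sub J Q₀) (hk : J.scale ≤ k) :
    vol μ J ≤ 2 * μ.real (J.toSet ∩ stopSet₂ (stopRule (vol μ) F H) Q₀ k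
      (stp (stopRule (vol μ) F H) Q₀ J)) := by
  set st := stopRule (vol μ) F H with hst
  have hV := additive_vol (μ := μ)
  suffices main : ∀ n : ℕ, ∀ R Q, R.scale + n = k → Sub R Q₀ → stp st Q₀ R = Q →
      vol μ R ≤ 2 * μ.real (R.toSet ∩ stopSet₂ st Q₀ k Q) from
    main (k - J.scale).toNat J _ (by omega) hJ rfl
  intro n
  induction n with
  | zero =>
    intro R Q hR hR0 hRQ
    have : R.toSet ∩ stopSet₂ st Q₀ k Q = R.toSet := by
      refine inter_eq_left.2 fun x hx => ?_
      rw [mem_iff_cubeAt] at hx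
      simp only [Nat.cast_zero, add_zero] at hR
      rw [hR] at hx
      left
      simp only [hx, hRQ]
    rw [this]
    have : 0 ≤ vol μ R := measureReal_nonneg
    simp only [vol] at *
    linarith
  | succ n ih =>
    intro R Q hR hR0 hRQ
    have hchild : ∀ C, C.parent = R → C.scale = R.scale + 1 →
        vol μ C ≤ 2 * μ.real (C.toSet ∩ stopSet₂ st Q₀ k Q) := by
      intro C hCR hCs
      have hCR0 : Sub C.parent Q₀ := hCR ▸ hR0
      have hC0 : Sub C Q₀ := (sub_parent C).trans hCR0
      have hsc : C.scale + n = k := by rw [hCs]; push_cast at hR; linarith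
      rcases stp_eq_or (st := st) hCR0 with h | h
      · refine (vol_le_stopSet hμ hF hF0 hH hH0 (k := k) hC0 h.2 (by omega)).trans ?_
        refine mul_le_mul_of_nonneg_left (measureReal_mono ?_ ?_) (by norm_num)
        · refine inter_subset_inter_right _ fun x hx => ?_
          right
          simp only [stopSet, mem_ofPred_eq] at hx
          rw [hx, hCR, hRQ]
        · exact ((measure_mono inter_subset_left).trans_lt (measure_toSet_lt_top μ C)).ne
      · refine ih C Q hsc hC0 ?_
        rw [h.2, hCR, hRQ]
    have hl := hchild R.left (parent_left R) rfl
    have hr := hchild R.right (parent_right R) rfl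
    have e := additive_real_inter (μ := μ) (measurableSet_stopSet₂ st Q₀ k Q) R
    rw [hV R]
    simp only at e
    rw [e]
    linarith

end

/-- A sparse family: every member has half of its mass in a part, and the parts have overlap at
most `L`. -/
structure IsSparse (μ : Measure ℝ) (S : Finset Dyadic) (E : Dyadic → Set ℝ) (L : ℕ) : Prop where
  measurableSet : ∀ J, MeasurableSet (E J)
  subset : ∀ J, E J ⊆ J.toSet
  le : ∀ J ∈ S, μ J.toSet ≤ 2 * μ (E J)
  overlap : ∀ x, ∀ S' ⊆ S, (∀ J ∈ S', x ∈ E J) → S'.card ≤ L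

/-- A point determines its stopping interval `q` at scale `k`. If it lies in the part of `J`, the
stopping interval of `J` is `q` or the one preceding it, and `J` sits at one of N + 2 generations
below that. These two data determine `J`, because `J` contains the point. -/
theorem isSparse_sparseFam {μ : Measure ℝ} [IsLocallyFiniteMeasure μ] {F H : Dyadic → ℝ}
    {Q₀ : Dyadic} (hμ : ∀ I : Dyadic, 0 < μ I.toSet) (hF : Additive F)
    (hF0 : ∀ I, 0 ≤ F I) (hH : Additive H) (hH0 : ∀ I, 0 ≤ H I) (N n : ℕ) :
    IsSparse μ (sparseFam (stopRule (vol μ) F H) Q₀ N n)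
      (fun J => J.toSet ∩ stopSet₂ (stopRule (vol μ) F H) Q₀ (Q₀.scale + (n + N + 2 : ℕ))
        (stp (stopRule (vol μ) F H) Q₀ J)) (2 * (N + 2)) := by
  classical
  set st := stopRule (vol μ) F H with hst
  set k := Q₀.scale + (n + N + 2 : ℕ) with hk
  refine ⟨fun J => J.measurableSet_toSet.inter (measurableSet_stopSet₂ _ _ _ _),
    fun J => inter_subset_left, fun J hJ => ?_, fun x S' hS' hx => ?_⟩
  · rw [sparseFam, Finset.mem_filter, mem_tree_iff] at hJ
    have h := vol_le_stopSet₂ hμ hF hF0 hH hH0 (k := k) hJ.1.1 (by omega)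
    have hfin : ∀ A : Set ℝ, μ (J.toSet ∩ A) ≠ ∞ := fun A =>
      ((measure_mono inter_subset_left).trans_lt (measure_toSet_lt_top μ J)).ne
    rw [← ENNReal.toReal_le_toReal (measure_toSet_lt_top μ J).ne
      (ENNReal.mul_ne_top (by norm_num) (hfin _)), ENNReal.toReal_mul]
    exact h
  · set q := stp st Q₀ (cubeAt k x) with hq
    have : (({q, stp st Q₀ q.parent} : Finset Dyadic) ×ˢ Finset.range (N + 2)).card
        ≤ 2 * (N + 2) := by
      rw [Finset.card_product, Finset.card_range]
      exact Nat.mul_le_mul_right _ (Finset.card_le_two)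
    refine le_trans (Finset.card_le_card_of_injOn
      (fun J => (stp st Q₀ J, (J.scale - (stp st Q₀ J).scale).toNat)) ?_ ?_) this
    · intro J hJ
      have hJx := hx J hJ
      replace hJ := hS' hJ
      rw [sparseFam, Finset.mem_filter, mem_tree_iff] at hJ
      rw [Finset.mem_coe, Finset.mem_product, Finset.mem_range, Finset.mem_insert,
        Finset.mem_singleton]
      have := (sub_stp (st := st) hJ.1.1).scale_le
      refine ⟨?_, by simp only; omega⟩
      rcases hJx.2 with h | h
      · exact Or.inl h.symm
      · exact Or.inr h.symm
    · intro J hJ J' hJ' h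
      have hJx := hx J hJ
      have hJx' := hx J' hJ'
      replace hJ := hS' hJ
      replace hJ' := hS' hJ'
      rw [sparseFam, Finset.mem_filter, mem_tree_iff] at hJ hJ'
      have h1 := (sub_stp (st := st) hJ.1.1).scale_le
      have h2 := (sub_stp (st := st) hJ'.1.1).scale_le
      simp only [Prod.mk.injEq] at h
      rw [h.1] at h1
      have h3 := h.2
      rw [h.1] at h3
      exact eq_of_mem_of_scale_eq hJx.1 hJx'.1 (by omega)

/-- The overlap bound is pointwise, so it can be integrated against any measure; the same parts `E
J` thus serve both w dμ and its dual. -/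
theorem IsSparse.sum_measure_le {μ : Measure ℝ} {S : Finset Dyadic} {E : Dyadic → Set ℝ} {L : ℕ}
    (h : IsSparse μ S E L) (ν : Measure ℝ) {A : Set ℝ} (hA : MeasurableSet A) {S' : Finset Dyadic}
    (hS : S' ⊆ S) (hSA : ∀ J ∈ S', J.toSet ⊆ A) :
    ∑ J ∈ S', ν (E J) ≤ L * ν A := by
  classical
  calc ∑ J ∈ S', ν (E J) = ∑ J ∈ S', ∫⁻ x, (E J).indicator 1 x ∂ν := by
        refine Finset.sum_congr rfl fun J _ => ?_
        rw [lintegral_indicator_one (h.measurableSet J)]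
    _ = ∫⁻ x, ∑ J ∈ S', (E J).indicator 1 x ∂ν := by
        rw [lintegral_finsetSum]
        exact fun J _ => measurable_one.indicator (h.measurableSet J)
    _ ≤ ∫⁻ x, A.indicator (fun _ => (L : ℝ≥0∞)) x ∂ν := by
        refine lintegral_mono fun x => ?_
        simp only [indicator_apply, Pi.one_apply]
        by_cases hx : x ∈ A
        · rw [if_pos hx, Finset.sum_boole]
          norm_cast
          exact h.overlap x _ ((Finset.filter_subset _ _).trans hS) fun J hJ =>
            (Finset.mem_filter.1 hJ).2
        · rw [if_neg hx]
          refine le_of_eq (Finset.sum_eq_zero fun J hJ => if_neg fun hx' => hx ?_)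
          exact hSA J hJ (h.subset J hx')
    _ = L * ν A := by rw [lintegral_indicator hA, setLIntegral_const]

/-! ### The Carleson embedding theorem. -/

/-- Joint convexity of `(g, t) ↦ g ^ q / t ^ (q - 1)`. -/
theorem add_rpow_div_le {q g₁ g₂ t₁ t₂ : ℝ} (hq : 1 ≤ q) (hg₁ : 0 ≤ g₁) (hg₂ : 0 ≤ g₂)
    (ht₁ : 0 < t₁) (ht₂ : 0 < t₂) :
    (g₁ + g₂) ^ q / (t₁ + t₂) ^ (q - 1) ≤ g₁ ^ q / t₁ ^ (q - 1) + g₂ ^ q / t₂ ^ (q - 1) := by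
  have ht : 0 < t₁ + t₂ := by positivity
  have h := (convexOn_rpow hq).2 (x := g₁ / t₁) (y := g₂ / t₂)
    (div_nonneg hg₁ ht₁.le) (div_nonneg hg₂ ht₂.le)
    (div_nonneg ht₁.le ht.le) (div_nonneg ht₂.le ht.le) (by rw [← add_div, div_self ht.ne'])
  simp only [smul_eq_mul] at h
  have e1 : t₁ / (t₁ + t₂) * (g₁ / t₁) + t₂ / (t₁ + t₂) * (g₂ / t₂)
      = (g₁ + g₂) / (t₁ + t₂) := by field_simp
  have e2 : ∀ g t : ℝ, 0 ≤ g → 0 < t → g ^ q / t ^ (q - 1) = t * (g / t) ^ q := by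
    intro g t hg ht
    rw [Real.div_rpow hg ht.le, Real.rpow_sub_one ht.ne']
    field_simp
  rw [e1] at h
  rw [e2 _ _ (add_nonneg hg₁ hg₂) ht, e2 _ _ hg₁ ht₁, e2 _ _ hg₂ ht₂]
  calc _ ≤ (t₁ + t₂) * (t₁ / (t₁ + t₂) * (g₁ / t₁) ^ q + t₂ / (t₁ + t₂) * (g₂ / t₂) ^ q) :=
        mul_le_mul_of_nonneg_left h ht.le
    _ = _ := by field_simp

/-- A quantitative decrease of t ↦ g^q / t^(q-1), whose derivative is -(q-1) (g/t)^q; the bound t ≤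
2v replaces g/t by g/(2v). -/
theorem rpow_div_sub_ge {q g v t a : ℝ} (hq : 1 < q) (hg : 0 ≤ g) (hv : 0 < v) (ha : 0 ≤ a)
    (hta : a < t) (htv : t ≤ 2 * v) :
    (q - 1) * 2⁻¹ ^ q * (a * (g / v) ^ q) + g ^ q / t ^ (q - 1) ≤ g ^ q / (t - a) ^ (q - 1) := by
  have ht : 0 < t := ha.trans_lt hta
  have hta' : 0 < t - a := sub_pos.2 hta
  -- With x = a/t: 1 - x ≤ exp(-x) and 1 + (q-1)x ≤ exp((q-1)x).
  have h1 : ((t - a) / t) ^ (q - 1) * (1 + (q - 1) * (a / t)) ≤ 1 := by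
    have e1 : (t - a) / t ≤ Real.exp (-(a / t)) := by
      have := Real.add_one_le_exp (-(a / t))
      have e : (t - a) / t = -(a / t) + 1 := by field_simp; ring
      rw [e]; exact this
    have e2 : ((t - a) / t) ^ (q - 1) ≤ Real.exp (-(a / t) * (q - 1)) := by
      rw [Real.exp_mul]
      exact Real.rpow_le_rpow (by positivity) e1 (by linarith)
    have e3 : 1 + (q - 1) * (a / t) ≤ Real.exp ((q - 1) * (a / t)) := by
      have := Real.add_one_le_exp ((q - 1) * (a / t))
      linarith
    have hq1 : 0 < q - 1 := by linarith
    calc _ ≤ Real.exp (-(a / t) * (q - 1)) * Real.exp ((q - 1) * (a / t)) := by gcongr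
      _ = 1 := by rw [← Real.exp_add]; ring_nf; exact Real.exp_zero
  have h2 : 1 / t ^ (q - 1) * (1 + (q - 1) * (a / t)) ≤ 1 / (t - a) ^ (q - 1) := by
    rw [Real.div_rpow hta'.le ht.le] at h1
    have p1 : 0 < (t - a) ^ (q - 1) := Real.rpow_pos_of_pos hta' _
    have p2 : 0 < t ^ (q - 1) := Real.rpow_pos_of_pos ht _
    rw [le_div_iff₀ p1]
    calc _ = (t - a) ^ (q - 1) / t ^ (q - 1) * (1 + (q - 1) * (a / t)) := by ring
      _ ≤ 1 := h1
  have h3 : 2⁻¹ ^ q * (a * (g / v) ^ q) ≤ g ^ q * (1 / t ^ (q - 1) * (a / t)) := by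
    have e : g ^ q * (1 / t ^ (q - 1) * (a / t)) = a * (g / t) ^ q := by
      rw [Real.div_rpow hg ht.le, Real.rpow_sub_one ht.ne']
      field_simp
    rw [e]
    have e2 : 2⁻¹ ^ q * (a * (g / v) ^ q) = a * (g / (2 * v)) ^ q := by
      rw [mul_left_comm, ← Real.mul_rpow (by norm_num) (by positivity)]
      congr 2
      field_simp
    rw [e2]
    refine mul_le_mul_of_nonneg_left (Real.rpow_le_rpow (by positivity) ?_ (by linarith)) ha
    exact div_le_div_of_nonneg_left hg ht htv
  have h4 := mul_le_mul_of_nonneg_left h2 (Real.rpow_nonneg hg q)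
  have h5 := mul_le_mul_of_nonneg_left h3 (by linarith : 0 ≤ q - 1)
  have e5 : g ^ q * (1 / (t - a) ^ (q - 1)) = g ^ q / (t - a) ^ (q - 1) := by ring
  have e6 : g ^ q * (1 / t ^ (q - 1) * (1 + (q - 1) * (a / t)))
      = g ^ q / t ^ (q - 1) + (q - 1) * (g ^ q * (1 / t ^ (q - 1) * (a / t))) := by ring
  rw [e5, e6] at h4
  linarith

/-- The dyadic Carleson embedding theorem on a finite tree. -/
theorem carleson_embedding_real {q : ℝ} (hq : 1 < q) {Q₀ : Dyadic} {v g X a : Dyadic → ℝ}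
    (hv0 : ∀ R, Sub R Q₀ → 0 < v R)
    (hv : ∀ R, Sub R Q₀ → v R = v R.left + v R.right)
    (hg0 : ∀ R, 0 ≤ g R) (hg : ∀ R, Sub R Q₀ → g R = g R.left + g R.right)
    (hX : ∀ R, Sub R Q₀ → X R = X R.left + X R.right)
    (hgX : ∀ R, Sub R Q₀ → g R ^ q / v R ^ (q - 1) ≤ X R)
    (ha0 : ∀ R, 0 ≤ a R) (ha : ∀ n R, Sub R Q₀ → ∑ J ∈ tree n R, a J ≤ v R) (n : ℕ) :
    (q - 1) * 2⁻¹ ^ q * ∑ J ∈ tree n Q₀, a J * (g J / v J) ^ q ≤ X Q₀ := by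
  -- Bellman function argument with g^q / (v + A)^(q-1), where A is the sum of `a` over the tree
  -- below. Removing a(R) from the denominator pays for the term at `R`, joint convexity passes to
  -- the children, and A ≤ v keeps the denominator within a factor 2 of v.
  have key : ∀ n R, Sub R Q₀ → (q - 1) * 2⁻¹ ^ q * ∑ J ∈ tree n R, a J * (g J / v J) ^ q
      + g R ^ q / (v R + ∑ J ∈ tree n R, a J) ^ (q - 1) ≤ X R := by
    intro n
    induction n with
    | zero =>
      intro R hR
      simpa [tree] using hgX R hR
    | succ n ih =>
      intro R hR
      have hl := ih R.left hR.left
      have hr := ih R.right hR.right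
      have haR := ha (n + 1) R hR
      rw [sum_tree_succ] at haR
      have hA : ∀ R, 0 ≤ ∑ J ∈ tree n R, a J := fun R => Finset.sum_nonneg fun J _ => ha0 J
      rw [sum_tree_succ, sum_tree_succ]
      set A₁ := ∑ J ∈ tree n R.left, a J
      set A₂ := ∑ J ∈ tree n R.right, a J
      have hA₁ : 0 ≤ A₁ := hA _
      have hA₂ : 0 ≤ A₂ := hA _
      have v1 := hv0 _ hR.left
      have v2 := hv0 _ hR.right
      have v3 := hv0 _ hR
      have e1 := add_rpow_div_le hq.le (hg0 R.left) (hg0 R.right)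
        (add_pos_of_pos_of_nonneg v1 hA₁) (add_pos_of_pos_of_nonneg v2 hA₂)
      have e2 := rpow_div_sub_ge hq (hg0 R) v3 (ha0 R)
        (t := v R + (a R + (A₁ + A₂))) (by linarith) (by linarith)
      have e3 : v R + (a R + (A₁ + A₂)) - a R = v R.left + A₁ + (v R.right + A₂) := by
        rw [hv R hR]; ring
      rw [e3] at e2
      rw [← hg R hR] at e1
      rw [hX R hR, mul_add]
      linarith
  have h := key n Q₀ (Sub.refl _)
  have : 0 ≤ g Q₀ ^ q / (v Q₀ + ∑ J ∈ tree n Q₀, a J) ^ (q - 1) := by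
    have := hg0 Q₀
    have := hv0 Q₀ (Sub.refl _)
    have : 0 ≤ ∑ J ∈ tree n Q₀, a J := Finset.sum_nonneg fun J _ => ha0 J
    positivity
  linarith

theorem setLIntegral_toSet (ν : Measure ℝ) (g : ℝ → ℝ≥0∞) (R : Dyadic) :
    ∫⁻ x in R.toSet, g x ∂ν = ∫⁻ x in R.left.toSet, g x ∂ν + ∫⁻ x in R.right.toSet, g x ∂ν := by
  rw [R.toSet_eq_union, lintegral_union R.right.measurableSet_toSet R.disjoint_children]

/-- The constant of the Carleson embedding theorem. -/
def embConst (q : ℝ) : ℝ≥0∞ := ENNReal.ofReal ((q - 1)⁻¹ * 2 ^ q)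

/-- By bounded overlap, ν(E J)/L is a Carleson sequence for ν. When the right side is finite, Hölder
makes all the integrals involved finite, so the real-valued theorem applies. -/
theorem carleson_embedding {q : ℝ} (hq : 1 < q) {Q₀ : Dyadic} {μ ν : Measure ℝ}
    (hpos : ∀ R, Sub R Q₀ → 0 < ν R.toSet) (hfin : ν Q₀.toSet < ∞) {g : ℝ → ℝ≥0∞}
    (hg : AEMeasurable g ν) {S : Finset Dyadic} {E : Dyadic → Set ℝ} {L : ℕ}
    (hS : IsSparse μ S E L) {n : ℕ} (hSn : S ⊆ tree n Q₀) :
    ∑ J ∈ S, ν (E J) * ((∫⁻ x in J.toSet, g x ∂ν) / ν J.toSet) ^ q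
      ≤ embConst q * L * ∫⁻ x in Q₀.toSet, g x ^ q ∂ν := by
  classical
  have hq0 : 0 < q := by linarith
  have hc : 0 < (q - 1)⁻¹ * 2 ^ q := by
    have : 0 < q - 1 := by linarith
    positivity
  -- For L = 0 the right side is zero even if the integral is infinite, so this case has to be
  -- settled before an infinite integral is dismissed.
  rcases Nat.eq_zero_or_pos L with hL | hL
  · have : ∀ J ∈ S, ν (E J) = 0 := by
      intro J hJ
      have := hS.sum_measure_le ν MeasurableSet.univ (S' := S) subset_rfl fun _ _ => subset_univ _
      rw [hL, Nat.cast_zero, zero_mul] at this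
      exact (Finset.sum_eq_zero_iff.1 (le_antisymm this bot_le)) J hJ
    rw [Finset.sum_eq_zero fun J hJ => by rw [this J hJ, zero_mul]]
    exact bot_le
  by_cases htop : ∫⁻ x in Q₀.toSet, g x ^ q ∂ν = ∞
  · rw [htop, ENNReal.mul_top]
    · exact le_top
    · refine mul_ne_zero ?_ (by exact_mod_cast hL.ne')
      rw [embConst]
      simpa using hc
  have hmono : ∀ {R}, Sub R Q₀ → ∀ φ : ℝ → ℝ≥0∞,
      ∫⁻ x in R.toSet, φ x ∂ν ≤ ∫⁻ x in Q₀.toSet, φ x ∂ν := fun hR φ =>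
    lintegral_mono_set hR.subset
  have hνfin : ∀ R, Sub R Q₀ → ν R.toSet ≠ ∞ := fun R hR =>
    ((measure_mono hR.subset).trans_lt hfin).ne
  have hXfin : ∀ R, Sub R Q₀ → ∫⁻ x in R.toSet, g x ^ q ∂ν ≠ ∞ := fun R hR =>
    ((hmono hR _).trans_lt (lt_top_iff_ne_top.2 htop)).ne
  have hconj : q.HolderConjugate (q / (q - 1)) := Real.HolderConjugate.conjExponent hq
  have hhold : ∀ R : Dyadic, (∫⁻ x in R.toSet, g x ∂ν) ^ q
      ≤ (∫⁻ x in R.toSet, g x ^ q ∂ν) * ν R.toSet ^ (q - 1) := by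
    intro R
    have h := ENNReal.lintegral_mul_le_Lp_mul_Lq (ν.restrict R.toSet) hconj hg.restrict
      (g := fun _ => 1) aemeasurable_const
    simp only [Pi.mul_apply, mul_one, ENNReal.one_rpow, lintegral_const, one_mul,
      Measure.restrict_apply_univ] at h
    refine (ENNReal.rpow_le_rpow h hq0.le).trans (le_of_eq ?_)
    rw [ENNReal.mul_rpow_of_nonneg _ _ hq0.le, ← ENNReal.rpow_mul, ← ENNReal.rpow_mul]
    congr 2
    · rw [one_div, inv_mul_cancel₀ hq0.ne', ENNReal.rpow_one]
    · field_simp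
  have hgfin : ∀ R, Sub R Q₀ → ∫⁻ x in R.toSet, g x ∂ν ≠ ∞ := by
    intro R hR h
    have := hhold R
    rw [h, ENNReal.top_rpow_of_pos hq0, top_le_iff] at this
    exact ENNReal.mul_ne_top (hXfin R hR)
      (ENNReal.rpow_ne_top_of_nonneg (by linarith) (hνfin R hR)) this
  have hEfin : ∀ J ∈ S, ν (E J) ≠ ∞ := fun J hJ =>
    ((measure_mono (hS.subset J)).trans_lt
      (lt_top_iff_ne_top.2 (hνfin J (mem_tree_iff.1 (hSn hJ)).1))).ne
  have hL' : (0 : ℝ) < L := by exact_mod_cast hL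
  have key := carleson_embedding_real hq (Q₀ := Q₀) (v := fun R => (ν R.toSet).toReal)
    (g := fun R => (∫⁻ x in R.toSet, g x ∂ν).toReal)
    (X := fun R => (∫⁻ x in R.toSet, g x ^ q ∂ν).toReal)
    (a := fun J => if J ∈ S then (ν (E J)).toReal / L else 0)
    (fun R hR => ENNReal.toReal_pos (hpos R hR).ne' (hνfin R hR))
    (fun R hR => by
      have := setLIntegral_toSet ν 1 R
      simp only [Pi.one_apply, setLIntegral_one] at this
      rw [this, ENNReal.toReal_add (hνfin _ hR.left) (hνfin _ hR.right)])
    (fun R => ENNReal.toReal_nonneg)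
    (fun R hR => by
      rw [setLIntegral_toSet, ENNReal.toReal_add (hgfin _ hR.left) (hgfin _ hR.right)])
    (fun R hR => by
      rw [setLIntegral_toSet, ENNReal.toReal_add (hXfin _ hR.left) (hXfin _ hR.right)])
    (fun R hR => by
      have h0 := ENNReal.toReal_pos (hpos R hR).ne' (hνfin R hR)
      rw [div_le_iff₀ (Real.rpow_pos_of_pos h0 _), ENNReal.toReal_rpow, ENNReal.toReal_rpow,
        ← ENNReal.toReal_mul]
      exact ENNReal.toReal_mono (ENNReal.mul_ne_top (hXfin R hR)
        (ENNReal.rpow_ne_top_of_nonneg (by linarith) (hνfin R hR))) (hhold R))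
    (fun R => by split_ifs <;> positivity)
    (fun n R hR => by
      rw [← Finset.sum_filter, ← Finset.sum_div, div_le_iff₀ hL',
        ← ENNReal.toReal_sum fun J hJ => hEfin J (Finset.mem_filter.1 hJ).2]
      have h := hS.sum_measure_le ν R.measurableSet_toSet
        (S' := (tree n R).filter (· ∈ S)) (fun J hJ => (Finset.mem_filter.1 hJ).2)
        (fun J hJ => (mem_tree_iff.1 (Finset.mem_filter.1 hJ).1).1.subset)
      have h2 := ENNReal.toReal_mono (ENNReal.mul_ne_top (ENNReal.natCast_ne_top L)
        (hνfin R hR)) h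
      rw [ENNReal.toReal_mul, ENNReal.toReal_natCast, mul_comm] at h2
      exact h2) n
  have hterm : ∀ J ∈ S, ν (E J) * ((∫⁻ x in J.toSet, g x ∂ν) / ν J.toSet) ^ q
      = ENNReal.ofReal ((ν (E J)).toReal
        * ((∫⁻ x in J.toSet, g x ∂ν).toReal / (ν J.toSet).toReal) ^ q) := by
    intro J hJ
    have hJ0 := (mem_tree_iff.1 (hSn hJ)).1
    rw [ENNReal.ofReal_mul ENNReal.toReal_nonneg, ENNReal.ofReal_toReal (hEfin J hJ),
      ← ENNReal.toReal_div, ENNReal.toReal_rpow, ENNReal.ofReal_toReal]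
    exact ENNReal.rpow_ne_top_of_nonneg hq0.le
      (ENNReal.div_ne_top (hgfin J hJ0) (hpos J hJ0).ne')
  rw [Finset.sum_congr rfl hterm, ← ENNReal.ofReal_sum_of_nonneg (fun J _ => by positivity)]
  have hXR : ENNReal.ofReal ((q - 1)⁻¹ * 2 ^ q * L * (∫⁻ x in Q₀.toSet, g x ^ q ∂ν).toReal)
      = embConst q * L * ∫⁻ x in Q₀.toSet, g x ^ q ∂ν := by
    rw [ENNReal.ofReal_mul (by positivity), ENNReal.ofReal_mul hc.le, ENNReal.ofReal_natCast,
      ENNReal.ofReal_toReal htop, embConst]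
  rw [← hXR]
  refine ENNReal.ofReal_le_ofReal ?_
  have e : ∑ J ∈ tree n Q₀, (if J ∈ S then (ν (E J)).toReal / L else 0) *
      ((∫⁻ x in J.toSet, g x ∂ν).toReal / (ν J.toSet).toReal) ^ q
      = (∑ J ∈ S, (ν (E J)).toReal *
        ((∫⁻ x in J.toSet, g x ∂ν).toReal / (ν J.toSet).toReal) ^ q) / L := by
    simp only [ite_mul, zero_mul]
    rw [← Finset.sum_filter, Finset.filter_mem_eq_inter, Finset.inter_eq_right.2 hSn,
      Finset.sum_div]
    exact Finset.sum_congr rfl fun J _ => by ring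
  rw [e] at key
  have hq1 : 0 < q - 1 := by linarith
  have h2 : (0 : ℝ) < 2⁻¹ ^ q := by positivity
  have h3 : (2 : ℝ)⁻¹ ^ q * 2 ^ q = 1 := by
    rw [← Real.mul_rpow (by norm_num) (by norm_num)]; norm_num
  set Z := ∑ J ∈ S, (ν (E J)).toReal *
        ((∫⁻ x in J.toSet, g x ∂ν).toReal / (ν J.toSet).toReal) ^ q
  calc Z = (q - 1)⁻¹ * 2 ^ q * L * ((q - 1) * 2⁻¹ ^ q * (Z / L)) := by
        have h4 : (q - 1)⁻¹ * (q - 1) = 1 := inv_mul_cancel₀ hq1.ne'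
        have h5 : L * (Z / L) = Z := mul_div_cancel₀ _ hL'.ne'
        calc Z = ((q - 1)⁻¹ * (q - 1)) * ((2 : ℝ)⁻¹ ^ q * 2 ^ q) * (L * (Z / L)) := by
              rw [h3, h4, h5]; ring
          _ = _ := by ring
    _ ≤ _ := mul_le_mul_of_nonneg_left key (by positivity)

/-! ### Muckenhoupt weights on sparse families. -/

/-- Hölder over the set of near pairs. Each interval occurs in at most (n + 1)² 2ⁿ of them, and the
powers 1/p and 1/q of this number multiply to the number itself. -/
theorem sum_near_le {p q : ℝ} (hpq : p.HolderConjugate q) (n : ℕ) (S : Finset Dyadic)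
    [∀ J, DecidablePred (Near n J)] (X Y : Dyadic → ℝ≥0∞) :
    ∑ J ∈ S, ∑ K ∈ S with Near n J K, X J * Y K
      ≤ ((n + 1) ^ 2 * 2 ^ n : ℕ) * ((∑ J ∈ S, X J ^ p) ^ (1 / p) * (∑ K ∈ S, Y K ^ q) ^ (1 / q)) := by
  classical
  set c : ℕ := (n + 1) ^ 2 * 2 ^ n with hc
  have h1 : ∀ J, ∑ K ∈ S with Near n J K, X J * Y K
      = ∑ K ∈ S, if Near n J K then X J * Y K else 0 := fun J => Finset.sum_filter _ _
  simp only [h1]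
  rw [← Finset.sum_product', ← Finset.sum_filter]
  set P := (S ×ˢ S).filter fun x => Near n x.1 x.2 with hP
  refine (ENNReal.inner_le_Lp_mul_Lq P (fun x => X x.1) (fun x => Y x.2) hpq).trans ?_
  have hcard : ∀ J, (S.filter fun K => Near n J K).card ≤ c := fun J =>
    (Finset.card_le_card fun K hK => mem_nbhd.2 (Finset.mem_filter.1 hK).2).trans (card_nbhd_le n J)
  have hcard' : ∀ K, (S.filter fun J => Near n J K).card ≤ c := fun K =>
    (Finset.card_le_card fun J hJ => mem_nbhd.2 (Finset.mem_filter.1 hJ).2.symm).trans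
      (card_nbhd_le n K)
  have hX : ∑ x ∈ P, X x.1 ^ p ≤ c * ∑ J ∈ S, X J ^ p := by
    rw [hP, Finset.sum_filter, Finset.sum_product, Finset.mul_sum]
    refine Finset.sum_le_sum fun J _ => ?_
    rw [← Finset.sum_filter]
    dsimp only
    rw [Finset.sum_const, nsmul_eq_mul]
    exact mul_le_mul_left (by exact_mod_cast hcard J) _
  have hY : ∑ x ∈ P, Y x.2 ^ q ≤ c * ∑ K ∈ S, Y K ^ q := by
    rw [hP, Finset.sum_filter, Finset.sum_product_right, Finset.mul_sum]
    refine Finset.sum_le_sum fun K _ => ?_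
    rw [← Finset.sum_filter]
    dsimp only
    rw [Finset.sum_const, nsmul_eq_mul]
    exact mul_le_mul_left (by exact_mod_cast hcard' K) _
  have hp := hpq.pos
  have hq := hpq.symm.pos
  calc _ ≤ (c * ∑ J ∈ S, X J ^ p) ^ (1 / p) * (c * ∑ K ∈ S, Y K ^ q) ^ (1 / q) := by gcongr
    _ = ((c : ℝ≥0∞) ^ (1 / p) * (c : ℝ≥0∞) ^ (1 / q)) * _ := by
        rw [ENNReal.mul_rpow_of_nonneg _ _ (by positivity), ENNReal.mul_rpow_of_nonneg _ _ (by positivity)]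
        exact mul_mul_mul_comm _ _ _ _
    _ = _ := by
        rw [← ENNReal.rpow_add_of_nonneg _ _ (by positivity) (by positivity), one_div, one_div,
          hpq.inv_add_inv_eq_one, ENNReal.rpow_one]

/-- The dual measure `w^{1-p'} dμ`. -/
def dualMeasure (μ : Measure ℝ) (p : ℝ) (w : ℝ → ℝ) : Measure ℝ :=
  μ.withDensity fun x => ENNReal.ofReal (w x) ^ (1 - p / (p - 1))

section

variable {μ : Measure ℝ} {w : ℝ → ℝ} {p : ℝ}

theorem IsWeight.aemeasurable (hw : IsWeight μ w) :
    AEMeasurable (fun x => ENNReal.ofReal (w x)) μ :=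
  hw.locallyIntegrable.aestronglyMeasurable.aemeasurable.ennreal_ofReal

theorem IsWeight.ae_pos (hw : IsWeight μ w) : ∀ᵐ x ∂μ, ENNReal.ofReal (w x) ≠ 0 := by
  filter_upwards [hw.pos] with x hx
  exact (ENNReal.ofReal_pos.2 hx).ne'

theorem IsWeight.weighted_lt_top (hw : IsWeight μ w) (J : Dyadic) :
    weighted μ w J.toSet < ∞ := by
  rw [weighted, withDensity_apply _ J.measurableSet_toSet]
  have h : IntegrableOn w J.toSet μ :=
    (hw.locallyIntegrable.integrableOn_isCompact isCompact_Icc).mono_set Ico_subset_Icc_self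
  exact h.lintegral_lt_top

theorem IsWeight.absolutelyContinuous (hw : IsWeight μ w) : μ ≪ weighted μ w :=
  withDensity_absolutelyContinuous' hw.aemeasurable hw.ae_pos

theorem IsWeight.absolutelyContinuous_dual (hw : IsWeight μ w) : μ ≪ dualMeasure μ p w := by
  refine withDensity_absolutelyContinuous' (hw.aemeasurable.pow_const _) ?_
  filter_upwards [hw.ae_pos] with x hx
  exact (ENNReal.rpow_pos (pos_iff_ne_zero.2 hx) ENNReal.ofReal_ne_top).ne'

theorem IsWeight.weighted_pos (hw : IsWeight μ w) {A : Set ℝ} (hA : 0 < μ A) :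
    0 < weighted μ w A :=
  pos_iff_ne_zero.2 fun h => hA.ne' (hw.absolutelyContinuous h)

theorem IsWeight.dual_pos (hw : IsWeight μ w) {A : Set ℝ} (hA : 0 < μ A) :
    0 < dualMeasure μ p w A :=
  pos_iff_ne_zero.2 fun h => hA.ne' (hw.absolutelyContinuous_dual h)

/-- Hölder for 1 = w^{1/p} w^{-1/p}. It is the converse of the A_p inequality, valid on every
measurable set and so on the parts `E J`. -/
theorem IsWeight.measure_rpow_le (hw : IsWeight μ w) (hp : 1 < p) {A : Set ℝ}
    (hA : MeasurableSet A) :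
    μ A ^ p ≤ weighted μ w A * dualMeasure μ p w A ^ (p - 1) := by
  have hp0 : 0 < p := by linarith
  have hp1 : 0 < p - 1 := by linarith
  have hconj : p.HolderConjugate (p / (p - 1)) := Real.HolderConjugate.conjExponent hp
  have h := ENNReal.lintegral_mul_le_Lp_mul_Lq (μ.restrict A) hconj
    (f := fun x => ENNReal.ofReal (w x) ^ (1 / p))
    (g := fun x => ENNReal.ofReal (w x) ^ (-(1 / p)))
    (hw.aemeasurable.pow_const _).restrict (hw.aemeasurable.pow_const _).restrict
  have e1 : ∫⁻ x in A, ((fun x => ENNReal.ofReal (w x) ^ (1 / p))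
      * fun x => ENNReal.ofReal (w x) ^ (-(1 / p))) x ∂μ = μ A := by
    rw [← setLIntegral_one]
    refine lintegral_congr_ae (ae_restrict_of_ae ?_)
    filter_upwards [hw.ae_pos] with x hx
    rw [Pi.mul_apply, ← ENNReal.rpow_add _ _ hx ENNReal.ofReal_ne_top, add_neg_cancel,
      ENNReal.rpow_zero]
  rw [e1] at h
  simp only [← ENNReal.rpow_mul] at h
  have e2 : 1 / p * p = 1 := by field_simp
  have e3 : -(1 / p) * (p / (p - 1)) = 1 - p / (p - 1) := by field_simp; ring
  rw [e2, e3] at h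
  simp only [ENNReal.rpow_one] at h
  rw [weighted, dualMeasure, withDensity_apply _ hA, withDensity_apply _ hA]
  refine (ENNReal.rpow_le_rpow h hp0.le).trans (le_of_eq ?_)
  rw [ENNReal.mul_rpow_of_nonneg _ _ hp0.le, ← ENNReal.rpow_mul, ← ENNReal.rpow_mul, e2,
    ENNReal.rpow_one]
  congr 2
  field_simp

theorem apProduct_eq (μ : Measure ℝ) (p : ℝ) (w : ℝ → ℝ) (I J : Dyadic) :
    apProduct μ p w I J = weighted μ w I.toSet / μ I.toSet
      * (dualMeasure μ p w J.toSet / μ J.toSet) ^ (p - 1) := by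
  rw [apProduct, setLAverage_eq, setLAverage_eq, weighted, dualMeasure,
    withDensity_apply _ I.measurableSet_toSet, withDensity_apply _ J.measurableSet_toSet]

variable [IsLocallyFiniteMeasure μ]

theorem apProduct_mul (hμ : ∀ I : Dyadic, 0 < μ I.toSet) (hp : 1 < p) (w : ℝ → ℝ)
    (I J : Dyadic) :
    apProduct μ p w I J * (μ I.toSet * μ J.toSet ^ (p - 1))
      = weighted μ w I.toSet * dualMeasure μ p w J.toSet ^ (p - 1) := by
  have hp1 : 0 < p - 1 := by linarith
  rw [apProduct_eq, mul_mul_mul_comm, ← ENNReal.mul_rpow_of_nonneg _ _ hp1.le,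
    ENNReal.div_mul_cancel (hμ I).ne' (measure_toSet_lt_top μ I).ne,
    ENNReal.div_mul_cancel (hμ J).ne' (measure_toSet_lt_top μ J).ne]

theorem weighted_mul_dual_le (hμ : ∀ I : Dyadic, 0 < μ I.toSet) (hp : 1 < p) (w : ℝ → ℝ)
    (J : Dyadic) :
    weighted μ w J.toSet * dualMeasure μ p w J.toSet ^ (p - 1)
      ≤ apChar μ p w * μ J.toSet ^ p := by
  rw [← apProduct_mul hμ hp w]
  have e : μ J.toSet * μ J.toSet ^ (p - 1) = μ J.toSet ^ p := by
    conv_lhs => enter [1]; rw [← ENNReal.rpow_one (μ J.toSet)]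
    rw [← ENNReal.rpow_add_of_nonneg _ _ (by norm_num) (by linarith)]
    ring_nf
  rw [e]
  exact mul_le_mul_left (le_iSup (fun I => apProduct μ p w I I) J) _

theorem one_le_apChar (hμ : ∀ I : Dyadic, 0 < μ I.toSet) (hp : 1 < p) (hw : IsWeight μ w) :
    1 ≤ apChar μ p w := by
  let J : Dyadic := ⟨0, 0⟩
  have h := (hw.measure_rpow_le hp J.measurableSet_toSet).trans (weighted_mul_dual_le hμ hp w J)
  have h0 : μ J.toSet ^ p ≠ 0 := (ENNReal.rpow_pos (hμ J) (measure_toSet_lt_top μ J).ne).ne'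
  have h1 : μ J.toSet ^ p ≠ ∞ :=
    ENNReal.rpow_ne_top_of_nonneg (by linarith) (measure_toSet_lt_top μ J).ne
  rw [← ENNReal.mul_le_mul_iff_left h0 h1, one_mul]
  exact h

theorem ofReal_vol (J : Dyadic) : ENNReal.ofReal (vol μ J) = μ J.toSet :=
  ENNReal.ofReal_toReal (measure_toSet_lt_top μ J).ne

/-- Cleared of denominators, c^b_p is the p-th power of the coefficient in the dominating form. This
ties the form to the characteristics. -/
theorem cb_mul (hμ : ∀ I : Dyadic, 0 < μ I.toSet) (hp : 1 ≤ p) (I J : Dyadic) :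
    cb μ p I J * (μ J.toSet * μ I.toSet ^ (p - 1)) = ENNReal.ofReal (kap (vol μ) J I) ^ p := by
  have hV0 : ∀ I, 0 < vol μ I := real_pos hμ
  have hp0 : 0 < p := by linarith
  by_cases h : I = J
  · subst h
    rw [cb, if_pos rfl, one_mul, kap, if_pos rfl, ofReal_vol]
    conv_lhs => enter [1]; rw [← ENNReal.rpow_one (μ I.toSet)]
    rw [← ENNReal.rpow_add_of_nonneg _ _ (by norm_num) (by linarith)]
    ring_nf
  · rw [cb, if_neg h, kap, if_neg (Ne.symm h), ← ofReal_vol, ← ofReal_vol,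
      ENNReal.ofReal_rpow_of_pos (hV0 I), ← ENNReal.ofReal_mul (hV0 J).le,
      ENNReal.ofReal_rpow_of_nonneg (by positivity) hp0.le]
    have hI : 0 ≤ m μ I := (hm_nonneg hV0 I)
    have hJ : 0 ≤ m μ J := (hm_nonneg hV0 J)
    have hVI := hV0 I
    have hVJ := hV0 J
    rw [← ENNReal.ofReal_mul (by have : 0 ≤ μ.real J.toSet * μ.real I.toSet ^ (p - 1) := by positivity
                                 positivity)]
    congr 1
    change m μ I ^ (p / 2) * m μ J ^ (p / 2) / (vol μ J * vol μ I ^ (p - 1))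
      * (vol μ J * vol μ I ^ (p - 1)) = (√(m μ J) * √(m μ I)) ^ p
    rw [div_mul_cancel₀ _ (by positivity), Real.mul_rpow (by positivity) (by positivity),
      Real.sqrt_eq_rpow, Real.sqrt_eq_rpow, ← Real.rpow_mul hI, ← Real.rpow_mul hJ, mul_comm]
    ring_nf

/-- The measures left over from `cb` and from `apProduct` complement each other to (μ(J) μ(K))^p,
because the first carries the exponents 1 and p - 1 and the second the same exponents exchanged. -/
theorem kap_rpow_mul_le (hμ : ∀ I : Dyadic, 0 < μ I.toSet) (hp : 1 < p) (w : ℝ → ℝ) {N : ℕ}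
    {J K : Dyadic} (h : Near (N + 2) J K) :
    ENNReal.ofReal (kap (vol μ) J K) ^ p
        * (weighted μ w K.toSet * dualMeasure μ p w J.toSet ^ (p - 1))
      ≤ apNChar μ p N w * (μ J.toSet * μ K.toSet) ^ p := by
  rw [← cb_mul hμ hp.le, ← apProduct_mul hμ hp]
  have e : ∀ A : Dyadic, μ A.toSet * μ A.toSet ^ (p - 1) = μ A.toSet ^ p := by
    intro A
    conv_lhs => enter [1]; rw [← ENNReal.rpow_one (μ A.toSet)]
    rw [← ENNReal.rpow_add_of_nonneg _ _ (by norm_num) (by linarith)]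
    ring_nf
  have h1 : cb μ p K J * apProduct μ p w K J ≤ apNChar μ p N w :=
    le_iSup_of_le K (le_iSup_of_le J (le_iSup_of_le (dist_le_iff.2 h.symm) le_rfl))
  calc _ = cb μ p K J * apProduct μ p w K J
        * ((μ J.toSet * μ J.toSet ^ (p - 1)) * (μ K.toSet * μ K.toSet ^ (p - 1))) := by ring
    _ ≤ apNChar μ p N w * ((μ J.toSet * μ J.toSet ^ (p - 1))
        * (μ K.toSet * μ K.toSet ^ (p - 1))) := by gcongr
    _ = _ := by rw [e, e, ENNReal.mul_rpow_of_nonneg _ _ (by linarith)]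

theorem dual_lt_top (hμ : ∀ I : Dyadic, 0 < μ I.toSet) (hp : 1 < p) (hw : IsWeight μ w)
    (hB : apChar μ p w ≠ ∞) (J : Dyadic) : dualMeasure μ p w J.toSet < ∞ := by
  rw [lt_top_iff_ne_top]
  intro h
  have h1 := weighted_mul_dual_le hμ hp w J
  rw [h, ENNReal.top_rpow_of_pos (by linarith), ENNReal.mul_top (hw.weighted_pos (hμ J)).ne',
    top_le_iff] at h1
  exact ENNReal.mul_ne_top hB
    (ENNReal.rpow_ne_top_of_nonneg (by linarith) (measure_toSet_lt_top μ J).ne) h1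

section sparse

variable {S : Finset Dyadic} {E : Dyadic → Set ℝ} {L : ℕ}

/-- A_p on `J`, then μ(J) ≤ 2 μ(E J), then Hölder on `E J`. Enlarging `E J` to `J` in one of the two
factors and cancelling compares `J` with `E J` for the other measure, in `weighted_le` and
`dual_le`. -/
theorem IsSparse.mul_dual_le (hS : IsSparse μ S E L) (hμ : ∀ I : Dyadic, 0 < μ I.toSet)
    (hp : 1 < p) (hw : IsWeight μ w) {J : Dyadic} (hJ : J ∈ S) :
    weighted μ w J.toSet * dualMeasure μ p w J.toSet ^ (p - 1) ≤ 2 ^ p * apChar μ p w *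
      (weighted μ w (E J) * dualMeasure μ p w (E J) ^ (p - 1)) := by
  have hp0 : 0 < p := by linarith
  calc _ ≤ apChar μ p w * μ J.toSet ^ p := weighted_mul_dual_le hμ hp w J
    _ ≤ apChar μ p w * (2 * μ (E J)) ^ p := by
        gcongr
        exact hS.le J hJ
    _ = 2 ^ p * apChar μ p w * μ (E J) ^ p := by
        rw [ENNReal.mul_rpow_of_nonneg _ _ hp0.le]; ring
    _ ≤ _ := by
        gcongr
        exact hw.measure_rpow_le hp (hS.measurableSet J)

theorem IsSparse.weighted_le (hS : IsSparse μ S E L) (hμ : ∀ I : Dyadic, 0 < μ I.toSet)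
    (hp : 1 < p) (hw : IsWeight μ w) (hB : apChar μ p w ≠ ∞) {J : Dyadic} (hJ : J ∈ S) :
    weighted μ w J.toSet ≤ 2 ^ p * apChar μ p w * weighted μ w (E J) := by
  have hp1 : 0 < p - 1 := by linarith
  have h := hS.mul_dual_le hμ hp hw hJ
  have h1 : dualMeasure μ p w J.toSet ^ (p - 1) ≠ 0 :=
    (ENNReal.rpow_pos (hw.dual_pos (hμ J)) (dual_lt_top hμ hp hw hB J).ne).ne'
  have h2 : dualMeasure μ p w J.toSet ^ (p - 1) ≠ ∞ :=
    ENNReal.rpow_ne_top_of_nonneg hp1.le (dual_lt_top hμ hp hw hB J).ne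
  rw [← ENNReal.mul_le_mul_iff_left h1 h2]
  refine h.trans ?_
  rw [mul_assoc _ (weighted μ w (E J))]
  gcongr
  exact hS.subset J

theorem IsSparse.dual_le (hS : IsSparse μ S E L) (hμ : ∀ I : Dyadic, 0 < μ I.toSet)
    (hp : 1 < p) (hw : IsWeight μ w) {J : Dyadic} (hJ : J ∈ S) :
    dualMeasure μ p w J.toSet
      ≤ (2 ^ p * apChar μ p w) ^ (1 / (p - 1)) * dualMeasure μ p w (E J) := by
  have hp1 : 0 < p - 1 := by linarith
  have h := hS.mul_dual_le hμ hp hw hJ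
  have h1 := (hw.weighted_pos (hμ J)).ne'
  have h2 := (hw.weighted_lt_top J).ne
  have h3 : dualMeasure μ p w J.toSet ^ (p - 1)
      ≤ 2 ^ p * apChar μ p w * dualMeasure μ p w (E J) ^ (p - 1) := by
    rw [← ENNReal.mul_le_mul_iff_right h1 h2]
    refine h.trans ?_
    rw [mul_left_comm (weighted μ w J.toSet)]
    gcongr
    exact hS.subset J
  have h4 := ENNReal.rpow_le_rpow h3 (by positivity : 0 ≤ 1 / (p - 1))
  rw [ENNReal.mul_rpow_of_nonneg _ _ (by positivity), ← ENNReal.rpow_mul, ← ENNReal.rpow_mul,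
    mul_one_div_cancel hp1.ne', ENNReal.rpow_one, ENNReal.rpow_one] at h4
  exact h4

theorem IsSparse.sum_weighted_le (hS : IsSparse μ S E L) (hμ : ∀ I : Dyadic, 0 < μ I.toSet)
    (hp : 1 < p) (hw : IsWeight μ w) (hB : apChar μ p w ≠ ∞) {Q₀ : Dyadic} {n : ℕ}
    (hSn : S ⊆ tree n Q₀) {q : ℝ} (hq : 1 < q) {g : ℝ → ℝ≥0∞} (hg : AEMeasurable g (weighted μ w)) :
    ∑ J ∈ S, weighted μ w J.toSet
        * ((∫⁻ x in J.toSet, g x ∂weighted μ w) / weighted μ w J.toSet) ^ q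
      ≤ 2 ^ p * apChar μ p w * (embConst q * L * ∫⁻ x in Q₀.toSet, g x ^ q ∂weighted μ w) := by
  refine le_trans ?_ (mul_le_mul_right (carleson_embedding hq (fun R _ => hw.weighted_pos (hμ R))
    (hw.weighted_lt_top Q₀) hg hS hSn) _)
  rw [Finset.mul_sum]
  refine Finset.sum_le_sum fun J hJ => ?_
  rw [← mul_assoc]
  exact mul_le_mul_left (hS.weighted_le hμ hp hw hB hJ) _

theorem IsSparse.sum_dual_le (hS : IsSparse μ S E L) (hμ : ∀ I : Dyadic, 0 < μ I.toSet)
    (hp : 1 < p) (hw : IsWeight μ w) (hB : apChar μ p w ≠ ∞) {Q₀ : Dyadic} {n : ℕ}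
    (hSn : S ⊆ tree n Q₀) {q : ℝ} (hq : 1 < q) {g : ℝ → ℝ≥0∞}
    (hg : AEMeasurable g (dualMeasure μ p w)) :
    ∑ J ∈ S, dualMeasure μ p w J.toSet
        * ((∫⁻ x in J.toSet, g x ∂dualMeasure μ p w) / dualMeasure μ p w J.toSet) ^ q
      ≤ (2 ^ p * apChar μ p w) ^ (1 / (p - 1))
        * (embConst q * L * ∫⁻ x in Q₀.toSet, g x ^ q ∂dualMeasure μ p w) := by
  refine le_trans ?_ (mul_le_mul_right (carleson_embedding hq (fun R _ => hw.dual_pos (hμ R))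
    (dual_lt_top hμ hp hw hB Q₀) hg hS hSn) _)
  rw [Finset.mul_sum]
  refine Finset.sum_le_sum fun J hJ => ?_
  rw [← mul_assoc]
  exact mul_le_mul_left (hS.dual_le hμ hp hw hJ) _

end sparse

end

/-! ### The bilinear sparse form in weighted spaces. -/

section

variable {μ : Measure ℝ} {w : ℝ → ℝ} {p : ℝ}

theorem setLIntegral_weighted (hw : IsWeight μ w) {g : ℝ → ℝ≥0∞} (hg : AEMeasurable g μ)
    (J : Dyadic) : ∫⁻ x in J.toSet, g x ∂weighted μ w
      = ∫⁻ x in J.toSet, g x * ENNReal.ofReal (w x) ∂μ := by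
  rw [weighted, restrict_withDensity J.measurableSet_toSet,
    lintegral_withDensity_eq_lintegral_mul₀ hw.aemeasurable.restrict hg.restrict]
  simp only [Pi.mul_apply, mul_comm]

theorem setLIntegral_dual (hw : IsWeight μ w) {g : ℝ → ℝ≥0∞} (hg : AEMeasurable g μ)
    (J : Dyadic) : ∫⁻ x in J.toSet, g x ∂dualMeasure μ p w
      = ∫⁻ x in J.toSet, g x * ENNReal.ofReal (w x) ^ (1 - p / (p - 1)) ∂μ := by
  rw [dualMeasure, restrict_withDensity J.measurableSet_toSet,
    lintegral_withDensity_eq_lintegral_mul₀ (hw.aemeasurable.pow_const _).restrict hg.restrict]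
  simp only [Pi.mul_apply, mul_comm]

/-- The function `f w^{p'-1}`, for which `∫ f dμ = ∫ (f w^{p'-1}) w^{1-p'} dμ`. -/
def dualFun (p : ℝ) (w : ℝ → ℝ) (f : ℝ → ℝ≥0∞) (x : ℝ) : ℝ≥0∞ :=
  f x * ENNReal.ofReal (w x) ^ (p / (p - 1) - 1)

theorem aemeasurable_dualFun (hw : IsWeight μ w) {f : ℝ → ℝ≥0∞} (hf : AEMeasurable f μ) :
    AEMeasurable (dualFun p w f) μ := hf.mul (hw.aemeasurable.pow_const _)

theorem setLIntegral_dualFun (hw : IsWeight μ w) {f : ℝ → ℝ≥0∞} (hf : AEMeasurable f μ)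
    (J : Dyadic) : ∫⁻ x in J.toSet, dualFun p w f x ∂dualMeasure μ p w
      = ∫⁻ x in J.toSet, f x ∂μ := by
  rw [setLIntegral_dual hw (aemeasurable_dualFun hw hf)]
  refine lintegral_congr_ae (ae_restrict_of_ae ?_)
  filter_upwards [hw.ae_pos] with x hx
  rw [dualFun, mul_assoc, ← ENNReal.rpow_add _ _ hx ENNReal.ofReal_ne_top]
  simp

theorem setLIntegral_dualFun_rpow (hp : 1 < p) (hw : IsWeight μ w) {f : ℝ → ℝ≥0∞}
    (hf : AEMeasurable f μ) (J : Dyadic) :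
    ∫⁻ x in J.toSet, dualFun p w f x ^ p ∂dualMeasure μ p w
      = ∫⁻ x in J.toSet, f x ^ p ∂weighted μ w := by
  have hp1 : p - 1 ≠ 0 := by linarith
  rw [setLIntegral_dual hw ((aemeasurable_dualFun hw hf).pow_const _),
    setLIntegral_weighted hw (hf.pow_const _)]
  refine lintegral_congr_ae (ae_restrict_of_ae ?_)
  filter_upwards [hw.ae_pos] with x hx
  rw [dualFun, ENNReal.mul_rpow_of_nonneg _ _ (by linarith), ← ENNReal.rpow_mul, mul_assoc,
    ← ENNReal.rpow_add _ _ hx ENNReal.ofReal_ne_top]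
  have : (p / (p - 1) - 1) * p + (1 - p / (p - 1)) = 1 := by field_simp; ring
  rw [this, ENNReal.rpow_one]

end

section

variable {μ : Measure ℝ} [IsLocallyFiniteMeasure μ] {w : ℝ → ℝ} {p : ℝ}

/-- The constant of the bilinear weighted estimate. -/
def formConst (p : ℝ) (N : ℕ) : ℝ≥0∞ :=
  ((N + 2 + 1) ^ 2 * 2 ^ (N + 2) : ℕ) *
    ((((2 : ℝ≥0∞) ^ p) ^ (1 / (p - 1)) * (embConst p * (2 * (N + 2) : ℕ))) ^ (1 / p)
      * ((2 : ℝ≥0∞) ^ p * (embConst (p / (p - 1)) * (2 * (N + 2) : ℕ))) ^ (1 / (p / (p - 1))))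

theorem embConst_ne_top (q : ℝ) : embConst q ≠ ∞ := ENNReal.ofReal_ne_top

theorem formConst_ne_top (hp : 1 < p) (N : ℕ) : formConst p N ≠ ∞ := by
  have hp0 : 0 < p := by linarith
  have hp1 : 0 < p - 1 := by linarith
  have h2 : (2 : ℝ≥0∞) ^ p ≠ ∞ := ENNReal.rpow_ne_top_of_nonneg hp0.le (by norm_num)
  refine ENNReal.mul_ne_top (ENNReal.natCast_ne_top _) (ENNReal.mul_ne_top ?_ ?_)
  · refine ENNReal.rpow_ne_top_of_nonneg (by positivity) (ENNReal.mul_ne_top ?_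
      (ENNReal.mul_ne_top (embConst_ne_top _) (ENNReal.natCast_ne_top _)))
    exact ENNReal.rpow_ne_top_of_nonneg (by positivity) h2
  · exact ENNReal.rpow_ne_top_of_nonneg (by positivity) (ENNReal.mul_ne_top h2
      (ENNReal.mul_ne_top (embConst_ne_top _) (ENNReal.natCast_ne_top _)))

-- Writing f dμ = φ dσ, the averages are taken with respect to σ on `J` and w dμ on `K`, both
-- adapted to the Carleson embedding. The A_p^N condition absorbs `kap` together with the change of
-- measure, and Hölder over near pairs separates `J` from `K`.
open Classical in
theorem sum_form_le (hμ : ∀ I : Dyadic, 0 < μ I.toSet) (hp : 1 < p) (hw : IsWeight μ w)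
    (hB : apChar μ p w ≠ ∞) {N : ℕ} {S : Finset Dyadic} {E : Dyadic → Set ℝ}
    (hS : IsSparse μ S E (2 * (N + 2))) {Q₀ : Dyadic} {n : ℕ} (hSn : S ⊆ tree n Q₀)
    {f g : ℝ → ℝ≥0∞} (hf : AEMeasurable f μ) (hg : AEMeasurable g (weighted μ w)) :
    ∑ J ∈ S, ∑ K ∈ S with Near (N + 2) J K, ENNReal.ofReal (kap (vol μ) J K)
        * ((∫⁻ x in J.toSet, f x ∂μ) / μ J.toSet)
        * ((∫⁻ x in K.toSet, g x ∂weighted μ w) / μ K.toSet)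
      ≤ formConst p N * (apChar μ p w ^ (((p - 1) ^ 2 + 1) / (p * (p - 1)))
          * apNChar μ p N w ^ (1 / p))
        * ((∫⁻ x in Q₀.toSet, f x ^ p ∂weighted μ w) ^ (1 / p)
          * (∫⁻ x in Q₀.toSet, g x ^ (p / (p - 1)) ∂weighted μ w) ^ (1 / (p / (p - 1)))) := by
  have hp0 : 0 < p := by linarith
  have hp1 : 0 < p - 1 := by linarith
  set q := p / (p - 1) with hq
  have hconj : p.HolderConjugate q := Real.HolderConjugate.conjExponent hp
  have hq1 : 1 < q := hconj.symm.lt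
  have hq0 : 0 < q := by linarith
  set α := weighted μ w with hα
  set β := dualMeasure μ p w with hβ
  set φ := dualFun p w f with hφ
  have hβac : β ≪ μ := withDensity_absolutelyContinuous _ _
  have hφm : AEMeasurable φ β := (aemeasurable_dualFun hw hf).mono_ac hβac
  set X : Dyadic → ℝ≥0∞ := fun J => β J.toSet ^ (1 / p) * ((∫⁻ x in J.toSet, φ x ∂β) / β J.toSet)
  set Y : Dyadic → ℝ≥0∞ := fun K => α K.toSet ^ (1 / q) * ((∫⁻ x in K.toSet, g x ∂α) / α K.toSet)
  have hterm : ∀ J K, Near (N + 2) J K → ENNReal.ofReal (kap (vol μ) J K)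
      * ((∫⁻ x in J.toSet, f x ∂μ) / μ J.toSet) * ((∫⁻ x in K.toSet, g x ∂α) / μ K.toSet)
      ≤ apNChar μ p N w ^ (1 / p) * (X J * Y K) := by
    intro J K hJK
    have h1 := ENNReal.rpow_le_rpow (kap_rpow_mul_le hμ hp w hJK) (by positivity : 0 ≤ 1 / p)
    rw [ENNReal.mul_rpow_of_nonneg _ _ (by positivity),
      ENNReal.mul_rpow_of_nonneg _ _ (by positivity),
      ENNReal.mul_rpow_of_nonneg _ _ (by positivity), ← ENNReal.rpow_mul, ← ENNReal.rpow_mul,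
      ← ENNReal.rpow_mul, mul_one_div_cancel hp0.ne', ENNReal.rpow_one, ENNReal.rpow_one] at h1
    have hμJ := (hμ J).ne'
    have hμJ' := (measure_toSet_lt_top μ J).ne
    have hμK := (hμ K).ne'
    have hμK' := (measure_toSet_lt_top μ K).ne
    have hβJ : β J.toSet ≠ 0 := (hw.dual_pos (hμ J)).ne'
    have hβJ' : β J.toSet ≠ ∞ := (dual_lt_top hμ hp hw hB J).ne
    have hαK : α K.toSet ≠ 0 := (hw.weighted_pos (hμ K)).ne'
    have hαK' : α K.toSet ≠ ∞ := (hw.weighted_lt_top K).ne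
    rw [← setLIntegral_dualFun (p := p) hw hf]
    set a := ∫⁻ x in J.toSet, φ x ∂β
    set b := ∫⁻ x in K.toSet, g x ∂α
    have ea : a / μ J.toSet = a / β J.toSet * (β J.toSet / μ J.toSet) := by
      rw [← mul_div_assoc, ENNReal.div_mul_cancel hβJ hβJ']
    have eb : b / μ K.toSet = b / α K.toSet * (α K.toSet / μ K.toSet) := by
      rw [← mul_div_assoc, ENNReal.div_mul_cancel hαK hαK']
    -- The p-th root of the A_p^N bound uses the powers (p-1)/p of σ(J) and 1/p of w(K). What is
    -- left, 1/p and 1/q, are the exponents for Hölder.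
    have eβ : β J.toSet = β J.toSet ^ ((p - 1) * (1 / p)) * β J.toSet ^ (1 / p) := by
      rw [← ENNReal.rpow_add _ _ hβJ hβJ']
      conv_lhs => rw [← ENNReal.rpow_one (β J.toSet)]
      congr 1; field_simp; ring
    have eα : α K.toSet = α K.toSet ^ (1 / p) * α K.toSet ^ (1 / q) := by
      rw [← ENNReal.rpow_add _ _ hαK hαK', one_div, one_div, hconj.inv_add_inv_eq_one,
        ENNReal.rpow_one]
    have key : ENNReal.ofReal (kap (vol μ) J K) * (β J.toSet / μ J.toSet)
        * (α K.toSet / μ K.toSet)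
        ≤ apNChar μ p N w ^ (1 / p) * (β J.toSet ^ (1 / p) * α K.toSet ^ (1 / q)) := by
      conv_lhs => rw [eβ, eα]
      calc _ = (ENNReal.ofReal (kap (vol μ) J K) * (α K.toSet ^ (1 / p)
            * β J.toSet ^ ((p - 1) * (1 / p)))) * ((μ J.toSet)⁻¹ * (μ K.toSet)⁻¹)
            * (β J.toSet ^ (1 / p) * α K.toSet ^ (1 / q)) := by
              simp only [div_eq_mul_inv]; ring
        _ ≤ (apNChar μ p N w ^ (1 / p) * (μ J.toSet * μ K.toSet))
            * ((μ J.toSet)⁻¹ * (μ K.toSet)⁻¹) * (β J.toSet ^ (1 / p) * α K.toSet ^ (1 / q)) := by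
            gcongr
        _ = apNChar μ p N w ^ (1 / p) * ((μ J.toSet * (μ J.toSet)⁻¹) * (μ K.toSet * (μ K.toSet)⁻¹))
            * (β J.toSet ^ (1 / p) * α K.toSet ^ (1 / q)) := by ring
        _ = _ := by
            rw [ENNReal.mul_inv_cancel hμJ hμJ', ENNReal.mul_inv_cancel hμK hμK']; ring
    rw [ea, eb]
    calc _ = (ENNReal.ofReal (kap (vol μ) J K) * (β J.toSet / μ J.toSet)
        * (α K.toSet / μ K.toSet)) * ((a / β J.toSet) * (b / α K.toSet)) := by ring
      _ ≤ _ := mul_le_mul_left key _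
      _ = _ := by ring
  have hsum : ∑ J ∈ S, ∑ K ∈ S with Near (N + 2) J K, ENNReal.ofReal (kap (vol μ) J K)
        * ((∫⁻ x in J.toSet, f x ∂μ) / μ J.toSet) * ((∫⁻ x in K.toSet, g x ∂α) / μ K.toSet)
      ≤ apNChar μ p N w ^ (1 / p) * ∑ J ∈ S, ∑ K ∈ S with Near (N + 2) J K, X J * Y K := by
    rw [Finset.mul_sum]
    refine Finset.sum_le_sum fun J _ => ?_
    rw [Finset.mul_sum]
    exact Finset.sum_le_sum fun K hK => hterm J K (Finset.mem_filter.1 hK).2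
  refine hsum.trans ((mul_le_mul_right (sum_near_le hconj (N + 2) S X Y) _).trans ?_)
  have hXs : ∑ J ∈ S, X J ^ p ≤ (2 ^ p * apChar μ p w) ^ (1 / (p - 1))
      * (embConst p * (2 * (N + 2) : ℕ) * ∫⁻ x in Q₀.toSet, f x ^ p ∂α) := by
    rw [← setLIntegral_dualFun_rpow hp hw hf]
    refine le_trans (le_of_eq ?_) (hS.sum_dual_le hμ hp hw hB hSn hp hφm)
    refine Finset.sum_congr rfl fun J _ => ?_
    rw [ENNReal.mul_rpow_of_nonneg _ _ hp0.le, ← ENNReal.rpow_mul, one_div_mul_cancel hp0.ne',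
      ENNReal.rpow_one]
  have hYs : ∑ K ∈ S, Y K ^ q ≤ 2 ^ p * apChar μ p w
      * (embConst q * (2 * (N + 2) : ℕ) * ∫⁻ x in Q₀.toSet, g x ^ q ∂α) := by
    refine le_trans (le_of_eq ?_) (hS.sum_weighted_le hμ hp hw hB hSn hq1 hg)
    refine Finset.sum_congr rfl fun J _ => ?_
    rw [ENNReal.mul_rpow_of_nonneg _ _ hq0.le, ← ENNReal.rpow_mul, one_div_mul_cancel hq0.ne',
      ENNReal.rpow_one]
  have hX2 := ENNReal.rpow_le_rpow hXs (by positivity : 0 ≤ 1 / p)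
  have hY2 := ENNReal.rpow_le_rpow hYs (by positivity : 0 ≤ 1 / q)
  refine (mul_le_mul_right (mul_le_mul_right (mul_le_mul' hX2 hY2) _) _).trans (le_of_eq ?_)
  have hip : 0 ≤ 1 / p := by positivity
  have hiq : 0 ≤ 1 / q := by positivity
  have hip1 : 0 ≤ 1 / (p - 1) := by positivity
  -- 1/(p(p-1)) comes from the sum with σ, and 1/q = (p-1)/p from the sum with w.
  have eB : apChar μ p w ^ (((p - 1) ^ 2 + 1) / (p * (p - 1)))
      = (apChar μ p w ^ (1 / (p - 1))) ^ (1 / p) * apChar μ p w ^ (1 / q) := by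
    rw [← ENNReal.rpow_mul, ← ENNReal.rpow_add_of_nonneg _ _ (by positivity) hiq]
    congr 1
    rw [hq]
    field_simp
    ring
  rw [formConst, eB, ← hq]
  simp only [ENNReal.mul_rpow_of_nonneg _ _ hip, ENNReal.mul_rpow_of_nonneg _ _ hiq,
    ENNReal.mul_rpow_of_nonneg _ _ hip1]
  ring

end

/-! ### Finite Haar shifts. -/

section step

variable {μ : Measure ℝ}

theorem measurable_haar (μ : Measure ℝ) (K : Dyadic) : Measurable (haar μ K) := by
  unfold haar
  have h : ∀ J : Dyadic, Measurable (J.toSet.indicator (1 : ℝ → ℝ)) := fun J =>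
    measurable_one.indicator J.measurableSet_toSet
  exact (((h _).div_const _).sub ((h _).div_const _)).const_mul _

theorem exists_abs_haar_le (μ : Measure ℝ) (K : Dyadic) : ∃ M, ∀ x, |haar μ K x| ≤ M := by
  refine ⟨√(m μ K) * (1 / μ.real K.left.toSet + 1 / μ.real K.right.toSet), fun x => ?_⟩
  have h : ∀ J : Dyadic, |J.toSet.indicator (1 : ℝ → ℝ) x / μ.real J.toSet| ≤ 1 / μ.real J.toSet := by
    intro J
    rw [abs_div, abs_of_nonneg (measureReal_nonneg (μ := μ))]
    refine div_le_div_of_nonneg_right ?_ measureReal_nonneg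
    by_cases hx : x ∈ J.toSet <;> simp [hx]
  rw [haar, abs_mul, abs_of_nonneg (Real.sqrt_nonneg _)]
  exact mul_le_mul_of_nonneg_left ((abs_sub _ _).trans (add_le_add (h _) (h _)))
    (Real.sqrt_nonneg _)

/-- A finite Haar shift with coefficients `c` in place of `⟨f, h_J⟩`. -/
def stepFun (μ : Measure ℝ) (s t : ℕ) (α : Dyadic → Dyadic → Dyadic → ℝ) (T : Finset Dyadic)
    (c : Dyadic → ℝ) (x : ℝ) : ℝ :=
  ∑ I ∈ T, ∑ J ∈ descendants s I, ∑ K ∈ descendants t I, α I J K * c J * haar μ K x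

variable {s t : ℕ} {α : Dyadic → Dyadic → Dyadic → ℝ} {T : Finset Dyadic} {c : Dyadic → ℝ}

theorem measurable_stepFun : Measurable (stepFun μ s t α T c) := by
  unfold stepFun
  refine Finset.measurable_sum _ fun I _ => Finset.measurable_sum _ fun J _ =>
    Finset.measurable_sum _ fun K _ => (measurable_haar μ K).const_mul _

theorem exists_abs_stepFun_le : ∃ M, 0 ≤ M ∧ ∀ x, |stepFun μ s t α T c x| ≤ M := by
  choose M hM using exists_abs_haar_le μ
  refine ⟨∑ I ∈ T, ∑ J ∈ descendants s I, ∑ K ∈ descendants t I, |α I J K * c J| * M K,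
    ?_, fun x => ?_⟩
  · refine Finset.sum_nonneg fun I _ => Finset.sum_nonneg fun J _ => Finset.sum_nonneg fun K _ =>
      mul_nonneg (abs_nonneg _) ((abs_nonneg _).trans (hM K 0))
  · unfold stepFun
    refine (Finset.abs_sum_le_sum_abs _ _).trans (Finset.sum_le_sum fun I _ => ?_)
    refine (Finset.abs_sum_le_sum_abs _ _).trans (Finset.sum_le_sum fun J _ => ?_)
    refine (Finset.abs_sum_le_sum_abs _ _).trans (Finset.sum_le_sum fun K _ => ?_)
    rw [abs_mul]
    exact mul_le_mul_of_nonneg_left (hM K x) (abs_nonneg _)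

theorem stepFun_eq_zero {Q₀ : Dyadic} (hT : ∀ I ∈ T, Sub I Q₀) {x : ℝ} (hx : x ∉ Q₀.toSet) :
    stepFun μ s t α T c x = 0 := by
  unfold stepFun
  refine Finset.sum_eq_zero fun I hI => Finset.sum_eq_zero fun J _ => Finset.sum_eq_zero
    fun K hK => ?_
  rw [mem_descendants] at hK
  rw [haar_eq_zero, mul_zero]
  exact fun hxK => hx ((Sub.trans ⟨_, hK⟩ (hT I hI)).subset hxK)

theorem additive_setIntegral {f : ℝ → ℝ} (hf : ∀ I : Dyadic, IntegrableOn f I.toSet μ) :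
    Additive fun I => ∫ x in I.toSet, f x ∂μ := by
  intro I
  change ∫ x in I.toSet, f x ∂μ = _
  rw [I.toSet_eq_union, setIntegral_union I.disjoint_children I.right.measurableSet_toSet
    (hf _) (hf _)]

theorem integrable_mul_haar {f : ℝ → ℝ} (hf : ∀ I : Dyadic, IntegrableOn f I.toSet μ)
    (J : Dyadic) : Integrable (fun x => f x * haar μ J x) μ := by
  obtain ⟨M, hM⟩ := exists_abs_haar_le μ J
  have h1 : Integrable (J.toSet.indicator f) μ :=
    (integrable_indicator_iff J.measurableSet_toSet).2 (hf J)
  have h2 := h1.mul_bdd (c := M) (measurable_haar μ J).aestronglyMeasurable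
    (Filter.Eventually.of_forall hM)
  refine h2.congr (Filter.Eventually.of_forall fun x => ?_)
  by_cases hx : x ∈ J.toSet
  · simp [hx]
  · simp [haar_eq_zero μ hx]

theorem integral_mul_haar {f : ℝ → ℝ} (hf : ∀ I : Dyadic, IntegrableOn f I.toSet μ)
    (J : Dyadic) : ∫ x, f x * haar μ J x ∂μ = √(hm (vol μ) J) *
      (avg (vol μ) (fun I => ∫ x in I.toSet, f x ∂μ) J.left
        - avg (vol μ) (fun I => ∫ x in I.toSet, f x ∂μ) J.right) := by
  have h1 : ∀ K : Dyadic, Integrable (K.toSet.indicator f) μ := fun K =>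
    (integrable_indicator_iff K.measurableSet_toSet).2 (hf K)
  have h2 : ∀ x, f x * haar μ J x = √(m μ J) * (J.left.toSet.indicator f x / vol μ J.left
      - J.right.toSet.indicator f x / vol μ J.right) := by
    intro x
    have h3 : ∀ K : Dyadic, K.toSet.indicator f x = f x * K.toSet.indicator 1 x := by
      intro K
      by_cases hx : x ∈ K.toSet <;> simp [hx]
    rw [h3, h3, haar]
    simp only [vol]
    ring
  simp only [h2]
  rw [integral_const_mul, integral_sub ((h1 _).div_const _) ((h1 _).div_const _), integral_div,
    integral_div, integral_indicator J.left.measurableSet_toSet,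
    integral_indicator J.right.measurableSet_toSet]
  rfl

/-- The coefficients are only required to be bounded by masked differences, so that one estimate
serves the full shift and the good part in the weak type argument. -/
theorem integral_stepFun_mul_le (hα : ∀ I J K, |α I J K| ≤ 1) {g : ℝ → ℝ}
    (hg : ∀ I : Dyadic, IntegrableOn g I.toSet μ) {V F : Dyadic → ℝ} {W : Dyadic → Prop}
    (hc : ∀ J, |c J| ≤ √(hm V J) * |mavg V F W J.left - mavg V F W J.right|) :
    ∫ x, stepFun μ s t α T c x * g x ∂μ ≤ ∑ I ∈ T, diffSum V F W s I
      * diffSum (vol μ) (fun I => ∫ x in I.toSet, g x ∂μ) (fun _ => True) t I := by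
  have hint : ∀ I J K, Integrable (fun x => α I J K * c J * haar μ K x * g x) μ := by
    intro I J K
    refine ((integrable_mul_haar hg K).const_mul (α I J K * c J)).congr
      (Filter.Eventually.of_forall fun x => ?_)
    simp only; ring
  have e : ∫ x, stepFun μ s t α T c x * g x ∂μ = ∑ I ∈ T, ∑ J ∈ descendants s I,
      ∑ K ∈ descendants t I, α I J K * c J * ∫ x, g x * haar μ K x ∂μ := by
    simp only [stepFun, Finset.sum_mul]
    rw [integral_finsetSum _ fun I _ => integrable_finsetSum _ fun J _ =>
      integrable_finsetSum _ fun K _ => hint I J K]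
    refine Finset.sum_congr rfl fun I _ => ?_
    rw [integral_finsetSum _ fun J _ => integrable_finsetSum _ fun K _ => hint I J K]
    refine Finset.sum_congr rfl fun J _ => ?_
    rw [integral_finsetSum _ fun K _ => hint I J K]
    refine Finset.sum_congr rfl fun K _ => ?_
    rw [← integral_const_mul]
    congr 1
    ext x
    ring
  rw [e]
  refine Finset.sum_le_sum fun I _ => ?_
  rw [diffSum, diffSum, Finset.sum_mul_sum]
  refine Finset.sum_le_sum fun J _ => Finset.sum_le_sum fun K _ => ?_
  refine (le_abs_self _).trans ?_
  rw [abs_mul, abs_mul, integral_mul_haar hg, abs_mul (√(hm (vol μ) K)),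
    abs_of_nonneg (Real.sqrt_nonneg (hm (vol μ) K))]
  simp only [mavg, if_true]
  refine mul_le_mul_of_nonneg_right ?_ (by positivity)
  calc |α I J K| * |c J| ≤ 1 * |c J| := by gcongr; exact hα I J K
    _ ≤ _ := by rw [one_mul]; exact hc J

end step

/-! ### The strong type estimate for finite Haar shifts. -/

section

variable {μ : Measure ℝ} {w : ℝ → ℝ} {p : ℝ}

theorem IsWeight.integrableOn (hw : IsWeight μ w) (J : Dyadic) : IntegrableOn w J.toSet μ := by
  refine (hw.locallyIntegrable.integrableOn_isCompact (isCompact_Icc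
    (a := (J.pos : ℝ) * (2 : ℝ) ^ (-J.scale))
    (b := ((J.pos : ℝ) + 1) * (2 : ℝ) ^ (-J.scale)))).mono_set ?_
  exact Ico_subset_Icc_self

/-- The function that tests the `L^p(w)` norm of `t`. -/
def testFun (p : ℝ) (w t : ℝ → ℝ) (x : ℝ) : ℝ := |t x| ^ (p - 1) * (SignType.sign (t x) : ℝ) * w x

theorem mul_testFun (hp : 1 < p) (t : ℝ → ℝ) (x : ℝ) :
    t x * testFun p w t x = |t x| ^ p * w x := by
  have h1 : t x * (SignType.sign (t x) : ℝ) = |t x| := by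
    rw [mul_comm]; exact sign_mul_self (t x)
  have h2 : |t x| ^ p = |t x| ^ (p - 1) * |t x| := by
    rcases (abs_nonneg (t x)).eq_or_lt' with h | h
    · rw [h, Real.zero_rpow (by linarith), mul_zero]
    · rw [← Real.rpow_add_one h.ne']; congr 1; ring
  rw [testFun, h2]
  linear_combination (|t x| ^ (p - 1) * w x) * h1

theorem enorm_testFun (hp : 1 < p) (t : ℝ → ℝ) (x : ℝ) :
    ‖testFun p w t x‖ₑ = ‖t x‖ₑ ^ (p - 1) * ‖w x‖ₑ := by
  rw [testFun, enorm_mul, enorm_mul]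
  congr 1
  rw [Real.enorm_rpow_of_nonneg (abs_nonneg _) (by linarith), Real.enorm_abs]
  rcases lt_trichotomy (t x) 0 with h | h | h
  · simp [h]
  · simp [h, sub_pos.2 hp]
  · simp [h]

theorem lintegral_weighted (hw : IsWeight μ w) {g : ℝ → ℝ≥0∞} (hg : AEMeasurable g μ) :
    ∫⁻ x, g x ∂weighted μ w = ∫⁻ x, g x * ENNReal.ofReal (w x) ∂μ := by
  rw [weighted, lintegral_withDensity_eq_lintegral_mul₀ hw.aemeasurable hg]
  simp only [Pi.mul_apply, mul_comm]

theorem IsWeight.enorm_ae_eq (hw : IsWeight μ w) :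
    ∀ᵐ x ∂μ, ‖w x‖ₑ = ENNReal.ofReal (w x) := by
  filter_upwards [hw.pos] with x hx
  rw [Real.enorm_eq_ofReal hx.le]

variable {s t n N : ℕ} {α : Dyadic → Dyadic → Dyadic → ℝ} {Q₀ : Dyadic} {c : Dyadic → ℝ}
  {D : ℝ}

/-- A finite shift is bounded and supported in `Q₀`. This finiteness permits the absorption
arguments, where a power of the integral is cancelled. -/
theorem lintegral_stepFun_rpow_lt_top (hw : IsWeight μ w) (hp : 0 < p) :
    ∫⁻ x, ‖stepFun μ s t α (tree n Q₀) c x‖ₑ ^ p ∂weighted μ w < ∞ := by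
  obtain ⟨M, hM0, hM⟩ := exists_abs_stepFun_le (μ := μ) (s := s) (t := t) (α := α)
    (T := tree n Q₀) (c := c)
  refine lt_of_le_of_lt (lintegral_mono (g := Q₀.toSet.indicator
    fun _ => ENNReal.ofReal M ^ p) fun x => ?_) ?_
  · by_cases hx : x ∈ Q₀.toSet
    · rw [indicator_of_mem hx, Real.enorm_eq_ofReal_abs]
      exact ENNReal.rpow_le_rpow (ENNReal.ofReal_le_ofReal (hM x)) hp.le
    · rw [stepFun_eq_zero (fun I hI => (mem_tree_iff.1 hI).1) hx]
      simp [hp]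
  · rw [lintegral_indicator_const Q₀.measurableSet_toSet]
    exact ENNReal.mul_lt_top (ENNReal.rpow_lt_top_of_nonneg hp.le ENNReal.ofReal_ne_top)
      (hw.weighted_lt_top Q₀)

variable [IsLocallyFiniteMeasure μ]

theorem ofReal_avg_setIntegral_abs (hμ : ∀ I : Dyadic, 0 < μ I.toSet) {f : ℝ → ℝ}
    (hf : ∀ I : Dyadic, IntegrableOn f I.toSet μ) (I : Dyadic) :
    ENNReal.ofReal (avg (vol μ) (fun I => ∫ x in I.toSet, |f x| ∂μ) I)
      = (∫⁻ x in I.toSet, ‖f x‖ₑ ∂μ) / μ I.toSet := by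
  rw [avg, ENNReal.ofReal_div_of_pos (show 0 < vol μ I from real_pos hμ I), ofReal_vol,
    ofReal_integral_eq_lintegral_ofReal (hf I).abs
      (Filter.Eventually.of_forall fun x => abs_nonneg _)]
  simp only [← Real.enorm_eq_ofReal_abs]

open Classical in
/-- Sparse domination of a finite Haar shift applied to a masked function, tested against
its own power in `L^p(w)`. -/
theorem exists_sparse_lintegral_stepFun_le (hμ : ∀ I : Dyadic, 0 < μ I.toSet) (hp : 1 < p)
    (hw : IsWeight μ w) (hα : ∀ I J K, |α I J K| ≤ 1) {f : ℝ → ℝ}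
    (hf : ∀ I : Dyadic, IntegrableOn f I.toSet μ) {W : Dyadic → Prop}
    (hW : ∀ I, W I → W I.parent) (hD0 : 0 ≤ D)
    (hD : ∀ I J, Near (N + 2) I J → hm (vol μ) I ≤ D * hm (vol μ) J) (hst : s + t ≤ N)
    (hc : ∀ J, |c J| ≤ √(hm (vol μ) J) *
      |mavg (vol μ) (fun I => ∫ x in I.toSet, f x ∂μ) W J.left
        - mavg (vol μ) (fun I => ∫ x in I.toSet, f x ∂μ) W J.right|) :
    ∃ S E, IsSparse μ S E (2 * (N + 2)) ∧ S ⊆ tree (n + N + 2) Q₀ ∧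
      ∫⁻ x, ‖stepFun μ s t α (tree n Q₀) c x‖ₑ ^ p ∂weighted μ w
        ≤ ENNReal.ofReal (domConst N D) *
          ∑ J ∈ S, ∑ K ∈ S with Near (N + 2) J K, ENNReal.ofReal (kap (vol μ) J K)
            * (if W J then (∫⁻ x in J.toSet, ‖f x‖ₑ ∂μ) / μ J.toSet else 0)
            * ((∫⁻ x in K.toSet, ‖stepFun μ s t α (tree n Q₀) c x‖ₑ ^ (p - 1) ∂weighted μ w)
              / μ K.toSet) := by
  have hp1 : 0 < p - 1 := by linarith
  set u : ℝ → ℝ := stepFun μ s t α (tree n Q₀) c with hu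
  have hum : Measurable u := measurable_stepFun
  obtain ⟨M, hM0, hM⟩ : ∃ M, 0 ≤ M ∧ ∀ x, |u x| ≤ M := exists_abs_stepFun_le
  set g : ℝ → ℝ := testFun p w u with hg
  have hsm : AEStronglyMeasurable (fun x => |u x| ^ (p - 1) * (SignType.sign (u x) : ℝ)) μ := by
    refine Measurable.aestronglyMeasurable ?_
    refine (hum.abs.pow_const _).mul ?_
    have hs : ∀ y : ℝ, (SignType.sign y : ℝ) = if 0 < y then 1 else if y < 0 then -1 else 0 := by
      intro y
      rw [sign_apply]
      split_ifs <;> simp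
    simp only [hs]
    exact Measurable.ite (measurableSet_lt measurable_const hum) measurable_const
      (Measurable.ite (measurableSet_lt hum measurable_const) measurable_const measurable_const)
  have hsb : ∀ x, ‖|u x| ^ (p - 1) * (SignType.sign (u x) : ℝ)‖ ≤ M ^ (p - 1) := by
    intro x
    rw [norm_mul, Real.norm_eq_abs, abs_of_nonneg (by positivity)]
    have h1 : |u x| ^ (p - 1) ≤ M ^ (p - 1) :=
      Real.rpow_le_rpow (abs_nonneg _) (hM x) hp1.le
    have h2 : ‖(SignType.sign (u x) : ℝ)‖ ≤ 1 := by
      rcases lt_trichotomy (u x) 0 with h | h | h <;> simp [h]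
    calc _ ≤ M ^ (p - 1) * 1 := by gcongr
      _ = _ := mul_one _
  have hgi : ∀ I : Dyadic, IntegrableOn g I.toSet μ := fun I =>
    (hw.integrableOn I).bdd_mul hsm.restrict (Filter.Eventually.of_forall hsb)
  have hgw : ∀ x, u x * g x = |u x| ^ p * w x := mul_testFun hp u
  have hugi : Integrable (fun x => u x * g x) μ := by
    have h1 : Integrable (Q₀.toSet.indicator g) μ :=
      (integrable_indicator_iff Q₀.measurableSet_toSet).2 (hgi Q₀)
    refine (h1.bdd_mul (c := M) hum.aestronglyMeasurable (Filter.Eventually.of_forall hM)).congr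
      (Filter.Eventually.of_forall fun x => ?_)
    by_cases hx : x ∈ Q₀.toSet
    · simp [hx]
    · have : u x = 0 := stepFun_eq_zero (fun I hI => (mem_tree_iff.1 hI).1) hx
      simp [this]
  have hug0 : 0 ≤ᵐ[μ] fun x => u x * g x := by
    filter_upwards [hw.pos] with x hx
    simp only [hgw, Pi.zero_apply]; positivity
  have hleft : ∫⁻ x, ‖u x‖ₑ ^ p ∂weighted μ w = ENNReal.ofReal (∫ x, u x * g x ∂μ) := by
    rw [lintegral_weighted hw (hum.enorm.pow_const p).aemeasurable,
      ofReal_integral_eq_lintegral_ofReal hugi hug0]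
    refine lintegral_congr_ae ?_
    filter_upwards [hw.pos] with x hx
    rw [hgw, ENNReal.ofReal_mul (by positivity), Real.enorm_eq_ofReal_abs,
      ENNReal.ofReal_rpow_of_nonneg (abs_nonneg _) (by linarith)]
  have hgav : ∀ K : Dyadic, ENNReal.ofReal (avg (vol μ) (fun I => ∫ x in I.toSet, |g x| ∂μ) K)
      = (∫⁻ x in K.toSet, ‖u x‖ₑ ^ (p - 1) ∂weighted μ w) / μ K.toSet := by
    intro K
    rw [ofReal_avg_setIntegral_abs hμ hgi,
      setLIntegral_weighted hw (hum.enorm.pow_const _).aemeasurable]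
    congr 1
    refine lintegral_congr_ae (ae_restrict_of_ae ?_)
    filter_upwards [hw.enorm_ae_eq] with x hx
    rw [hg, enorm_testFun hp, hx]
  have hV0 : ∀ I : Dyadic, 0 < vol μ I := real_pos hμ
  set F₁ : Dyadic → ℝ := fun I => ∫ x in I.toSet, |f x| ∂μ
  set H₁ : Dyadic → ℝ := fun I => ∫ x in I.toSet, |g x| ∂μ
  have hF₁ : Additive F₁ := additive_setIntegral fun I => (hf I).abs
  have hH₁ : Additive H₁ := additive_setIntegral fun I => (hgi I).abs
  have hF0 : ∀ I, 0 ≤ F₁ I := fun I => integral_nonneg fun x => abs_nonneg _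
  have hH0 : ∀ I, 0 ≤ H₁ I := fun I => integral_nonneg fun x => abs_nonneg _
  have hdom := domination (V := vol μ) (st := stopRule (vol μ) F₁ H₁) (Q₀ := Q₀) (s := s) (t := t)
    additive_vol hV0 (additive_setIntegral hf)
    hF₁ (fun I => abs_integral_le_integral_abs) (additive_setIntegral hgi) hH₁
    (fun I => abs_integral_le_integral_abs) hW (WH := fun _ => True) (fun _ _ => trivial)
    (avg_le_of_stopRule hV0 hF0) (avg_le_of_stopRule' hV0 hH0) hD0 hD hst n
  have hfin := (integral_stepFun_mul_le (T := tree n Q₀) hα hgi hc (s := s) (t := t)).trans hdom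
  refine ⟨_, _, isSparse_sparseFam hμ hF₁ hF0 hH₁ hH0 N n, Finset.filter_subset _ _, ?_⟩
  have hdc : 0 ≤ domConst N D := by unfold domConst; positivity
  rw [hleft]
  refine (ENNReal.ofReal_le_ofReal hfin).trans (le_of_eq ?_)
  have hmF : ∀ J, 0 ≤ mavg (vol μ) F₁ W J := mavg_nonneg hV0 hF0 W
  have hmH : ∀ J, 0 ≤ mavg (vol μ) H₁ (fun _ => True) J := mavg_nonneg hV0 hH0 _
  rw [ENNReal.ofReal_mul hdc, domForm]
  congr 1
  rw [ENNReal.ofReal_sum_of_nonneg fun J _ => Finset.sum_nonneg fun K _ =>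
    mul_nonneg (mul_nonneg (kap_nonneg hV0 _ _) (hmF _)) (hmH _)]
  refine Finset.sum_congr rfl fun J _ => ?_
  rw [ENNReal.ofReal_sum_of_nonneg fun K _ =>
    mul_nonneg (mul_nonneg (kap_nonneg hV0 _ _) (hmF _)) (hmH _)]
  refine Finset.sum_congr (Finset.filter_congr_decidable _ _ _) fun K _ => ?_
  rw [ENNReal.ofReal_mul (mul_nonneg (kap_nonneg hV0 _ _) (hmF _)),
    ENNReal.ofReal_mul (kap_nonneg hV0 _ _)]
  congr 1
  · congr 1
    rw [mavg]
    split_ifs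
    · exact ofReal_avg_setIntegral_abs hμ hf J
    · simp
  · rw [← hgav, mavg, if_pos trivial]

/-- The comparison of m with its value at the parent is chained up from `I` to the common ancestor
and down to `J`. -/
theorem IsBalanced.exists_near (hμ : IsBalanced μ) (n : ℕ) :
    ∃ D : ℝ, 1 ≤ D ∧ ∀ I J, Near n I J → hm (vol μ) I ≤ D * hm (vol μ) J := by
  obtain ⟨C, hC⟩ := hμ.comparable
  have hV0 : ∀ I : Dyadic, 0 < vol μ I := real_pos hμ.pos
  have hpos : ∀ I, 0 < hm (vol μ) I := hm_pos hV0
  -- A constant at least 1 allows the power a + b to be replaced by n.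
  set C' := max C 1
  have hC1 : 1 ≤ C' := le_max_right _ _
  have hC' : ∀ I : Dyadic, hm (vol μ) I ≤ C' * hm (vol μ) I.parent
      ∧ hm (vol μ) I.parent ≤ C' * hm (vol μ) I := fun I =>
    ⟨(hC I).1.trans (mul_le_mul_of_nonneg_right (le_max_left _ _) (hpos _).le),
      (hC I).2.trans (mul_le_mul_of_nonneg_right (le_max_left _ _) (hpos _).le)⟩
  have h1 : ∀ a (I : Dyadic), hm (vol μ) I ≤ C' ^ a * hm (vol μ) (ancestor a I) ∧
      hm (vol μ) (ancestor a I) ≤ C' ^ a * hm (vol μ) I := by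
    intro a
    induction a with
    | zero => intro I; simp [ancestor]
    | succ a ih =>
      intro I
      rw [ancestor_succ']
      have := ih I
      have h2 := hC' (ancestor a I)
      constructor
      · calc _ ≤ C' ^ a * hm (vol μ) (ancestor a I) := this.1
          _ ≤ C' ^ a * (C' * hm (vol μ) (ancestor a I).parent) := by gcongr; exact h2.1
          _ = _ := by ring
      · calc _ ≤ C' * hm (vol μ) (ancestor a I) := h2.2
          _ ≤ C' * (C' ^ a * hm (vol μ) I) := by gcongr; exact this.2
          _ = _ := by ring
  refine ⟨C' ^ n, one_le_pow₀ hC1, ?_⟩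
  rintro I J ⟨a, b, hab, he⟩
  calc hm (vol μ) I ≤ C' ^ a * hm (vol μ) (ancestor a I) := (h1 a I).1
    _ = C' ^ a * hm (vol μ) (ancestor b J) := by rw [he]
    _ ≤ C' ^ a * (C' ^ b * hm (vol μ) J) := by gcongr; exact (h1 b J).2
    _ = C' ^ (a + b) * hm (vol μ) J := by ring
    _ ≤ C' ^ n * hm (vol μ) J := by
      have := (hpos J).le
      gcongr

/-- The weighted strong type estimate for a finite Haar shift. -/
theorem lintegral_stepFun_rpow_le (hμ : ∀ I : Dyadic, 0 < μ I.toSet) (hp : 1 < p)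
    (hw : IsWeight μ w) (hB : apChar μ p w ≠ ∞) (hα : ∀ I J K, |α I J K| ≤ 1) {f : ℝ → ℝ}
    (hfm : AEStronglyMeasurable f μ) (hf : ∀ I : Dyadic, IntegrableOn f I.toSet μ) (hD0 : 0 ≤ D)
    (hD : ∀ I J, Near (N + 2) I J → hm (vol μ) I ≤ D * hm (vol μ) J) (hst : s + t ≤ N)
    (hc : ∀ J, c J = ∫ x, f x * haar μ J x ∂μ) :
    (∫⁻ x, ‖stepFun μ s t α (tree n Q₀) c x‖ₑ ^ p ∂weighted μ w) ^ (1 / p)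
      ≤ ENNReal.ofReal (domConst N D) * (formConst p N *
        (apChar μ p w ^ (((p - 1) ^ 2 + 1) / (p * (p - 1))) * apNChar μ p N w ^ (1 / p)))
        * (∫⁻ x in Q₀.toSet, ‖f x‖ₑ ^ p ∂weighted μ w) ^ (1 / p) := by
  classical
  have hp0 : 0 < p := by linarith
  have hp1 : 0 < p - 1 := by linarith
  set Z := ∫⁻ x, ‖stepFun μ s t α (tree n Q₀) c x‖ₑ ^ p ∂weighted μ w with hZ
  have hZt : Z < ∞ := lintegral_stepFun_rpow_lt_top hw hp0
  rcases eq_or_ne Z 0 with hZ0 | hZ0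
  · rw [hZ0, ENNReal.zero_rpow_of_pos (by positivity)]; exact zero_le
  obtain ⟨S, E, hS, hSn, hle⟩ := exists_sparse_lintegral_stepFun_le (n := n) (Q₀ := Q₀) (c := c)
    hμ hp hw hα hf
    (W := fun _ => True) (fun _ _ => trivial) hD0 hD hst (fun J => by
      rw [hc, integral_mul_haar hf, abs_mul, abs_of_nonneg (Real.sqrt_nonneg _)]
      simp only [mavg, if_true, le_refl])
  simp only [if_true] at hle
  have hform := sum_form_le hμ hp hw hB hS hSn (f := fun x => ‖f x‖ₑ)
    (g := fun x => ‖stepFun μ s t α (tree n Q₀) c x‖ₑ ^ (p - 1)) hfm.enorm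
    (measurable_stepFun.enorm.pow_const _).aemeasurable
  have hgq : ∫⁻ x in Q₀.toSet, (‖stepFun μ s t α (tree n Q₀) c x‖ₑ ^ (p - 1)) ^ (p / (p - 1))
      ∂weighted μ w ≤ Z := by
    refine (setLIntegral_le_lintegral _ _).trans (le_of_eq (lintegral_congr fun x => ?_))
    rw [← ENNReal.rpow_mul, mul_div_cancel₀ _ hp1.ne']
  have hq : 1 / (p / (p - 1)) = 1 - 1 / p := by field_simp
  set R := ENNReal.ofReal (domConst N D) * (formConst p N *
        (apChar μ p w ^ (((p - 1) ^ 2 + 1) / (p * (p - 1))) * apNChar μ p N w ^ (1 / p)))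
        * (∫⁻ x in Q₀.toSet, ‖f x‖ₑ ^ p ∂weighted μ w) ^ (1 / p) with hR
  -- The test function has L^q(w) norm Z^(1/q) with 1/q = 1 - 1/p, a power of Z that is neither zero
  -- nor infinite and can be cancelled.
  have hmain : Z ≤ R * Z ^ (1 - 1 / p) := by
    refine hle.trans ((mul_le_mul_right hform _).trans ?_)
    rw [← hq]
    calc _ ≤ ENNReal.ofReal (domConst N D) * (formConst p N *
        (apChar μ p w ^ (((p - 1) ^ 2 + 1) / (p * (p - 1))) * apNChar μ p N w ^ (1 / p))
        * ((∫⁻ x in Q₀.toSet, ‖f x‖ₑ ^ p ∂weighted μ w) ^ (1 / p)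
          * Z ^ (1 / (p / (p - 1))))) := by gcongr
      _ = _ := by rw [hR]; ring
  have hsplit : Z ^ (1 / p) * Z ^ (1 - 1 / p) = Z := by
    rw [← ENNReal.rpow_add _ _ hZ0 hZt.ne, add_sub_cancel, ENNReal.rpow_one]
  have hne : Z ^ (1 - 1 / p) ≠ 0 := (ENNReal.rpow_pos (pos_iff_ne_zero.2 hZ0) hZt.ne).ne'
  have hnt : Z ^ (1 - 1 / p) ≠ ∞ := ENNReal.rpow_ne_top_of_ne_zero hZ0 hZt.ne
  exact (ENNReal.mul_le_mul_iff_left hne hnt).1 (hsplit.trans_le hmain)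

end

/-! ### The strong type estimate for the maximal function. -/

section

variable {μ : Measure ℝ} {N : ℕ}

/-- The part of `𝓜^N f` that comes from a finite tree. -/
def maxFin (μ : Measure ℝ) (N n : ℕ) (Q₀ : Dyadic) (f : ℝ → ℝ) (x : ℝ) : ℝ≥0∞ :=
  ⨆ (I : Dyadic) (J : Dyadic) (_ : I ∈ tree n Q₀) (_ : J ∈ tree n Q₀) (_ : Near (N + 2) I J),
    J.toSet.indicator (fun _ => cb μ 1 I J * ⨍⁻ y in I.toSet, ‖f y‖ₑ ∂μ) x

theorem maxFin_le {n : ℕ} {Q₀ : Dyadic} {f : ℝ → ℝ} {x : ℝ} {r : ℝ≥0∞}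
    (h : ∀ I J, I ∈ tree n Q₀ → J ∈ tree n Q₀ → Near (N + 2) I J → x ∈ J.toSet →
      cb μ 1 I J * ⨍⁻ y in I.toSet, ‖f y‖ₑ ∂μ ≤ r) : maxFin μ N n Q₀ f x ≤ r := by
  refine iSup_le fun I => iSup_le fun J => iSup_le fun hI => iSup_le fun hJ => iSup_le fun hn => ?_
  by_cases hx : x ∈ J.toSet
  · rw [indicator_of_mem hx]; exact h I J hI hJ hn hx
  · rw [indicator_of_notMem hx]; exact zero_le

theorem le_maxFin {n : ℕ} {Q₀ I J : Dyadic} {f : ℝ → ℝ} {x : ℝ} (hI : I ∈ tree n Q₀)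
    (hJ : J ∈ tree n Q₀) (hn : Near (N + 2) I J) :
    J.toSet.indicator (fun _ => cb μ 1 I J * ⨍⁻ y in I.toSet, ‖f y‖ₑ ∂μ) x
      ≤ maxFin μ N n Q₀ f x :=
  le_iSup_of_le I (le_iSup_of_le J (le_iSup_of_le hI (le_iSup_of_le hJ
    (le_iSup_of_le hn le_rfl))))

theorem measurable_maxFin {n : ℕ} {Q₀ : Dyadic} {f : ℝ → ℝ} :
    Measurable (maxFin μ N n Q₀ f) := by
  have : Countable Dyadic := by
    have : Function.Injective fun I : Dyadic => (I.scale, I.pos) := fun I J h => by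
      simp only [Prod.mk.injEq] at h
      exact Dyadic.ext h.1 h.2
    exact this.countable
  unfold maxFin
  refine Measurable.iSup fun I => Measurable.iSup fun J => Measurable.iSup_Prop _ ?_
  refine Measurable.iSup_Prop _ (Measurable.iSup_Prop _ ?_)
  exact measurable_const.indicator J.measurableSet_toSet

theorem laverage_toSet (f : ℝ → ℝ≥0∞) (I : Dyadic) :
    ⨍⁻ y in I.toSet, f y ∂μ = (∫⁻ y in I.toSet, f y ∂μ) / μ I.toSet := by
  rw [setLAverage_eq]

variable [IsLocallyFiniteMeasure μ] {D : ℝ}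

theorem cb_one_mul (hμ : ∀ I : Dyadic, 0 < μ I.toSet) (I J : Dyadic) :
    cb μ 1 I J * μ J.toSet = ENNReal.ofReal (kap (vol μ) J I) := by
  have := cb_mul hμ (p := 1) le_rfl I J
  simpa using this

theorem cb_one_eq (hμ : ∀ I : Dyadic, 0 < μ I.toSet) (I J : Dyadic) :
    cb μ 1 I J = ENNReal.ofReal (kap (vol μ) J I) / μ J.toSet := by
  rw [← cb_one_mul hμ, ENNReal.mul_div_cancel_right (hμ J).ne' (measure_toSet_lt_top μ J).ne]

theorem cb_one_le_of_kap_le (hμ : ∀ I : Dyadic, 0 < μ I.toSet) {I Q J : Dyadic} (hD0 : 0 ≤ D)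
    (h : kap (vol μ) J I ≤ D * kap (vol μ) J Q) : cb μ 1 I J ≤ ENNReal.ofReal D * cb μ 1 Q J := by
  rw [cb_one_eq hμ, cb_one_eq hμ, ← mul_div_assoc, ← ENNReal.ofReal_mul hD0]
  exact ENNReal.div_le_div_right (ENNReal.ofReal_le_ofReal h) _

theorem kap_le_mul_kap (hD1 : 1 ≤ D) {n : ℕ}
    (hμ : ∀ I : Dyadic, 0 < μ I.toSet)
    (hD : ∀ I J, Near n I J → hm (vol μ) I ≤ D * hm (vol μ) J) {I Q J : Dyadic}
    (hIJ : I ≠ J) (hQJ : Q ≠ J) (h : Near n I Q) : kap (vol μ) J I ≤ D * kap (vol μ) J Q := by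
  have hV0 : ∀ I : Dyadic, 0 < vol μ I := real_pos hμ
  have hQ := hm_nonneg hV0 Q
  have h1 : √(hm (vol μ) I) ≤ D * √(hm (vol μ) Q) := by
    refine (Real.sqrt_le_sqrt (hD _ _ h)).trans ?_
    rw [Real.sqrt_mul (by linarith)]
    exact mul_le_mul_of_nonneg_right (Real.sqrt_le_self_iff.2 (Or.inr hD1)) (Real.sqrt_nonneg _)
  rw [kap, if_neg hIJ.symm, kap, if_neg hQJ.symm]
  calc _ ≤ √(hm (vol μ) J) * (D * √(hm (vol μ) Q)) := by gcongr
    _ = _ := by ring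

theorem kap_le_mul_vol (hD1 : 1 ≤ D) {n : ℕ}
    (hμ : ∀ I : Dyadic, 0 < μ I.toSet)
    (hD : ∀ I J, Near n I J → hm (vol μ) I ≤ D * hm (vol μ) J) {I J : Dyadic}
    (h : Near n I J) : kap (vol μ) J I ≤ D * vol μ J := by
  have hV0 : ∀ I : Dyadic, 0 < vol μ I := real_pos hμ
  rw [kap]
  split_ifs with he
  · nlinarith [hV0 J]
  · have hJ := hm_nonneg hV0 J
    have h1 : √(hm (vol μ) I) ≤ D * √(hm (vol μ) J) := by
      refine (Real.sqrt_le_sqrt (hD _ _ h)).trans ?_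
      rw [Real.sqrt_mul (by linarith)]
      exact mul_le_mul_of_nonneg_right (Real.sqrt_le_self_iff.2 (Or.inr hD1)) (Real.sqrt_nonneg _)
    calc _ ≤ √(hm (vol μ) J) * (D * √(hm (vol μ) J)) := by gcongr
      _ = D * hm (vol μ) J := by
        rw [mul_left_comm, Real.mul_self_sqrt hJ]
      _ ≤ _ := by gcongr; exact hm_le additive_vol hV0 J

/-- Off the diagonal, √m(I) √m(J) / μ(J) ≤ D m(J)/μ(J) ≤ D. A term of the modified maximal function
thus exceeds the average over `I` by at most a constant factor. -/
theorem cb_one_le (hD1 : 1 ≤ D) {n : ℕ} (hμ : ∀ I : Dyadic, 0 < μ I.toSet)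
    (hD : ∀ I J, Near n I J → hm (vol μ) I ≤ D * hm (vol μ) J) {I J : Dyadic}
    (h : Near n I J) : cb μ 1 I J ≤ ENNReal.ofReal D := by
  rw [cb_one_eq hμ]
  refine ENNReal.div_le_of_le_mul ?_
  rw [← ofReal_vol, ← ENNReal.ofReal_mul (by linarith)]
  exact ENNReal.ofReal_le_ofReal (kap_le_mul_vol hD1 hμ hD h)

/-- If `I ⊆ Q` and `J` is near `I` but not inside `Q`, then `Q` lies between `I` and `J`. -/
theorem Dyadic.Near.between {n : ℕ} {I J Q : Dyadic} (h : Near n I J) (hIQ : Sub I Q)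
    (hJQ : ¬ Sub J Q) : Near n Q J ∧ Near n I Q ∧ ∃ i, i ≤ n ∧ Sub Q (ancestor i J) := by
  obtain ⟨a, b, hab, he⟩ := h
  have hP : Sub I (ancestor a I) := sub_ancestor a I
  have hJP : Sub J (ancestor a I) := he ▸ sub_ancestor b J
  rcases hIQ.total hP with h1 | h1
  · obtain ⟨i, hi⟩ := hIQ
    obtain ⟨k, hk⟩ := h1
    have hs1 : I.scale - i = Q.scale := by rw [← hi, scale_ancestor]
    have hs2 : Q.scale - k = I.scale - a := by rw [← scale_ancestor, hk, scale_ancestor]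
    refine ⟨⟨k, b, by omega, by rw [hk, he]⟩, ⟨i, 0, by omega, by rw [hi]; rfl⟩, b, by omega,
      ⟨k, by rw [hk, he]⟩⟩
  · exact absurd (hJP.trans h1) hJQ

/-- A term of `𝓜^N` is dominated by a term with `I` replaced by its stopping ancestor. -/
theorem cb_mul_laverage_le (hμ : ∀ I : Dyadic, 0 < μ I.toSet) (hD1 : 1 ≤ D)
    (hD : ∀ I J, Near (N + 2) I J → hm (vol μ) I ≤ D * hm (vol μ) J) {f : ℝ → ℝ}
    {I J Q : Dyadic} (hIQ : Sub I Q) (hIJ : Near (N + 2) I J) {x : ℝ} (hx : x ∈ J.toSet)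
    (hf : ⨍⁻ y in I.toSet, ‖f y‖ₑ ∂μ ≤ 4 * ⨍⁻ y in Q.toSet, ‖f y‖ₑ ∂μ) :
    ∃ J', Near (N + 2) Q J' ∧ x ∈ J'.toSet ∧ cb μ 1 I J * ⨍⁻ y in I.toSet, ‖f y‖ₑ ∂μ
      ≤ 4 * ENNReal.ofReal D * (cb μ 1 Q J' * ⨍⁻ y in Q.toSet, ‖f y‖ₑ ∂μ) := by
  -- If `J` lies in `Q`, the pair (Q, Q) with coefficient 1 takes over. Otherwise `Q` lies between
  -- `I` and the common ancestor of `I` and `J`, so (Q, J) is again near and has a comparable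
  -- coefficient.
  by_cases hJQ : Sub J Q
  · refine ⟨Q, Near.refl _ _, hJQ.subset hx, ?_⟩
    have h1 : cb μ 1 Q Q = 1 := by simp [cb]
    rw [h1, one_mul]
    calc _ ≤ ENNReal.ofReal D * (4 * ⨍⁻ y in Q.toSet, ‖f y‖ₑ ∂μ) :=
        mul_le_mul' (cb_one_le hD1 hμ hD hIJ) hf
      _ = _ := by ring
  · obtain ⟨h1, h2, -⟩ := hIJ.between hIQ hJQ
    refine ⟨J, h1, hx, ?_⟩
    have hIJ' : I ≠ J := fun h => hJQ (h ▸ hIQ)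
    have hQJ' : Q ≠ J := fun h => hJQ (h ▸ Sub.refl _)
    calc _ ≤ ENNReal.ofReal D * cb μ 1 Q J * (4 * ⨍⁻ y in Q.toSet, ‖f y‖ₑ ∂μ) :=
        mul_le_mul' (cb_one_le_of_kap_le hμ (by linarith)
          (kap_le_mul_kap hD1 hμ hD hIJ' hQJ' h2)) hf
      _ = _ := by ring

variable {w : ℝ → ℝ} {p : ℝ}

/-- The two-weight testing of one term: with f dμ = φ dσ, the A_p^N condition bounds its L^p(w) norm
by the corresponding term of the Carleson embedding for σ. -/
theorem cb_rpow_mul_le (hμ : ∀ I : Dyadic, 0 < μ I.toSet) (hp : 1 < p) (hw : IsWeight μ w)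
    (hB : apChar μ p w ≠ ∞) {f : ℝ → ℝ≥0∞} (hf : AEMeasurable f μ) {Q J : Dyadic}
    (h : Near (N + 2) Q J) :
    (cb μ 1 Q J * ⨍⁻ y in Q.toSet, f y ∂μ) ^ p * weighted μ w J.toSet
      ≤ apNChar μ p N w * (dualMeasure μ p w Q.toSet
        * ((∫⁻ x in Q.toSet, dualFun p w f x ∂dualMeasure μ p w) / dualMeasure μ p w Q.toSet) ^ p)
      := by
  have hp0 : 0 < p := by linarith
  have h1 := kap_rpow_mul_le hμ hp w h
  have hsymm : kap (vol μ) J Q = kap (vol μ) Q J := by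
    unfold kap
    rcases eq_or_ne J Q with h | h
    · rw [h]
    · rw [if_neg h, if_neg h.symm, mul_comm]
  rw [cb_one_eq hμ, laverage_toSet, setLIntegral_dualFun hw hf, hsymm]
  set k := ENNReal.ofReal (kap (vol μ) Q J)
  set a := ∫⁻ x in Q.toSet, f x ∂μ
  set β := dualMeasure μ p w Q.toSet with hβ
  set A := weighted μ w J.toSet
  have hβ0 : β ≠ 0 := (hw.dual_pos (hμ Q)).ne'
  have hβt : β ≠ ∞ := (dual_lt_top hμ hp hw hB Q).ne
  have hm0 : μ Q.toSet * μ J.toSet ≠ 0 := mul_ne_zero (hμ Q).ne' (hμ J).ne'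
  have hmt : μ Q.toSet * μ J.toSet ≠ ∞ :=
    ENNReal.mul_ne_top (measure_toSet_lt_top μ Q).ne (measure_toSet_lt_top μ J).ne
  have hmp0 : (μ Q.toSet * μ J.toSet) ^ p ≠ 0 :=
    (ENNReal.rpow_pos (pos_iff_ne_zero.2 hm0) hmt).ne'
  have hmpt : (μ Q.toSet * μ J.toSet) ^ p ≠ ∞ := ENNReal.rpow_ne_top_of_nonneg hp0.le hmt
  have e1 : k / μ J.toSet * (a / μ Q.toSet) = k * a / (μ Q.toSet * μ J.toSet) := by
    rw [div_eq_mul_inv, div_eq_mul_inv, div_eq_mul_inv,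
      ENNReal.mul_inv (Or.inl (hμ Q).ne') (Or.inl (measure_toSet_lt_top μ Q).ne)]
    ring
  have e2 : β * (a / β) ^ p * β ^ (p - 1) = a ^ p := by
    have : β * β ^ (p - 1) = β ^ p := by
      conv_lhs => rw [← ENNReal.rpow_one β, ← ENNReal.rpow_mul, ← ENNReal.rpow_add _ _ hβ0 hβt]
      congr 1; ring
    rw [mul_right_comm, this, ← ENNReal.mul_rpow_of_nonneg _ _ hp0.le,
      ENNReal.mul_div_cancel hβ0 hβt]
  rw [e1, ENNReal.div_rpow_of_nonneg _ _ hp0.le, ENNReal.mul_rpow_of_nonneg _ _ hp0.le,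
    ← ENNReal.mul_div_right_comm, ← e2]
  refine ENNReal.div_le_of_le_mul ?_
  calc _ = k ^ p * (A * β ^ (p - 1)) * (β * (a / β) ^ p) := by ring
    _ ≤ apNChar μ p N w * (μ Q.toSet * μ J.toSet) ^ p * (β * (a / β) ^ p) := by gcongr
    _ = _ := by ring

/-- The constant of the weighted maximal estimate. -/
def maxConst (p : ℝ) (N : ℕ) (D : ℝ) : ℝ≥0∞ :=
  (4 * ENNReal.ofReal D) ^ p * (((N + 2 + 1) ^ 2 * 2 ^ (N + 2) : ℕ)
    * (((2 : ℝ≥0∞) ^ p) ^ (1 / (p - 1)) * (embConst p * (2 * (N + 2) : ℕ))))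

theorem maxConst_ne_top (hp : 1 < p) (N : ℕ) (D : ℝ) : maxConst p N D ≠ ∞ := by
  have hp1 : 0 < p - 1 := by linarith
  have h2 : (2 : ℝ≥0∞) ^ p ≠ ∞ := ENNReal.rpow_ne_top_of_nonneg (by linarith) (by norm_num)
  refine ENNReal.mul_ne_top (ENNReal.rpow_ne_top_of_nonneg (by linarith)
    (ENNReal.mul_ne_top (by norm_num) ENNReal.ofReal_ne_top))
    (ENNReal.mul_ne_top (ENNReal.natCast_ne_top _) (ENNReal.mul_ne_top ?_
      (ENNReal.mul_ne_top (embConst_ne_top _) (ENNReal.natCast_ne_top _))))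
  exact ENNReal.rpow_ne_top_of_nonneg (by positivity) h2

/-- After passing to stopping intervals, the supremum is bounded by a sum over `Q` in the sparse
family and `J` near `Q`. There are boundedly many `J` for each `Q`, and the sum over `Q` is the
Carleson embedding for σ. -/
theorem lintegral_maxFin_rpow_le (hμ : ∀ I : Dyadic, 0 < μ I.toSet) (hp : 1 < p)
    (hw : IsWeight μ w) (hB : apChar μ p w ≠ ∞) {f : ℝ → ℝ} (hfm : AEStronglyMeasurable f μ)
    (hf : ∀ I : Dyadic, IntegrableOn f I.toSet μ) (hD1 : 1 ≤ D)
    (hD : ∀ I J, Near (N + 2) I J → hm (vol μ) I ≤ D * hm (vol μ) J) (n : ℕ) (Q₀ : Dyadic) :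
    ∫⁻ x, maxFin μ N n Q₀ f x ^ p ∂weighted μ w
      ≤ maxConst p N D * (apChar μ p w ^ (1 / (p - 1)) * apNChar μ p N w)
        * ∫⁻ x in Q₀.toSet, ‖f x‖ₑ ^ p ∂weighted μ w := by
  classical
  have hp0 : 0 < p := by linarith
  have hp1 : 0 < p - 1 := by linarith
  have hV0 : ∀ I : Dyadic, 0 < vol μ I := real_pos hμ
  set F₁ : Dyadic → ℝ := fun I => ∫ x in I.toSet, |f x| ∂μ
  have hF₁ : Additive F₁ := additive_setIntegral fun I => (hf I).abs
  have hF0 : ∀ I, 0 ≤ F₁ I := fun I => integral_nonneg fun x => abs_nonneg _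
  have hav : ∀ I : Dyadic, ⨍⁻ y in I.toSet, ‖f y‖ₑ ∂μ = ENNReal.ofReal (avg (vol μ) F₁ I) :=
    fun I => by rw [laverage_toSet, ofReal_avg_setIntegral_abs hμ hf]
  set st := stopRule (vol μ) F₁ F₁
  set S := sparseFam st Q₀ N n with hSdef
  have hS := isSparse_sparseFam (Q₀ := Q₀) hμ hF₁ hF0 hF₁ hF0 N n
  have hle4 : ∀ I, Sub I Q₀ → ⨍⁻ y in I.toSet, ‖f y‖ₑ ∂μ
      ≤ 4 * ⨍⁻ y in (stp st Q₀ I).toSet, ‖f y‖ₑ ∂μ := by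
    intro I hI
    rw [hav, hav, ← ENNReal.ofReal_ofNat, ← ENNReal.ofReal_mul (by norm_num)]
    exact ENNReal.ofReal_le_ofReal (avg_le_of_stopRule hV0 hF0 I hI)
  have hmemS : ∀ I ∈ tree n Q₀, stp st Q₀ I ∈ S := by
    intro I hI
    rw [mem_tree_iff] at hI
    refine Finset.mem_filter.2 ⟨mem_tree_iff.2 ⟨stp_sub hI.1, ?_⟩, ?_⟩
    · have := (sub_stp (st := st) hI.1).scale_le
      push_cast; omega
    · rw [stp_stp hI.1]; omega
  have hpt : ∀ x, maxFin μ N n Q₀ f x ^ p ≤ ∑ Q ∈ S, ∑ J ∈ nbhd (N + 2) Q,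
      J.toSet.indicator (fun _ => (4 * ENNReal.ofReal D) ^ p
        * (cb μ 1 Q J * ⨍⁻ y in Q.toSet, ‖f y‖ₑ ∂μ) ^ p) x := by
    intro x
    rw [← ENNReal.le_rpow_inv_iff hp0]
    refine maxFin_le fun I J hI hJ hn hx => ?_
    rw [ENNReal.le_rpow_inv_iff hp0]
    have hI' := (mem_tree_iff.1 hI).1
    obtain ⟨J', h1, h2, h3⟩ := cb_mul_laverage_le hμ hD1 hD (sub_stp (st := st) hI') hn hx
      (hle4 I hI')
    refine (ENNReal.rpow_le_rpow h3 hp0.le).trans ?_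
    rw [ENNReal.mul_rpow_of_nonneg _ _ hp0.le]
    refine le_trans (le_trans ?_ (Finset.single_le_sum (f := fun J => J.toSet.indicator
      (fun _ => (4 * ENNReal.ofReal D) ^ p
        * (cb μ 1 (stp st Q₀ I) J * ⨍⁻ y in (stp st Q₀ I).toSet, ‖f y‖ₑ ∂μ) ^ p) x)
      (fun _ _ => zero_le) (mem_nbhd.2 h1)))
      (Finset.single_le_sum (f := fun Q => ∑ J ∈ nbhd (N + 2) Q, J.toSet.indicator
      (fun _ => (4 * ENNReal.ofReal D) ^ p
        * (cb μ 1 Q J * ⨍⁻ y in Q.toSet, ‖f y‖ₑ ∂μ) ^ p) x)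
      (fun _ _ => zero_le) (hmemS I hI))
    simp only [indicator_of_mem h2, le_refl]
  refine (lintegral_mono hpt).trans ?_
  have hmeas : ∀ (Q J : Dyadic), Measurable fun x => J.toSet.indicator
      (fun _ => (4 * ENNReal.ofReal D) ^ p
        * (cb μ 1 Q J * ⨍⁻ y in Q.toSet, ‖f y‖ₑ ∂μ) ^ p) x :=
    fun Q J => measurable_const.indicator J.measurableSet_toSet
  rw [lintegral_finsetSum _ fun Q _ => Finset.measurable_sum _ fun J _ => hmeas Q J]
  have hsumdual := hS.sum_dual_le hμ hp hw hB (Finset.filter_subset _ _) hp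
    (g := dualFun p w fun x => ‖f x‖ₑ) ((aemeasurable_dualFun hw hfm.enorm).mono_ac
      (withDensity_absolutelyContinuous _ _))
  rw [setLIntegral_dualFun_rpow hp hw hfm.enorm] at hsumdual
  calc _ ≤ ∑ Q ∈ S, (4 * ENNReal.ofReal D) ^ p * (((N + 2 + 1) ^ 2 * 2 ^ (N + 2) : ℕ)
        * (apNChar μ p N w * (dualMeasure μ p w Q.toSet
        * ((∫⁻ x in Q.toSet, dualFun p w (fun x => ‖f x‖ₑ) x ∂dualMeasure μ p w)
          / dualMeasure μ p w Q.toSet) ^ p))) := by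
        refine Finset.sum_le_sum fun Q _ => ?_
        rw [lintegral_finsetSum _ fun J _ => hmeas Q J]
        refine (Finset.sum_le_card_nsmul _ _ ((4 * ENNReal.ofReal D) ^ p *
          (apNChar μ p N w * (dualMeasure μ p w Q.toSet
        * ((∫⁻ x in Q.toSet, dualFun p w (fun x => ‖f x‖ₑ) x ∂dualMeasure μ p w)
          / dualMeasure μ p w Q.toSet) ^ p))) fun J hJ => ?_).trans ?_
        · rw [lintegral_indicator_const J.measurableSet_toSet, mul_assoc]
          exact mul_le_mul_right (cb_rpow_mul_le hμ hp hw hB hfm.enorm (mem_nbhd.1 hJ)) _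
        · rw [nsmul_eq_mul, mul_left_comm]
          refine mul_le_mul_right (mul_le_mul_left ?_ _) _
          exact_mod_cast card_nbhd_le (N + 2) Q
    _ = (4 * ENNReal.ofReal D) ^ p * (((N + 2 + 1) ^ 2 * 2 ^ (N + 2) : ℕ)
        * (apNChar μ p N w * ∑ Q ∈ S, dualMeasure μ p w Q.toSet
        * ((∫⁻ x in Q.toSet, dualFun p w (fun x => ‖f x‖ₑ) x ∂dualMeasure μ p w)
          / dualMeasure μ p w Q.toSet) ^ p)) := by
        simp only [Finset.mul_sum]
    _ ≤ _ := mul_le_mul_right (mul_le_mul_right (mul_le_mul_right hsumdual _) _) _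
    _ = _ := by
      rw [maxConst, ENNReal.mul_rpow_of_nonneg _ _ (by positivity : (0:ℝ) ≤ 1 / (p - 1))]
      ring

/-- The function is only assumed measurable. Hölder with respect to σ gives local integrability,
since a finite [w]_{A_p} makes σ finite on dyadic intervals. -/
theorem integrableOn_of_lintegral_rpow_lt_top (hμ : ∀ I : Dyadic, 0 < μ I.toSet) (hp : 1 < p)
    (hw : IsWeight μ w) (hB : apChar μ p w ≠ ∞) {f : ℝ → ℝ} (hfm : AEStronglyMeasurable f μ)
    (hf : ∫⁻ x, ‖f x‖ₑ ^ p ∂weighted μ w ≠ ∞) (I : Dyadic) : IntegrableOn f I.toSet μ := by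
  have hp0 : 0 < p := by linarith
  refine ⟨hfm.restrict, ?_⟩
  have hconj : p.HolderConjugate (p / (p - 1)) := Real.HolderConjugate.conjExponent hp
  have hq0 : 0 < p / (p - 1) := hconj.symm.pos
  have hφ := aemeasurable_dualFun (p := p) hw hfm.enorm
  rw [hasFiniteIntegral_iff_enorm, ← setLIntegral_dualFun (p := p) hw hfm.enorm]
  have h1 := ENNReal.lintegral_mul_le_Lp_mul_Lq ((dualMeasure μ p w).restrict I.toSet) hconj
    ((hφ.mono_ac (withDensity_absolutelyContinuous _ _)).restrict) (aemeasurable_const (b := 1))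
  simp only [Pi.mul_def, mul_one, ENNReal.one_rpow, lintegral_const, one_mul,
    Measure.restrict_apply_univ] at h1
  refine h1.trans_lt (ENNReal.mul_lt_top (ENNReal.rpow_lt_top_of_nonneg (by positivity) ?_)
    (ENNReal.rpow_lt_top_of_nonneg (by positivity) (dual_lt_top hμ hp hw hB I).ne))
  rw [setLIntegral_dualFun_rpow hp hw hfm.enorm]
  exact ne_top_of_le_ne_top hf (setLIntegral_le_lintegral _ _)

end

/-! ### A₁ weights and the weak type estimate for the maximal function. -/

/-- `‖w⁻¹‖_{L^∞(J)}`. -/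
def supInv (μ : Measure ℝ) (w : ℝ → ℝ) (J : Dyadic) : ℝ≥0∞ :=
  eLpNorm (fun x => (w x)⁻¹) ∞ (μ.restrict J.toSet)

section

variable {μ : Measure ℝ} {w : ℝ → ℝ} {N : ℕ}

/-- Almost everywhere on `J` one has 1 ≤ ‖w⁻¹‖_{L^∞(J)} w. -/
theorem setLIntegral_le_supInv (hw : IsWeight μ w) {g : ℝ → ℝ≥0∞} (hg : AEMeasurable g μ)
    {J : Dyadic} {E : Set ℝ} (hE : MeasurableSet E) (hEJ : E ⊆ J.toSet) :
    ∫⁻ x in E, g x ∂μ ≤ supInv μ w J * ∫⁻ x in E, g x ∂weighted μ w := by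
  have h1 : ∀ᵐ x ∂μ.restrict E, 1 ≤ supInv μ w J * ENNReal.ofReal (w x) := by
    have h2 : ∀ᵐ x ∂μ.restrict E, ‖(w x)⁻¹‖ₑ ≤ supInv μ w J := by
      refine ae_mono (Measure.restrict_mono hEJ le_rfl) ?_
      rw [supInv, eLpNorm_exponent_top]
      exact enorm_ae_le_eLpNormEssSup _ _
    filter_upwards [h2, ae_restrict_of_ae hw.pos] with x hx hx0
    have h3 : ‖(w x)⁻¹‖ₑ * ENNReal.ofReal (w x) = 1 := by
      rw [← Real.enorm_eq_ofReal hx0.le, ← enorm_mul, inv_mul_cancel₀ hx0.ne', enorm_one]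
    rw [← h3]
    gcongr
  have h4 : ∫⁻ x in E, g x ∂weighted μ w = ∫⁻ x in E, g x * ENNReal.ofReal (w x) ∂μ := by
    rw [weighted, restrict_withDensity hE, lintegral_withDensity_eq_lintegral_mul₀
      hw.aemeasurable.restrict hg.restrict]
    simp only [Pi.mul_apply, mul_comm]
  rw [h4, ← lintegral_const_mul'' _ (by exact hg.restrict.mul hw.aemeasurable.restrict)]
  refine lintegral_mono_ae ?_
  filter_upwards [h1] with x hx
  calc g x = g x * 1 := (mul_one _).symm
    _ ≤ g x * (supInv μ w J * ENNReal.ofReal (w x)) := by gcongr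
    _ = _ := by ring

theorem measure_le_supInv (hw : IsWeight μ w) {J : Dyadic} {E : Set ℝ} (hE : MeasurableSet E)
    (hEJ : E ⊆ J.toSet) : μ E ≤ supInv μ w J * weighted μ w E := by
  simpa using setLIntegral_le_supInv hw (aemeasurable_const (b := 1)) hE hEJ

theorem laverage_weight (I : Dyadic) :
    ⨍⁻ x in I.toSet, ENNReal.ofReal (w x) ∂μ = weighted μ w I.toSet / μ I.toSet := by
  rw [laverage_toSet, weighted, withDensity_apply _ I.measurableSet_toSet]

theorem cb_mul_supInv_le {K J : Dyadic} (h : Near (N + 2) K J) :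
    cb μ 1 K J * (weighted μ w K.toSet / μ K.toSet) * supInv μ w J ≤ a1NChar μ N w := by
  rw [← laverage_weight]
  exact le_iSup_of_le K (le_iSup_of_le J (le_iSup_of_le (dist_le_iff.2 h) le_rfl))

/-- The `A₁` condition, tested on a nonnegative function. -/
theorem cb_mul_setLIntegral_le (hw : IsWeight μ w) {g : ℝ → ℝ≥0∞} (hg : AEMeasurable g μ)
    {K J : Dyadic} (h : Near (N + 2) K J) :
    cb μ 1 K J * (weighted μ w K.toSet / μ K.toSet) * ∫⁻ x in J.toSet, g x ∂μ
      ≤ a1NChar μ N w * ∫⁻ x in J.toSet, g x ∂weighted μ w := by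
  refine (mul_le_mul_right (setLIntegral_le_supInv hw hg J.measurableSet_toSet subset_rfl) _).trans
    ?_
  rw [← mul_assoc]
  exact mul_le_mul_left (cb_mul_supInv_le h) _

theorem cb_self (p : ℝ) (I : Dyadic) : cb μ p I I = 1 := by simp [cb]

theorem supInv_ne_zero (hμ : ∀ I : Dyadic, 0 < μ I.toSet) (hw : IsWeight μ w) (J : Dyadic) :
    supInv μ w J ≠ 0 := by
  intro h
  have := measure_le_supInv hw J.measurableSet_toSet subset_rfl (J := J)
  rw [h, zero_mul] at this
  exact (hμ J).ne' (le_antisymm this zero_le)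

theorem supInv_ne_top [IsLocallyFiniteMeasure μ] (hμ : ∀ I : Dyadic, 0 < μ I.toSet) (hw : IsWeight μ w)
    (hA : a1NChar μ N w ≠ ∞) (J : Dyadic) : supInv μ w J ≠ ∞ := by
  intro h
  have h1 := cb_mul_supInv_le (w := w) (μ := μ) (Near.refl (N + 2) J)
  rw [h, cb_self, one_mul, ENNReal.mul_top] at h1
  · exact hA (top_le_iff.1 h1)
  · exact ENNReal.div_ne_zero.2 ⟨(hw.weighted_pos (hμ J)).ne', (measure_toSet_lt_top μ J).ne⟩

theorem one_le_a1NChar [IsLocallyFiniteMeasure μ] (hμ : ∀ I : Dyadic, 0 < μ I.toSet) (hw : IsWeight μ w) :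
    1 ≤ a1NChar μ N w := by
  set J : Dyadic := ⟨0, 0⟩
  have h1 := cb_mul_setLIntegral_le hw (aemeasurable_const (b := 1)) (Near.refl (N + 2) J)
  simp only [lintegral_const, one_mul, Measure.restrict_apply_univ, cb_self] at h1
  rw [ENNReal.div_mul_cancel (hμ J).ne' (measure_toSet_lt_top μ J).ne] at h1
  have h2 := (hw.weighted_pos (hμ J)).ne'
  have h3 := (hw.weighted_lt_top J).ne
  rw [← ENNReal.mul_le_mul_iff_left h2 h3, one_mul]
  exact h1

/-- The diagonal pairs of A_1^N suffice, as the mean of w⁻¹ is at most its supremum. Thus A₂ sparse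
estimates are available in the endpoint argument. -/
theorem apChar_two_le (hw : IsWeight μ w) :
    apChar μ 2 w ≤ a1NChar μ N w := by
  refine iSup_le fun J => ?_
  have h0 := hw.aemeasurable.pow_const (-1 : ℝ)
  have h1 := setLIntegral_le_supInv hw h0 J.measurableSet_toSet (subset_refl J.toSet)
  rw [apProduct, show (2 : ℝ) - 1 = 1 by norm_num, ENNReal.rpow_one, laverage_weight,
    laverage_toSet, show (1 : ℝ) - 2 / 1 = -1 by norm_num]
  have h2 : ∫⁻ x in J.toSet, ENNReal.ofReal (w x) ^ (-1 : ℝ) ∂weighted μ w ≤ μ J.toSet := by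
    rw [setLIntegral_weighted hw h0, ← setLIntegral_one]
    refine lintegral_mono fun x => ?_
    rw [ENNReal.rpow_neg_one]
    exact ENNReal.inv_mul_le_one _
  refine (mul_le_mul_right (ENNReal.div_le_of_le_mul (h1.trans (mul_le_mul_right h2 _))) _).trans ?_
  have h3 := cb_mul_supInv_le (w := w) (μ := μ) (Near.refl (N + 2) J)
  rwa [cb_self, one_mul] at h3

/-- The set where the dyadic maximal function over a finite tree exceeds `r`. -/
def levelSet (μ : Measure ℝ) (f : ℝ → ℝ≥0∞) (r : ℝ≥0∞) (T : Finset Dyadic) : Set ℝ :=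
  ⋃ J ∈ T, ⋃ _ : r < (∫⁻ y in J.toSet, f y ∂μ) / μ J.toSet, J.toSet

theorem mem_levelSet {f : ℝ → ℝ≥0∞} {r : ℝ≥0∞} {T : Finset Dyadic} {x : ℝ} :
    x ∈ levelSet μ f r T ↔
      ∃ J ∈ T, r < (∫⁻ y in J.toSet, f y ∂μ) / μ J.toSet ∧ x ∈ J.toSet := by
  simp only [levelSet, mem_iUnion, exists_prop]

theorem measurableSet_levelSet {f : ℝ → ℝ≥0∞} {r : ℝ≥0∞} {T : Finset Dyadic} :
    MeasurableSet (levelSet μ f r T) :=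
  Finset.measurableSet_biUnion _ fun J _ => MeasurableSet.iUnion fun _ => J.measurableSet_toSet

/-- Descending from the root, the first intervals with average > r are disjoint and cover the level
set; on each of them the A₁ condition bounds r w(R) by the weighted integral of f. -/
theorem mul_measure_levelSet_le (hw : IsWeight μ w)
    {f : ℝ → ℝ≥0∞} (hf : AEMeasurable f μ) (r : ℝ≥0∞) (n : ℕ) (R : Dyadic) :
    r * weighted μ w (levelSet μ f r (tree n R))
      ≤ a1NChar μ N w * ∫⁻ x in R.toSet, f x ∂weighted μ w := by
  induction n generalizing R with
  | zero => simp [levelSet, tree]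
  | succ n ih =>
    by_cases hR : r < (∫⁻ y in R.toSet, f y ∂μ) / μ R.toSet
    · have hsub : levelSet μ f r (tree (n + 1) R) ⊆ R.toSet := by
        intro x hx
        obtain ⟨J, hJ, -, hxJ⟩ := mem_levelSet.1 hx
        exact (mem_tree_iff.1 hJ).1.subset hxJ
      have h1 := cb_mul_setLIntegral_le hw hf (Near.refl (N + 2) R)
      rw [cb_self, one_mul] at h1
      refine le_trans ?_ h1
      calc r * weighted μ w (levelSet μ f r (tree (n + 1) R))
          ≤ (∫⁻ y in R.toSet, f y ∂μ) / μ R.toSet * weighted μ w R.toSet :=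
            mul_le_mul' hR.le (measure_mono hsub)
        _ = _ := by simp only [div_eq_mul_inv]; ring
    · have hsub : levelSet μ f r (tree (n + 1) R)
          ⊆ levelSet μ f r (tree n R.left) ∪ levelSet μ f r (tree n R.right) := by
        intro x hx
        obtain ⟨J, hJ, h2, hxJ⟩ := mem_levelSet.1 hx
        rw [tree, Finset.mem_insert, Finset.mem_union] at hJ
        rcases hJ with rfl | hJ | hJ
        · exact absurd h2 hR
        · exact Or.inl (mem_levelSet.2 ⟨J, hJ, h2, hxJ⟩)
        · exact Or.inr (mem_levelSet.2 ⟨J, hJ, h2, hxJ⟩)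
      calc _ ≤ r * (weighted μ w (levelSet μ f r (tree n R.left))
            + weighted μ w (levelSet μ f r (tree n R.right))) := by
            gcongr
            exact (measure_mono hsub).trans (measure_union_le _ _)
        _ ≤ _ := by
            rw [mul_add, setLIntegral_toSet _ _ R, mul_add]
            exact add_le_add (ih _) (ih _)

/-- `I` lies in no selected interval of average `> r` inside `Q₀`. -/
def lowMask (μ : Measure ℝ) (f : ℝ → ℝ≥0∞) (r : ℝ≥0∞) (Q₀ I : Dyadic) : Prop :=
  ∀ A, Sub I A → Sub A Q₀ → (∫⁻ y in A.toSet, f y ∂μ) / μ A.toSet ≤ r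

theorem lowMask.of_sub {f : ℝ → ℝ≥0∞} {r : ℝ≥0∞} {Q₀ I A : Dyadic}
    (h : lowMask μ f r Q₀ I) (hA : Sub I A) : lowMask μ f r Q₀ A :=
  fun B hB hBQ => h B (hA.trans hB) hBQ

theorem additive_toReal_setLIntegral {ν : Measure ℝ} {f : ℝ → ℝ≥0∞}
    (hf : ∫⁻ x, f x ∂ν ≠ ∞) : Additive fun I => (∫⁻ x in I.toSet, f x ∂ν).toReal := by
  intro I
  have h : ∀ J : Dyadic, ∫⁻ x in J.toSet, f x ∂ν ≠ ∞ := fun J =>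
    ne_top_of_le_ne_top hf (setLIntegral_le_lintegral _ _)
  change (∫⁻ x in I.toSet, f x ∂ν).toReal = _
  rw [setLIntegral_toSet, ENNReal.toReal_add (h _) (h _)]

open Classical in
/-- The intervals within `d` generations below the maximal selected ones have overlap at most
`d`. -/
theorem sum_lowMask_le {ν : Measure ℝ} {f g : ℝ → ℝ≥0∞} (hg : ∫⁻ x, g x ∂ν ≠ ∞) (r : ℝ≥0∞)
    (Q₀ : Dyadic) (d n : ℕ) :
    ∑ I ∈ tree n Q₀ with ¬ lowMask μ f r Q₀ I ∧ lowMask μ f r Q₀ (ancestor d I),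
        ∫⁻ x in I.toSet, g x ∂ν ≤ d * ∫⁻ x in Q₀.toSet, g x ∂ν := by
  have h : ∀ J : Dyadic, ∫⁻ x in J.toSet, g x ∂ν ≠ ∞ := fun J =>
    ne_top_of_le_ne_top hg (setLIntegral_le_lintegral _ _)
  have h1 := (additive_toReal_setLIntegral hg).sum_filter_le (fun _ => ENNReal.toReal_nonneg)
    (P := fun I => ¬ lowMask μ f r Q₀ I ∧ lowMask μ f r Q₀ (ancestor d I)) (d := d) ?_ n Q₀
  · rw [← ENNReal.toReal_sum fun J _ => h J] at h1
    rw [← ENNReal.toReal_le_toReal (ENNReal.sum_ne_top.2 fun J _ => h J)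
      (ENNReal.mul_ne_top (ENNReal.natCast_ne_top _) (h _)), ENNReal.toReal_mul,
      ENNReal.toReal_natCast]
    convert h1
  · rintro I ⟨-, hI⟩ i hi ⟨h2, -⟩
    obtain ⟨k, rfl⟩ := Nat.exists_eq_add_of_le' hi
    rw [ancestor_add] at h2
    exact h2 (hI.of_sub (sub_ancestor _ _))

/-- Outside a level set of the ordinary dyadic maximal function, a large term (I, J) can only have
`I` inside a selected interval while its ancestor N + 2 generations up, which contains `J`, is not.
Such `I` have overlap at most N + 2, and each pair is handled by A_1^N. -/
theorem mul_measure_maxFin_gt_le [IsLocallyFiniteMeasure μ] {D : ℝ} (hμ : ∀ I : Dyadic, 0 < μ I.toSet) (hw : IsWeight μ w)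
    {f : ℝ → ℝ} (hfm : AEStronglyMeasurable f μ)
    (hf : ∫⁻ x, ‖f x‖ₑ ∂weighted μ w ≠ ∞) (hD1 : 1 ≤ D)
    (hD : ∀ I J, Near (N + 2) I J → hm (vol μ) I ≤ D * hm (vol μ) J) (n : ℕ) (Q₀ : Dyadic)
    (r : ℝ≥0∞) :
    r * weighted μ w {x | r < maxFin μ N n Q₀ f x}
      ≤ (ENNReal.ofReal D + ((N + 2 + 1) ^ 2 * 2 ^ (N + 2) : ℕ) * (N + 2 : ℕ)) * a1NChar μ N w
        * ∫⁻ x in Q₀.toSet, ‖f x‖ₑ ∂weighted μ w := by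
  classical
  have hD0 : ENNReal.ofReal D ≠ 0 := (ENNReal.ofReal_pos.2 (by linarith)).ne'
  have hDt : ENNReal.ofReal D ≠ ∞ := ENNReal.ofReal_ne_top
  -- Coefficients are at most D, so a term exceeding r forces an average exceeding r/D over `I`.
  set r' := r / ENNReal.ofReal D with hr'
  set g : ℝ → ℝ≥0∞ := fun x => ‖f x‖ₑ with hg
  set P : Dyadic → Prop := fun I => ¬ lowMask μ g r' Q₀ I ∧ lowMask μ g r' Q₀ (ancestor (N + 2) I)
  set B : Set ℝ := ⋃ I ∈ (tree n Q₀).filter P, ⋃ J ∈ (nbhd (N + 2) I).filter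
    (fun J => r < cb μ 1 I J * ⨍⁻ y in I.toSet, g y ∂μ), J.toSet with hB
  have hsub : {x | r < maxFin μ N n Q₀ f x} ⊆ levelSet μ g r' (tree n Q₀) ∪ B := by
    intro x hx
    by_contra hcon
    rw [mem_union, not_or] at hcon
    refine absurd (maxFin_le fun I J hI hJ hIJ hxJ => ?_) (not_le.2 hx)
    by_contra! hlt
    have hlow : r' < (∫⁻ y in I.toSet, g y ∂μ) / μ I.toSet := by
      rw [← laverage_toSet]
      refine ENNReal.div_lt_of_lt_mul' (hlt.trans_le ?_)
      exact mul_le_mul_left (cb_one_le hD1 hμ hD hIJ) _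
    have hI' := mem_tree_iff.1 hI
    refine hcon.2 ?_
    simp only [hB, mem_iUnion, Finset.mem_filter]
    refine ⟨I, ⟨hI, fun h => (not_lt.2 (h I (Sub.refl I) hI'.1)) hlow, ?_⟩, J,
      ⟨mem_nbhd.2 hIJ, hlt⟩, hxJ⟩
    intro A hA hAQ
    by_contra! hAr
    refine hcon.1 (mem_levelSet.2 ⟨A, mem_tree_iff.2 ⟨hAQ, ?_⟩, hAr, ?_⟩)
    · have := ((sub_ancestor (N + 2) I).trans hA).scale_le
      omega
    · obtain ⟨a, b, hab, he⟩ := hIJ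
      have h1 : Sub J (ancestor a I) := he ▸ sub_ancestor b J
      have h2 : Sub (ancestor a I) (ancestor (N + 2) I) := by
        rw [show N + 2 = (N + 2 - a) + a by omega, ancestor_add]
        exact sub_ancestor _ _
      exact ((h1.trans h2).trans hA).subset hxJ
  have hBle : r * weighted μ w B ≤ ((N + 2 + 1) ^ 2 * 2 ^ (N + 2) : ℕ) * ((N + 2 : ℕ)
      * (a1NChar μ N w * ∫⁻ x in Q₀.toSet, g x ∂weighted μ w)) := by
    -- By symmetry of `kap`, exchanging `I` and `J` turns c^b_1(I, J) ⟨g⟩_I w(J) into the quantity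
    -- tested in `cb_mul_setLIntegral_le`.
    have hJ : ∀ I, ∀ J ∈ (nbhd (N + 2) I).filter
        (fun J => r < cb μ 1 I J * ⨍⁻ y in I.toSet, g y ∂μ),
        r * weighted μ w J.toSet ≤ a1NChar μ N w * ∫⁻ x in I.toSet, g x ∂weighted μ w := by
      intro I J hJ
      rw [Finset.mem_filter, mem_nbhd] at hJ
      refine le_trans ?_ (cb_mul_setLIntegral_le hw hfm.enorm hJ.1.symm)
      refine (mul_le_mul_left hJ.2.le _).trans (le_of_eq ?_)
      have hs : kap (vol μ) J I = kap (vol μ) I J := by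
        unfold kap
        rcases eq_or_ne J I with h | h
        · rw [h]
        · rw [if_neg h, if_neg h.symm, mul_comm]
      rw [cb_one_eq hμ, cb_one_eq hμ, laverage_toSet, hs]
      simp only [div_eq_mul_inv]
      ring
    calc r * weighted μ w B
        ≤ r * ∑ I ∈ (tree n Q₀).filter P, ∑ J ∈ (nbhd (N + 2) I).filter
          (fun J => r < cb μ 1 I J * ⨍⁻ y in I.toSet, g y ∂μ), weighted μ w J.toSet := by
          gcongr
          refine (measure_biUnion_finset_le _ _).trans (Finset.sum_le_sum fun I _ => ?_)
          exact measure_biUnion_finset_le _ _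
      _ ≤ ∑ I ∈ (tree n Q₀).filter P, ((N + 2 + 1) ^ 2 * 2 ^ (N + 2) : ℕ)
          * (a1NChar μ N w * ∫⁻ x in I.toSet, g x ∂weighted μ w) := by
          rw [Finset.mul_sum]
          refine Finset.sum_le_sum fun I _ => ?_
          rw [Finset.mul_sum]
          refine (Finset.sum_le_card_nsmul _ _ _ (hJ I)).trans ?_
          rw [nsmul_eq_mul]
          gcongr
          exact (Finset.card_filter_le _ _).trans (card_nbhd_le _ _)
      _ = ((N + 2 + 1) ^ 2 * 2 ^ (N + 2) : ℕ) * (a1NChar μ N w * ∑ I ∈ (tree n Q₀).filter P,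
          ∫⁻ x in I.toSet, g x ∂weighted μ w) := by
          simp only [Finset.mul_sum]
      _ ≤ ((N + 2 + 1) ^ 2 * 2 ^ (N + 2) : ℕ) * (a1NChar μ N w * ((N + 2 : ℕ) *
          ∫⁻ x in Q₀.toSet, g x ∂weighted μ w)) := by
          gcongr
          exact sum_lowMask_le hf r' Q₀ (N + 2) n
      _ = _ := by ring
  have hlev : r * weighted μ w (levelSet μ g r' (tree n Q₀))
      ≤ ENNReal.ofReal D * (a1NChar μ N w * ∫⁻ x in Q₀.toSet, g x ∂weighted μ w) := by
    have h1 := mul_measure_levelSet_le (N := N) hw hfm.enorm r' n Q₀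
    calc _ = ENNReal.ofReal D * (r' * weighted μ w (levelSet μ g r' (tree n Q₀))) := by
          rw [← mul_assoc, hr', ENNReal.mul_div_cancel hD0 hDt]
      _ ≤ _ := mul_le_mul_right h1 _
  calc _ ≤ r * (weighted μ w (levelSet μ g r' (tree n Q₀)) + weighted μ w B) := by
        gcongr
        exact (measure_mono hsub).trans (measure_union_le _ _)
    _ ≤ _ := by
        rw [mul_add]
        refine (add_le_add hlev hBle).trans (le_of_eq ?_)
        ring

end

/-! ### The L² estimate of the good part at height r. -/

/-- Layer cake inequality; already the range t ∈ (x/2, x), where 4t ≥ 2x, contributes x². -/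
theorem sq_le_lintegral_Ioc {x r : ℝ≥0∞} (hx : x ≤ r) (hr : r ≠ ∞) :
    x ^ (2 : ℝ) ≤ ∫⁻ t in Ioc 0 r.toReal, (if ENNReal.ofReal t < x then 4 * ENNReal.ofReal t else 0)
      := by
  have hxt : x ≠ ∞ := ne_top_of_le_ne_top hr hx
  set y := x.toReal with hy
  have hy0 : 0 ≤ y := ENNReal.toReal_nonneg
  have hxy : ENNReal.ofReal y = x := ENNReal.ofReal_toReal hxt
  have hyr : y ≤ r.toReal := ENNReal.toReal_mono hr hx
  have hsub : Ioo (y / 2) y ⊆ Ioc 0 r.toReal := fun t ht =>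
    ⟨lt_of_le_of_lt (by positivity) ht.1, ht.2.le.trans hyr⟩
  calc x ^ (2 : ℝ) = ENNReal.ofReal (2 * y) * volume (Ioo (y / 2) y) := by
        rw [Real.volume_Ioo, ← ENNReal.ofReal_mul (by positivity), ← hxy,
          ENNReal.ofReal_rpow_of_nonneg hy0 (by norm_num), Real.rpow_two]
        congr 1; ring
    _ = ∫⁻ _ in Ioo (y / 2) y, ENNReal.ofReal (2 * y) := (setLIntegral_const _ _).symm
    _ ≤ ∫⁻ t in Ioo (y / 2) y, (if ENNReal.ofReal t < x then 4 * ENNReal.ofReal t else 0) := by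
        refine setLIntegral_mono' measurableSet_Ioo fun t ht => ?_
        have ht0 : 0 ≤ t := le_trans (by positivity) ht.1.le
        rw [if_pos]
        · rw [← ENNReal.ofReal_ofNat, ← ENNReal.ofReal_mul (by norm_num)]
          refine ENNReal.ofReal_le_ofReal ?_
          have := ht.1
          linarith
        · rw [← hxy]
          exact (ENNReal.ofReal_lt_ofReal_iff_of_nonneg ht0).2 ht.2
    _ ≤ _ := lintegral_mono_set hsub

/-- Absorption: the factor √Z on the right is cancelled, and the result is squared. -/
theorem le_of_le_mul_sqrt_mul_sqrt {Z c a b : ℝ≥0∞} (hZ : Z ≠ ∞)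
    (h : Z ≤ c * (a ^ (1 / 2 : ℝ) * (b * Z) ^ (1 / 2 : ℝ))) : Z ≤ c ^ 2 * (a * b) := by
  rcases eq_or_ne Z 0 with h0 | h0
  · rw [h0]; exact zero_le
  have hne : Z ^ (1 / 2 : ℝ) ≠ 0 := (ENNReal.rpow_pos (pos_iff_ne_zero.2 h0) hZ).ne'
  have hnt : Z ^ (1 / 2 : ℝ) ≠ ∞ := ENNReal.rpow_ne_top_of_ne_zero h0 hZ
  have hsq : ∀ x : ℝ≥0∞, x ^ (1 / 2 : ℝ) * x ^ (1 / 2 : ℝ) = x := fun x => by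
    rw [← ENNReal.rpow_add_of_nonneg _ _ (by norm_num) (by norm_num)]
    norm_num
  have h1 : Z ^ (1 / 2 : ℝ) ≤ c * (a ^ (1 / 2 : ℝ) * b ^ (1 / 2 : ℝ)) := by
    rw [← ENNReal.mul_le_mul_iff_left hne hnt, hsq]
    refine h.trans (le_of_eq ?_)
    rw [ENNReal.mul_rpow_of_nonneg _ _ (by norm_num)]
    ring
  calc Z = Z ^ (1 / 2 : ℝ) * Z ^ (1 / 2 : ℝ) := (hsq Z).symm
    _ ≤ _ := mul_le_mul' h1 h1
    _ = c ^ 2 * ((a ^ (1 / 2 : ℝ) * a ^ (1 / 2 : ℝ)) * (b ^ (1 / 2 : ℝ) * b ^ (1 / 2 : ℝ))) := by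
      ring
    _ = _ := by rw [hsq, hsq]

section

variable {μ : Measure ℝ} {w : ℝ → ℝ} {N : ℕ}

open Classical in
/-- Carleson embedding for truncated averages, at the endpoint `p = 1`. -/
theorem sum_weighted_mul_sq_le (hw : IsWeight μ w)
    {f : ℝ → ℝ≥0∞} (hf : AEMeasurable f μ) {S : Finset Dyadic} {E : Dyadic → Set ℝ} {L : ℕ}
    (hS : IsSparse μ S E L) {Q₀ : Dyadic} {n : ℕ} (hSn : S ⊆ tree n Q₀) {r : ℝ≥0∞} (hr : r ≠ ∞)
    {x : Dyadic → ℝ≥0∞} (hxr : ∀ J ∈ S, x J ≤ r)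
    (hx : ∀ J, x J ≤ (∫⁻ y in J.toSet, f y ∂μ) / μ J.toSet) :
    ∑ J ∈ S, weighted μ w (E J) * x J ^ (2 : ℝ)
      ≤ 4 * L * (a1NChar μ N w * ∫⁻ y in Q₀.toSet, f y ∂weighted μ w) * r := by
  have hmeas : ∀ J, Measurable fun t : ℝ =>
      if ENNReal.ofReal t < x J then 4 * ENNReal.ofReal t else 0 := fun J =>
    Measurable.ite (measurableSet_lt ENNReal.measurable_ofReal measurable_const)
      (ENNReal.measurable_ofReal.const_mul _) measurable_const
  calc _ ≤ ∑ J ∈ S, weighted μ w (E J) * ∫⁻ t in Ioc 0 r.toReal,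
        (if ENNReal.ofReal t < x J then 4 * ENNReal.ofReal t else 0) :=
        Finset.sum_le_sum fun J hJ => mul_le_mul_right (sq_le_lintegral_Ioc (hxr J hJ) hr) _
    _ = ∫⁻ t in Ioc 0 r.toReal, ∑ J ∈ S, weighted μ w (E J) *
        (if ENNReal.ofReal t < x J then 4 * ENNReal.ofReal t else 0) := by
        rw [lintegral_finsetSum _ fun J _ => (hmeas J).const_mul _]
        exact Finset.sum_congr rfl fun J _ => (lintegral_const_mul _ (hmeas J)).symm
    _ ≤ ∫⁻ _ in Ioc 0 r.toReal, 4 * L * (a1NChar μ N w * ∫⁻ y in Q₀.toSet, f y ∂weighted μ w) := by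
        -- The intervals with x(J) > t lie in the level set at height t. The 1/t decay of its weight
        -- cancels the factor t, and the integral over (0, r] yields r.
        refine lintegral_mono fun t => ?_
        have h1 := hS.sum_measure_le (weighted μ w) (S' := S.filter fun J => ENNReal.ofReal t < x J)
          (measurableSet_levelSet (μ := μ) (f := f) (r := ENNReal.ofReal t) (T := tree n Q₀))
          (Finset.filter_subset _ _) (fun J hJ y hy => by
            rw [Finset.mem_filter] at hJ
            exact mem_levelSet.2 ⟨J, hSn hJ.1, hJ.2.trans_le (hx J), hy⟩)
        calc _ = 4 * ENNReal.ofReal t * ∑ J ∈ S with ENNReal.ofReal t < x J,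
              weighted μ w (E J) := by
              rw [Finset.sum_filter, Finset.mul_sum]
              refine Finset.sum_congr rfl fun J _ => ?_
              split_ifs <;> ring
          _ ≤ 4 * ENNReal.ofReal t * (L * weighted μ w
              (levelSet μ f (ENNReal.ofReal t) (tree n Q₀))) := mul_le_mul_right h1 _
          _ = 4 * L * (ENNReal.ofReal t * weighted μ w
              (levelSet μ f (ENNReal.ofReal t) (tree n Q₀))) := by ring
          _ ≤ _ := mul_le_mul_right (mul_measure_levelSet_le hw hf _ _ _) _
    _ = _ := by
        rw [setLIntegral_const, Real.volume_Ioc, sub_zero, ENNReal.ofReal_toReal hr]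

variable [IsLocallyFiniteMeasure μ] {s t n : ℕ} {α : Dyadic → Dyadic → Dyadic → ℝ} {Q₀ : Dyadic}
  {c : Dyadic → ℝ} {D : ℝ}

/-- The constant of the `L²` estimate of the good part. -/
def goodConst (N : ℕ) (D : ℝ) : ℝ≥0∞ :=
  (ENNReal.ofReal (domConst N D) * ((N + 2 + 1) ^ 2 * 2 ^ (N + 2) : ℕ)) ^ 2
    * (8 * (2 * (N + 2) : ℕ) * (ENNReal.ofReal D * (4 * (embConst 2 * (2 * (N + 2) : ℕ)))))

theorem goodConst_ne_top (N : ℕ) (D : ℝ) : goodConst N D ≠ ∞ := by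
  refine ENNReal.mul_ne_top (ENNReal.pow_ne_top (ENNReal.mul_ne_top ENNReal.ofReal_ne_top
    (ENNReal.natCast_ne_top _))) (ENNReal.mul_ne_top (ENNReal.mul_ne_top (by norm_num)
    (ENNReal.natCast_ne_top _)) (ENNReal.mul_ne_top ENNReal.ofReal_ne_top (ENNReal.mul_ne_top
    (by norm_num) (ENNReal.mul_ne_top (embConst_ne_top _) (ENNReal.natCast_ne_top _)))))

/-- The good part of the Calderón–Zygmund decomposition of a finite Haar shift at height `r`. -/
theorem lintegral_stepFun_sq_le (hμ : ∀ I : Dyadic, 0 < μ I.toSet)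
    (hw : IsWeight μ w) (hA : a1NChar μ N w ≠ ∞) (hα : ∀ I J K, |α I J K| ≤ 1) {f : ℝ → ℝ}
    (hfm : AEStronglyMeasurable f μ) (hf : ∀ I : Dyadic, IntegrableOn f I.toSet μ) (hD1 : 1 ≤ D)
    (hD : ∀ I J, Near (N + 2) I J → hm (vol μ) I ≤ D * hm (vol μ) J) (hst : s + t ≤ N)
    {r : ℝ≥0∞} (hr : r ≠ ∞)
    (hc : ∀ J, |c J| ≤ √(hm (vol μ) J) * |mavg (vol μ) (fun I => ∫ x in I.toSet, f x ∂μ)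
        (lowMask μ (fun x => ‖f x‖ₑ) r Q₀) J.left
      - mavg (vol μ) (fun I => ∫ x in I.toSet, f x ∂μ)
        (lowMask μ (fun x => ‖f x‖ₑ) r Q₀) J.right|) :
    ∫⁻ x, ‖stepFun μ s t α (tree n Q₀) c x‖ₑ ^ (2 : ℝ) ∂weighted μ w
      ≤ goodConst N D * a1NChar μ N w ^ 3 * (∫⁻ y in Q₀.toSet, ‖f y‖ₑ ∂weighted μ w) * r := by
  classical
  set W := lowMask μ (fun x => ‖f x‖ₑ) r Q₀ with hW
  set u : ℝ → ℝ := stepFun μ s t α (tree n Q₀) c with hu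
  set A := a1NChar μ N w with hAdef
  set ν := weighted μ w with hν
  have hZt : ∫⁻ x, ‖u x‖ₑ ^ (2 : ℝ) ∂ν < ∞ := lintegral_stepFun_rpow_lt_top hw (by norm_num)
  set Z := ∫⁻ x, ‖u x‖ₑ ^ (2 : ℝ) ∂ν with hZ
  obtain ⟨S, E, hS, hSn, hle⟩ := exists_sparse_lintegral_stepFun_le (n := n) (Q₀ := Q₀) (c := c)
    hμ (p := 2) (by norm_num) hw hα hf (W := W)
    (fun I hI => hI.of_sub (sub_parent I)) (by linarith) hD hst hc
  rw [show (2 : ℝ) - 1 = 1 by norm_num] at hle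
  simp only [ENNReal.rpow_one] at hle
  set x : Dyadic → ℝ≥0∞ := fun J =>
    if W J then (∫⁻ y in J.toSet, ‖f y‖ₑ ∂μ) / μ J.toSet else 0 with hx
  set b : Dyadic → ℝ≥0∞ := fun K => (∫⁻ y in K.toSet, ‖u y‖ₑ ∂ν) / ν K.toSet with hb
  set X : Dyadic → ℝ≥0∞ := fun J => (A * (μ J.toSet / supInv μ w J)) ^ (1 / 2 : ℝ) * x J
  set Y : Dyadic → ℝ≥0∞ := fun K => (ENNReal.ofReal D * ν K.toSet) ^ (1 / 2 : ℝ) * b K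
  have hsq : ∀ x : ℝ≥0∞, x ^ (1 / 2 : ℝ) * x ^ (1 / 2 : ℝ) = x := fun x => by
    rw [← ENNReal.rpow_add_of_nonneg _ _ (by norm_num) (by norm_num)]
    norm_num
  have hterm : ∀ J K, Near (N + 2) J K → ENNReal.ofReal (kap (vol μ) J K) * x J
      * ((∫⁻ y in K.toSet, ‖u y‖ₑ ∂ν) / μ K.toSet) ≤ X J * Y K := by
    intro J K hJK
    -- Two bounds for v: the A_1^N condition gives one in terms of `J` alone, `kap ≤ D μ(K)` one in
    -- terms of `K` alone. Their geometric mean splits the pair into X and Y.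
    set v := ENNReal.ofReal (kap (vol μ) J K) * (ν K.toSet / μ K.toSet) with hv
    have hK0 : ν K.toSet ≠ 0 := (hw.weighted_pos (hμ K)).ne'
    have hKt : ν K.toSet ≠ ∞ := (hw.weighted_lt_top K).ne
    have e1 : (∫⁻ y in K.toSet, ‖u y‖ₑ ∂ν) / μ K.toSet = b K * (ν K.toSet / μ K.toSet) := by
      rw [hb, ← mul_div_assoc, ENNReal.div_mul_cancel hK0 hKt]
    have hv1 : v ≤ A * (μ J.toSet / supInv μ w J) := by
      have h1 := cb_mul_supInv_le (μ := μ) (w := w) hJK.symm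
      rw [← mul_div_assoc, ENNReal.le_div_iff_mul_le (Or.inl (supInv_ne_zero hμ hw J))
        (Or.inl (supInv_ne_top hμ hw hA J)), hv, ← cb_one_mul hμ]
      calc _ = cb μ 1 K J * (ν K.toSet / μ K.toSet) * supInv μ w J * μ J.toSet := by ring
        _ ≤ _ := mul_le_mul_left h1 _
    have hv2 : v ≤ ENNReal.ofReal D * ν K.toSet := by
      have hs : kap (vol μ) J K = kap (vol μ) K J := by
        unfold kap
        rcases eq_or_ne J K with h | h
        · rw [h]
        · rw [if_neg h, if_neg h.symm, mul_comm]
      have h1 := ENNReal.ofReal_le_ofReal (kap_le_mul_vol hD1 hμ hD hJK)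
      rw [ENNReal.ofReal_mul (by linarith), ofReal_vol, ← hs] at h1
      calc v ≤ ENNReal.ofReal D * μ K.toSet * (ν K.toSet / μ K.toSet) := mul_le_mul_left h1 _
        _ = _ := by rw [mul_assoc, ENNReal.mul_div_cancel (hμ K).ne' (measure_toSet_lt_top μ K).ne]
    have hv3 : v ≤ (A * (μ J.toSet / supInv μ w J)) ^ (1 / 2 : ℝ)
        * (ENNReal.ofReal D * ν K.toSet) ^ (1 / 2 : ℝ) := by
      rw [← hsq v]
      exact mul_le_mul' (ENNReal.rpow_le_rpow hv1 (by norm_num))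
        (ENNReal.rpow_le_rpow hv2 (by norm_num))
    rw [e1]
    calc _ = v * (x J * b K) := by rw [hv]; ring
      _ ≤ _ := mul_le_mul_left hv3 _
      _ = _ := by ring
  have hXs : ∑ J ∈ S, X J ^ (2 : ℝ)
      ≤ 8 * (2 * (N + 2) : ℕ) * (A ^ 2 * (∫⁻ y in Q₀.toSet, ‖f y‖ₑ ∂ν) * r) := by
    have h1 : ∀ J ∈ S, X J ^ (2 : ℝ) ≤ 2 * A * (ν (E J) * x J ^ (2 : ℝ)) := by
      intro J hJ
      -- Sparseness for μ followed by the A₁ comparison on `E J`; no further power of A is spent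
      -- here.
      have h2 : μ J.toSet / supInv μ w J ≤ 2 * ν (E J) := by
        refine ENNReal.div_le_of_le_mul ((hS.le J hJ).trans ?_)
        rw [mul_assoc, mul_comm (ν (E J))]
        exact mul_le_mul_right (measure_le_supInv hw (hS.measurableSet J) (hS.subset J)) _
      calc X J ^ (2 : ℝ) = A * (μ J.toSet / supInv μ w J) * x J ^ (2 : ℝ) := by
            rw [ENNReal.mul_rpow_of_nonneg _ _ (by norm_num), ← ENNReal.rpow_mul]
            norm_num
        _ ≤ A * (2 * ν (E J)) * x J ^ (2 : ℝ) := by gcongr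
        _ = _ := by ring
    refine (Finset.sum_le_sum h1).trans ?_
    rw [← Finset.mul_sum]
    refine (mul_le_mul_right (sum_weighted_mul_sq_le (N := N) hw hfm.enorm hS hSn hr (x := x)
      ?_ ?_) _).trans (le_of_eq ?_)
    · intro J hJ
      simp only [hx]
      split_ifs with h
      · exact h J (Sub.refl J) (mem_tree_iff.1 (hSn hJ)).1
      · exact zero_le
    · intro J
      simp only [hx]
      split_ifs with h
      · exact le_rfl
      · exact zero_le
    · ring
  have hapA : apChar μ 2 w ≤ A := apChar_two_le hw
  have hYs : ∑ K ∈ S, Y K ^ (2 : ℝ)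
      ≤ ENNReal.ofReal D * (4 * (embConst 2 * (2 * (N + 2) : ℕ))) * A * Z := by
    have h1 : ∀ K, Y K ^ (2 : ℝ) = ENNReal.ofReal D * (ν K.toSet * b K ^ (2 : ℝ)) := by
      intro K
      rw [ENNReal.mul_rpow_of_nonneg _ _ (by norm_num), ← ENNReal.rpow_mul]
      norm_num
      ring
    simp only [h1]
    rw [← Finset.mul_sum]
    have h2 := hS.sum_weighted_le hμ (p := 2) (by norm_num) hw (ne_top_of_le_ne_top hA hapA) hSn
      (q := 2) (by norm_num) (g := fun y => ‖u y‖ₑ) measurable_stepFun.enorm.aemeasurable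
    refine (mul_le_mul_right h2 _).trans ?_
    calc _ ≤ ENNReal.ofReal D * (2 ^ (2 : ℝ) * A * (embConst 2 * (2 * (N + 2) : ℕ) * Z)) := by
          gcongr
          exact setLIntegral_le_lintegral _ _
      _ = _ := by
          rw [show (2 : ℝ≥0∞) ^ (2 : ℝ) = 4 by rw [ENNReal.rpow_two]; norm_num]; ring
  have hmain : Z ≤ ENNReal.ofReal (domConst N D) * ((N + 2 + 1) ^ 2 * 2 ^ (N + 2) : ℕ)
      * ((8 * (2 * (N + 2) : ℕ) * (A ^ 2 * (∫⁻ y in Q₀.toSet, ‖f y‖ₑ ∂ν) * r)) ^ (1 / 2 : ℝ)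
        * (ENNReal.ofReal D * (4 * (embConst 2 * (2 * (N + 2) : ℕ))) * A * Z) ^ (1 / 2 : ℝ)) := by
    refine hle.trans ?_
    rw [mul_assoc]
    refine mul_le_mul_right ?_ _
    refine (Finset.sum_le_sum fun J _ => Finset.sum_le_sum fun K hK =>
      hterm J K (Finset.mem_filter.1 hK).2).trans ?_
    refine (sum_near_le (p := 2) (q := 2) (Real.HolderConjugate.two_two) (N + 2) S X Y).trans ?_
    gcongr
  refine (le_of_le_mul_sqrt_mul_sqrt hZt.ne hmain).trans (le_of_eq ?_)
  rw [goodConst]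
  ring

end

/-! ### The bad part and the weak type estimate for finite Haar shifts. -/

section

variable {μ : Measure ℝ} {w : ℝ → ℝ} {N s t n : ℕ} {α : Dyadic → Dyadic → Dyadic → ℝ}
  {Q₀ : Dyadic} {T : Finset Dyadic} {c c₁ c₂ : Dyadic → ℝ} {D : ℝ} {r : ℝ≥0∞} {f : ℝ → ℝ}

theorem stepFun_add (h : ∀ J, c J = c₁ J + c₂ J) (x : ℝ) :
    stepFun μ s t α T c x = stepFun μ s t α T c₁ x + stepFun μ s t α T c₂ x := by
  simp only [stepFun, ← Finset.sum_add_distrib]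
  refine Finset.sum_congr rfl fun I _ => Finset.sum_congr rfl fun J _ =>
    Finset.sum_congr rfl fun K _ => ?_
  rw [h]; ring

open Classical in
/-- The contribution of an interval `J'` that was cut off by the mask. -/
def cutTerm (μ : Measure ℝ) (f : ℝ → ℝ) (r : ℝ≥0∞) (Q₀ I J' : Dyadic) : ℝ≥0∞ :=
  if lowMask μ (fun x => ‖f x‖ₑ) r Q₀ I ∧ ¬ lowMask μ (fun x => ‖f x‖ₑ) r Q₀ J' then
    ENNReal.ofReal √(hm (vol μ) J'.parent) * ((∫⁻ y in J'.toSet, ‖f y‖ₑ ∂μ) / μ J'.toSet) else 0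

/-- The absolute value of one half of a Haar function. -/
def halfHaar (μ : Measure ℝ) (K' : Dyadic) (x : ℝ) : ℝ≥0∞ :=
  K'.toSet.indicator (fun _ => ENNReal.ofReal √(hm (vol μ) K'.parent) / μ K'.toSet) x

/-- A majorant of the bad part of a finite Haar shift. -/
def badMajorant (μ : Measure ℝ) (f : ℝ → ℝ) (r : ℝ≥0∞) (Q₀ : Dyadic) (s t n : ℕ) (x : ℝ) :
    ℝ≥0∞ :=
  ∑ I ∈ tree n Q₀, ∑ J' ∈ descendants (s + 1) I, ∑ K' ∈ descendants (t + 1) I,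
    cutTerm μ f r Q₀ I J' * halfHaar μ K' x

theorem measurable_halfHaar (K' : Dyadic) : Measurable (halfHaar μ K') :=
  measurable_const.indicator K'.measurableSet_toSet

variable [IsLocallyFiniteMeasure μ]

theorem enorm_haar_le (hμ : ∀ I : Dyadic, 0 < μ I.toSet) (K : Dyadic) (x : ℝ) :
    ‖haar μ K x‖ₑ ≤ halfHaar μ K.left x + halfHaar μ K.right x := by
  have h : ∀ K' : Dyadic, K'.parent = K → ENNReal.ofReal √(m μ K)
      * ‖K'.toSet.indicator (1 : ℝ → ℝ) x / μ.real K'.toSet‖ₑ = halfHaar μ K' x := by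
    rintro K' rfl
    have hv : 0 < vol μ K' := real_pos hμ K'
    by_cases hx : x ∈ K'.toSet
    · rw [halfHaar, indicator_of_mem hx, indicator_of_mem hx, Pi.one_apply,
        Real.enorm_eq_ofReal (div_nonneg zero_le_one measureReal_nonneg),
        show μ.real K'.toSet = vol μ K' from rfl, ENNReal.ofReal_div_of_pos hv, ofReal_vol, ENNReal.ofReal_one, mul_one_div]
      rfl
    · rw [halfHaar, indicator_of_notMem hx, indicator_of_notMem hx]
      simp
  rw [haar, enorm_mul, Real.enorm_eq_ofReal (Real.sqrt_nonneg _), ← h _ (parent_left K),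
    ← h _ (parent_right K), ← mul_add]
  exact mul_le_mul_right enorm_sub_le _

theorem enorm_mavg_le (hμ : ∀ I : Dyadic, 0 < μ I.toSet)
    (hf : ∀ I : Dyadic, IntegrableOn f I.toSet μ) (W : Dyadic → Prop) (J : Dyadic) (hW : W J) :
    ‖mavg (vol μ) (fun I => ∫ x in I.toSet, f x ∂μ) W J‖ₑ
      ≤ (∫⁻ y in J.toSet, ‖f y‖ₑ ∂μ) / μ J.toSet := by
  rw [mavg, if_pos hW, ← ofReal_avg_setIntegral_abs hμ hf, Real.enorm_eq_ofReal_abs]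
  exact ENNReal.ofReal_le_ofReal
    (abs_avg_le (real_pos hμ) (fun I => abs_integral_le_integral_abs) J)

/-- A point outside the level set lies in no selected interval, so an `I` contributing there is
unselected. The cut-off intervals below it are then at most s + 1 generations inside the maximal
selected ones. Cancellation is discarded. -/
theorem enorm_stepFun_le_badMajorant (hμ : ∀ I : Dyadic, 0 < μ I.toSet)
    (hα : ∀ I J K, |α I J K| ≤ 1) (hf : ∀ I : Dyadic, IntegrableOn f I.toSet μ)
    (hc : ∀ J, c J = √(hm (vol μ) J) * (mavg (vol μ) (fun I => ∫ x in I.toSet, f x ∂μ)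
        (fun J => ¬ lowMask μ (fun x => ‖f x‖ₑ) r Q₀ J) J.left
      - mavg (vol μ) (fun I => ∫ x in I.toSet, f x ∂μ)
        (fun J => ¬ lowMask μ (fun x => ‖f x‖ₑ) r Q₀ J) J.right)) {x : ℝ}
    (hx : x ∉ levelSet μ (fun x => ‖f x‖ₑ) r (tree n Q₀)) :
    ‖stepFun μ s t α (tree n Q₀) c x‖ₑ ≤ badMajorant μ f r Q₀ s t n x := by
  classical
  unfold stepFun badMajorant
  refine (enorm_sum_le _ _).trans (Finset.sum_le_sum fun I hI => ?_)
  rw [sum_descendants_succ']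
  refine (enorm_sum_le _ _).trans (Finset.sum_le_sum fun J _ => ?_)
  rw [sum_descendants_succ', sum_descendants_succ', ← Finset.sum_add_distrib]
  refine (enorm_sum_le _ _).trans (Finset.sum_le_sum fun K hK => ?_)
  by_cases hxK : x ∈ K.toSet
  swap
  · rw [haar_eq_zero μ hxK]; simp
  have hI' := mem_tree_iff.1 hI
  have hWI : lowMask μ (fun x => ‖f x‖ₑ) r Q₀ I := by
    intro A hA hAQ
    by_contra! hAr
    refine hx (mem_levelSet.2 ⟨A, mem_tree_iff.2 ⟨hAQ, ?_⟩, hAr, ?_⟩)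
    · have := hA.scale_le
      omega
    · rw [mem_descendants] at hK
      exact (Sub.trans ⟨t, hK⟩ hA).subset hxK
  have hcut : ∀ J' : Dyadic, J'.parent = J → ENNReal.ofReal √(hm (vol μ) J)
      * ‖mavg (vol μ) (fun I => ∫ x in I.toSet, f x ∂μ)
        (fun J => ¬ lowMask μ (fun x => ‖f x‖ₑ) r Q₀ J) J'‖ₑ ≤ cutTerm μ f r Q₀ I J' := by
    rintro J' rfl
    by_cases hW : lowMask μ (fun x => ‖f x‖ₑ) r Q₀ J'
    · simp [mavg, hW]
    · rw [cutTerm, if_pos ⟨hWI, hW⟩]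
      exact mul_le_mul_right (enorm_mavg_le hμ hf (fun J => ¬ lowMask μ (fun x => ‖f x‖ₑ) r Q₀ J)
        J' hW) _
  have hcJ : ‖c J‖ₑ ≤ cutTerm μ f r Q₀ I J.left + cutTerm μ f r Q₀ I J.right := by
    rw [hc, enorm_mul, Real.enorm_eq_ofReal (Real.sqrt_nonneg _)]
    refine (mul_le_mul_right enorm_sub_le _).trans ?_
    rw [mul_add]
    exact add_le_add (hcut _ (parent_left J)) (hcut _ (parent_right J))
  have hα1 : ‖α I J K‖ₑ ≤ 1 := by
    rw [Real.enorm_eq_ofReal_abs]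
    exact ENNReal.ofReal_le_one.2 (hα I J K)
  rw [enorm_mul, enorm_mul]
  calc ‖α I J K‖ₑ * ‖c J‖ₑ * ‖haar μ K x‖ₑ
      ≤ 1 * (cutTerm μ f r Q₀ I J.left + cutTerm μ f r Q₀ I J.right)
        * (halfHaar μ K.left x + halfHaar μ K.right x) := by
        gcongr
        exact enorm_haar_le hμ K x
    _ = _ := by ring

/-- Off the diagonal balance moves `hm` from parent to child; on it, the value at the parent is at
most the measure of either child. -/
theorem sqrt_hm_parent_mul_le (hμ : ∀ I : Dyadic, 0 < μ I.toSet) (hD1 : 1 ≤ D)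
    (hD : ∀ I J, Near (N + 2) I J → hm (vol μ) I ≤ D * hm (vol μ) J) (J' K' : Dyadic) :
    √(hm (vol μ) J'.parent) * √(hm (vol μ) K'.parent) ≤ D * kap (vol μ) J' K' := by
  have hV0 : ∀ I : Dyadic, 0 < vol μ I := real_pos hμ
  rw [kap]
  split_ifs with h
  · subst h
    rw [Real.mul_self_sqrt (hm_nonneg hV0 _)]
    have h1 : hm (vol μ) J'.parent ≤ vol μ J' := by
      rcases eq_left_or_right J' with h | h
      · conv_rhs => rw [h]
        exact hm_le_left additive_vol hV0 _
      · conv_rhs => rw [h]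
        exact hm_le_right additive_vol hV0 _
    nlinarith [hV0 J']
  · have h1 : ∀ J : Dyadic, √(hm (vol μ) J.parent) ≤ √D * √(hm (vol μ) J) := by
      intro J
      rw [← Real.sqrt_mul (by linarith)]
      exact Real.sqrt_le_sqrt (hD _ _ ⟨0, 1, by omega, rfl⟩)
    calc _ ≤ (√D * √(hm (vol μ) J')) * (√D * √(hm (vol μ) K')) :=
          mul_le_mul (h1 _) (h1 _) (Real.sqrt_nonneg _) (by positivity)
      _ = (√D * √D) * (√(hm (vol μ) J') * √(hm (vol μ) K')) := by ring
      _ = _ := by rw [Real.mul_self_sqrt (by linarith)]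

/-- The pair (K', J') is near, so A_1^N converts each term into D A ∫_{J'} |f| w. For fixed `J'`
there are at most 2 ^ (N + 1) intervals `K'`, and the `J'` overlap at most s + 1 times. -/
theorem lintegral_badMajorant_le (hμ : ∀ I : Dyadic, 0 < μ I.toSet) (hw : IsWeight μ w)
    (hfm : AEStronglyMeasurable f μ) (hfw : ∫⁻ x, ‖f x‖ₑ ∂weighted μ w ≠ ∞) (hD1 : 1 ≤ D)
    (hD : ∀ I J, Near (N + 2) I J → hm (vol μ) I ≤ D * hm (vol μ) J) (hst : s + t ≤ N) :
    ∫⁻ x, badMajorant μ f r Q₀ s t n x ∂weighted μ w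
      ≤ 2 ^ (N + 1) * (N + 1 : ℕ) * ENNReal.ofReal D * a1NChar μ N w
        * ∫⁻ x in Q₀.toSet, ‖f x‖ₑ ∂weighted μ w := by
  classical
  set ν := weighted μ w
  set A := a1NChar μ N w
  set W := lowMask μ (fun x => ‖f x‖ₑ) r Q₀ with hW
  set φ : Dyadic → ℝ≥0∞ := fun J' => if ¬ W J' ∧ W (ancestor (s + 1) J') then
    ∫⁻ x in J'.toSet, ‖f x‖ₑ ∂ν else 0 with hφ
  have hm : ∀ I J' K', Measurable fun x => cutTerm μ f r Q₀ I J' * halfHaar μ K' x :=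
    fun I J' K' => (measurable_halfHaar K').const_mul _
  have hterm : ∀ I, ∀ J' ∈ descendants (s + 1) I, ∀ K' ∈ descendants (t + 1) I,
      ∫⁻ x, cutTerm μ f r Q₀ I J' * halfHaar μ K' x ∂ν ≤ ENNReal.ofReal D * A * φ J' := by
    intro I J' hJ K' hK
    rw [mem_descendants] at hJ hK
    rw [lintegral_const_mul _ (measurable_halfHaar K')]
    unfold halfHaar
    rw [lintegral_indicator_const K'.measurableSet_toSet]
    simp only [hφ, hJ, cutTerm]
    by_cases hc : W I ∧ ¬ W J'
    · rw [if_pos hc, if_pos ⟨hc.2, hc.1⟩]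
      have hnear : Near (N + 2) K' J' := ⟨t + 1, s + 1, by omega, by rw [hJ, hK]⟩
      have h1 := ENNReal.ofReal_le_ofReal (sqrt_hm_parent_mul_le hμ hD1 hD J' K')
      rw [ENNReal.ofReal_mul (Real.sqrt_nonneg _), ENNReal.ofReal_mul (by linarith),
        ← cb_one_mul hμ] at h1
      calc _ = (ENNReal.ofReal √(HaarShift.hm (vol μ) J'.parent)
            * ENNReal.ofReal √(HaarShift.hm (vol μ) K'.parent))
            * ((∫⁻ y in J'.toSet, ‖f y‖ₑ ∂μ) / μ J'.toSet * (ν K'.toSet / μ K'.toSet)) := by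
            simp only [div_eq_mul_inv]; ring
        _ ≤ (ENNReal.ofReal D * (cb μ 1 K' J' * μ J'.toSet))
            * ((∫⁻ y in J'.toSet, ‖f y‖ₑ ∂μ) / μ J'.toSet * (ν K'.toSet / μ K'.toSet)) :=
            mul_le_mul_left h1 _
        _ = ENNReal.ofReal D * (cb μ 1 K' J' * (ν K'.toSet / μ K'.toSet)
            * (μ J'.toSet * ((∫⁻ y in J'.toSet, ‖f y‖ₑ ∂μ) / μ J'.toSet))) := by ring
        _ ≤ ENNReal.ofReal D * (A * ∫⁻ y in J'.toSet, ‖f y‖ₑ ∂ν) := by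
            rw [ENNReal.mul_div_cancel (hμ J').ne' (measure_toSet_lt_top μ J').ne]
            exact mul_le_mul_right (cb_mul_setLIntegral_le hw hfm.enorm hnear) _
        _ = _ := by ring
    · rw [if_neg hc, zero_mul]; exact zero_le
  unfold badMajorant
  rw [lintegral_finsetSum _ fun I _ => Finset.measurable_sum _ fun J _ =>
    Finset.measurable_sum _ fun K _ => hm I J K]
  have hI : ∀ I ∈ tree n Q₀, ∫⁻ x, ∑ J' ∈ descendants (s + 1) I, ∑ K' ∈ descendants (t + 1) I,
      cutTerm μ f r Q₀ I J' * halfHaar μ K' x ∂ν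
      ≤ 2 ^ (N + 1) * (ENNReal.ofReal D * A) * ∑ J' ∈ descendants (s + 1) I, φ J' := by
    intro I _
    rw [lintegral_finsetSum _ fun J _ => Finset.measurable_sum _ fun K _ => hm I J K,
      Finset.mul_sum]
    refine Finset.sum_le_sum fun J' hJ => ?_
    rw [lintegral_finsetSum _ fun K _ => hm I J' K]
    refine (Finset.sum_le_card_nsmul _ _ _ (hterm I J' hJ)).trans ?_
    rw [card_descendants, nsmul_eq_mul, mul_assoc (2 ^ (N + 1))]
    refine mul_le_mul_left ?_ _
    push_cast
    exact pow_le_pow_right₀ (by norm_num) (by omega)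
  refine (Finset.sum_le_sum hI).trans ?_
  rw [← Finset.mul_sum]
  have h2 := sum_tree_descendants_le n (s + 1) Q₀ (φ := φ) (fun _ => zero_le)
  have h3 : ∑ J ∈ tree (n + (s + 1)) Q₀, φ J
      ≤ (s + 1 : ℕ) * ∫⁻ x in Q₀.toSet, ‖f x‖ₑ ∂ν := by
    rw [hφ, ← Finset.sum_filter]
    exact sum_lowMask_le hfw r Q₀ (s + 1) _
  calc _ ≤ 2 ^ (N + 1) * (ENNReal.ofReal D * A)
        * ((N + 1 : ℕ) * ∫⁻ x in Q₀.toSet, ‖f x‖ₑ ∂ν) := by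
        refine mul_le_mul_right (h2.trans (h3.trans (mul_le_mul_left ?_ _))) _
        exact_mod_cast (by omega : s + 1 ≤ N + 1)
    _ = _ := by ring

/-- The constant of the weak type estimate for finite Haar shifts. -/
def weakConst (N : ℕ) (D : ℝ) : ℝ≥0∞ :=
  1 + 4 * goodConst N D + 2 * (2 ^ (N + 1) * (N + 1 : ℕ) * ENNReal.ofReal D)

theorem weakConst_ne_top (N : ℕ) (D : ℝ) : weakConst N D ≠ ∞ := by
  refine ENNReal.add_ne_top.2 ⟨ENNReal.add_ne_top.2 ⟨by norm_num, ENNReal.mul_ne_top (by norm_num)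
    (goodConst_ne_top N D)⟩, ENNReal.mul_ne_top (by norm_num) (ENNReal.mul_ne_top
    (ENNReal.mul_ne_top (by norm_num) (ENNReal.natCast_ne_top _)) ENNReal.ofReal_ne_top)⟩

/-- Masking the averages splits the coefficients into a part that never sees an average above r and
a remainder. The first is treated by Chebyshev in L²(w); outside the level set the second is treated
by Chebyshev in L¹(w). -/
theorem mul_measure_stepFun_gt_le (hμ : ∀ I : Dyadic, 0 < μ I.toSet)
    (hw : IsWeight μ w) (hA : a1NChar μ N w ≠ ∞) (hα : ∀ I J K, |α I J K| ≤ 1)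
    (hfm : AEStronglyMeasurable f μ) (hf : ∀ I : Dyadic, IntegrableOn f I.toSet μ)
    (hfw : ∫⁻ x, ‖f x‖ₑ ∂weighted μ w ≠ ∞) (hD1 : 1 ≤ D)
    (hD : ∀ I J, Near (N + 2) I J → hm (vol μ) I ≤ D * hm (vol μ) J) (hst : s + t ≤ N)
    (hc : ∀ J, c J = ∫ x, f x * haar μ J x ∂μ) {l : ℝ≥0∞} (hl : l ≠ ∞) :
    l * weighted μ w {x | l < ‖stepFun μ s t α (tree n Q₀) c x‖ₑ}
      ≤ weakConst N D * a1NChar μ N w ^ 2 * ∫⁻ x in Q₀.toSet, ‖f x‖ₑ ∂weighted μ w := by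
  set ν := weighted μ w with hν
  set A := a1NChar μ N w with hAdef
  set Φ := ∫⁻ x in Q₀.toSet, ‖f x‖ₑ ∂ν with hΦ
  have hA1 : 1 ≤ A := one_le_a1NChar hμ hw
  have hA0 : A ≠ 0 := (zero_lt_one.trans_le hA1).ne'
  rcases eq_or_ne l 0 with rfl | hl0
  · simp
  -- This height balances the contributions: the level set gives A/r = A²/l, and the good part A³
  -- r/l² = A²/l, up to constants and the norm of f.
  set r := l / A with hr
  have hrt : r ≠ ∞ := ENNReal.div_ne_top hl hA0
  have hrA : A * r = l := ENNReal.mul_div_cancel hA0 hA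
  set F : Dyadic → ℝ := fun I => ∫ x in I.toSet, f x ∂μ
  set W := lowMask μ (fun x => ‖f x‖ₑ) r Q₀ with hW
  set c₁ : Dyadic → ℝ := fun J => √(hm (vol μ) J) * (mavg (vol μ) F W J.left
    - mavg (vol μ) F W J.right) with hc₁
  set c₂ : Dyadic → ℝ := fun J => √(hm (vol μ) J) * (mavg (vol μ) F (fun J => ¬ W J) J.left
    - mavg (vol μ) F (fun J => ¬ W J) J.right) with hc₂
  have hsum : ∀ J, c J = c₁ J + c₂ J := by
    intro J
    have h1 : ∀ K, avg (vol μ) F K = mavg (vol μ) F W K + mavg (vol μ) F (fun J => ¬ W J) K := by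
      intro K
      by_cases h : W K <;> simp [mavg, h]
    rw [hc, integral_mul_haar hf, hc₁, hc₂, h1, h1]
    ring
  set G := stepFun μ s t α (tree n Q₀) c₁ with hG
  set U := badMajorant μ f r Q₀ s t n with hU
  set Ω := levelSet μ (fun x => ‖f x‖ₑ) r (tree n Q₀) with hΩ
  have hgood := lintegral_stepFun_sq_le (s := s) (t := t) (n := n) (Q₀ := Q₀) (c := c₁) hμ hw hA
    hα hfm hf hD1 hD hst hrt (fun J => by
      rw [hc₁, abs_mul, abs_of_nonneg (Real.sqrt_nonneg _)])
  have hbad := lintegral_badMajorant_le (s := s) (t := t) (n := n) (Q₀ := Q₀) (r := r)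
    hμ hw hfm hfw hD1 hD hst
  have hlev := mul_measure_levelSet_le (N := N) hw hfm.enorm r n Q₀
  have h2 : (2 : ℝ≥0∞) ≠ 0 := by norm_num
  have h2t : (2 : ℝ≥0∞) ≠ ∞ := by norm_num
  have hcover : {x | l < ‖stepFun μ s t α (tree n Q₀) c x‖ₑ}
      ⊆ Ω ∪ ({x | l / 2 ≤ ‖G x‖ₑ} ∪ {x | l / 2 ≤ U x}) := by
    intro x hx
    by_contra hcon
    simp only [mem_union, not_or, mem_ofPred_eq, not_le] at hcon hx
    obtain ⟨h3, h4, h5⟩ := hcon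
    have h6 : ‖stepFun μ s t α (tree n Q₀) c x‖ₑ ≤ ‖G x‖ₑ + U x := by
      rw [stepFun_add hsum]
      exact (enorm_add_le _ _).trans (add_le_add le_rfl
        (enorm_stepFun_le_badMajorant hμ hα hf (fun J => rfl) h3))
    have h7 := ENNReal.add_lt_add h4 h5
    rw [ENNReal.add_halves] at h7
    exact lt_asymm hx (h6.trans_lt h7)
  have e1 : l * ν Ω ≤ A ^ 2 * Φ := by
    calc l * ν Ω = A * (r * ν Ω) := by rw [← mul_assoc, hrA]
      _ ≤ A * (A * Φ) := mul_le_mul_right hlev _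
      _ = _ := by ring
  have e2 : l * ν {x | l / 2 ≤ ‖G x‖ₑ} ≤ 4 * goodConst N D * A ^ 2 * Φ := by
    have hGm : Measurable G := measurable_stepFun
    have h3 := mul_meas_ge_le_lintegral₀ (μ := ν) (hGm.enorm.pow_const (2 : ℝ)).aemeasurable
      ((l / 2) ^ (2 : ℝ))
    have h4 : {x | (l / 2) ^ (2 : ℝ) ≤ ‖G x‖ₑ ^ (2 : ℝ)} = {x | l / 2 ≤ ‖G x‖ₑ} := by
      ext x
      exact ENNReal.rpow_le_rpow_iff (by norm_num)
    rw [h4] at h3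
    have h5 := h3.trans hgood
    rw [← ENNReal.mul_le_mul_iff_right hl0 hl]
    have h6 : l * l = 4 * (l / 2) ^ (2 : ℝ) := by
      rw [ENNReal.rpow_two, div_eq_mul_inv, mul_pow, ← ENNReal.inv_pow, mul_left_comm,
        show (2 : ℝ≥0∞) ^ 2 = 4 by norm_num, ENNReal.mul_inv_cancel (by norm_num) (by norm_num),
        mul_one, sq]
    calc l * (l * ν {x | l / 2 ≤ ‖G x‖ₑ}) = 4 * ((l / 2) ^ (2 : ℝ) * ν {x | l / 2 ≤ ‖G x‖ₑ}) := by
          rw [← mul_assoc, h6, mul_assoc]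
      _ ≤ 4 * (goodConst N D * A ^ 3 * Φ * r) := mul_le_mul_right h5 _
      _ = 4 * goodConst N D * A ^ 2 * Φ * (A * r) := by ring
      _ = _ := by rw [hrA]; ring
  have e3 : l * ν {x | l / 2 ≤ U x} ≤ 2 * (2 ^ (N + 1) * (N + 1 : ℕ) * ENNReal.ofReal D) * A ^ 2
      * Φ := by
    have hUm : Measurable U := by
      rw [hU]
      unfold badMajorant
      exact Finset.measurable_sum _ fun I _ => Finset.measurable_sum _ fun J _ =>
        Finset.measurable_sum _ fun K _ => (measurable_halfHaar K).const_mul _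
    have h3 := (mul_meas_ge_le_lintegral₀ (μ := ν) hUm.aemeasurable (l / 2)).trans hbad
    calc l * ν {x | l / 2 ≤ U x} = 2 * (l / 2 * ν {x | l / 2 ≤ U x}) := by
          rw [← mul_assoc, ENNReal.mul_div_cancel h2 h2t]
      _ ≤ 2 * (2 ^ (N + 1) * (N + 1 : ℕ) * ENNReal.ofReal D * A * Φ) := mul_le_mul_right h3 _
      _ ≤ 2 * (2 ^ (N + 1) * (N + 1 : ℕ) * ENNReal.ofReal D * A ^ 2 * Φ) := by
          gcongr
          exact le_self_pow₀ hA1 (by norm_num)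
      _ = _ := by ring
  calc _ ≤ l * (ν Ω + (ν {x | l / 2 ≤ ‖G x‖ₑ} + ν {x | l / 2 ≤ U x})) := by
        gcongr
        exact (measure_mono hcover).trans ((measure_union_le _ _).trans
          (add_le_add le_rfl (measure_union_le _ _)))
    _ = l * ν Ω + (l * ν {x | l / 2 ≤ ‖G x‖ₑ} + l * ν {x | l / 2 ≤ U x}) := by ring
    _ ≤ _ := add_le_add e1 (add_le_add e2 e3)
    _ = _ := by rw [weakConst]; ring

end

/-! ### Exhaustion of the dyadic system and passage to the limit. -/

namespace Dyadic

/-- The dyadic interval `[0, 2ⁿ)`. -/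
def topR (n : ℕ) : Dyadic := ⟨-n, 0⟩

/-- The dyadic interval `[-2ⁿ, 0)`. -/
def topL (n : ℕ) : Dyadic := ⟨-n, -1⟩

theorem disjoint_tops (n : ℕ) : Disjoint (topL n).toSet (topR n).toSet :=
  disjoint_of_scale_eq rfl (by simp [topL, topR])

theorem disjoint_tree_tops (n k : ℕ) : Disjoint (tree k (topR n)) (tree k (topL n)) := by
  rw [Finset.disjoint_left]
  intro I h1 h2
  exact disjoint_of_sub (A := topR n) (B := topL n) rfl (by simp [topL, topR])
    (mem_tree_iff.1 h1).1 (mem_tree_iff.1 h2).1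

theorem lt_two_pow_of_natAbs_le {a : ℤ} {j : ℕ} (h : a.natAbs ≤ j) : |a| < 2 ^ j := by
  have h1 : a.natAbs < 2 ^ j := h.trans_lt Nat.lt_two_pow_self
  rw [Int.abs_eq_natAbs]
  exact_mod_cast h1

theorem mem_tree_topR {I : Dyadic} (hI : 0 ≤ I.pos) {n : ℕ}
    (hn : I.scale.natAbs + I.pos.natAbs + 1 ≤ n) : I ∈ tree (2 * n) (topR n) := by
  rw [mem_tree]
  refine ⟨(I.scale + n).toNat, by omega, ?_⟩
  rw [ancestor_eq]
  have h1 : ((I.scale + n).toNat : ℤ) = I.scale + n := Int.toNat_of_nonneg (by omega)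
  have h2 := abs_lt.1 (lt_two_pow_of_natAbs_le (a := I.pos) (j := (I.scale + n).toNat) (by omega))
  ext
  · simp only [h1, topR]; ring
  · exact Int.ediv_eq_zero_of_lt hI h2.2

theorem mem_tree_topL {I : Dyadic} (hI : I.pos < 0) {n : ℕ}
    (hn : I.scale.natAbs + I.pos.natAbs + 1 ≤ n) : I ∈ tree (2 * n) (topL n) := by
  rw [mem_tree]
  refine ⟨(I.scale + n).toNat, by omega, ?_⟩
  rw [ancestor_eq]
  have h1 : ((I.scale + n).toNat : ℤ) = I.scale + n := Int.toNat_of_nonneg (by omega)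
  have h2 := abs_lt.1 (lt_two_pow_of_natAbs_le (a := I.pos) (j := (I.scale + n).toNat) (by omega))
  ext
  · simp only [h1, topL]; ring
  · have h3 : (0 : ℤ) < 2 ^ (I.scale + n).toNat := by positivity
    change I.pos / 2 ^ (I.scale + n).toNat = -1
    rw [Int.ediv_eq_iff_of_pos h3]
    constructor <;> linarith [h2.1]

/-- No dyadic interval crosses the origin, so near intervals belong to the same half-line and hence
to the same tree of the exhaustion. -/
theorem Near.pos_nonneg_iff {n : ℕ} {I J : Dyadic} (h : Near n I J) : 0 ≤ I.pos ↔ 0 ≤ J.pos := by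
  obtain ⟨a, b, -, he⟩ := h
  have h1 : ∀ (a : ℕ) (I : Dyadic), 0 ≤ (ancestor a I).pos ↔ 0 ≤ I.pos := fun a I => by
    rw [ancestor_eq]
    exact Int.ediv_nonneg_iff_of_pos (by positivity)
  rw [← h1 a I, he, h1]

/-- A sequence of finite families that exhausts the dyadic intervals. -/
def exhaust (n : ℕ) : Finset Dyadic := tree (2 * n) (topR n) ∪ tree (2 * n) (topL n)

theorem tendsto_exhaust : Filter.Tendsto exhaust Filter.atTop Filter.atTop := by
  rw [Filter.tendsto_atTop]
  intro S
  have h : ∀ᶠ n in Filter.atTop, ∀ I ∈ S, I ∈ exhaust n := by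
    rw [Filter.eventually_all_finset]
    intro I _
    filter_upwards [Filter.eventually_ge_atTop (I.scale.natAbs + I.pos.natAbs + 1)] with n hn
    rcases le_or_gt 0 I.pos with h | h
    · exact Finset.mem_union_left _ (mem_tree_topR h hn)
    · exact Finset.mem_union_right _ (mem_tree_topL h hn)
  exact h

end Dyadic

section limit

variable {ν : Measure ℝ}

/-- `A` lies almost everywhere in an increasing union of tail intersections, and continuity from
below along increasing unions needs no measurability. -/
theorem measure_le_of_eventually_mem {A : Set ℝ} {B : ℕ → Set ℝ} {K : ℝ≥0∞}
    (h : ∀ᵐ x ∂ν, x ∈ A → ∀ᶠ n in Filter.atTop, x ∈ B n) (hB : ∀ n, ν (B n) ≤ K) : ν A ≤ K := by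
  have hmono : Monotone fun m : ℕ => ⋂ n ≥ m, B n := fun a b hab =>
    biInter_subset_biInter_left fun n hn => le_trans hab hn
  have h1 : A ≤ᵐ[ν] ⋃ m : ℕ, ⋂ n ≥ m, B n := by
    filter_upwards [h] with x hx hxA
    obtain ⟨m, hm⟩ := Filter.eventually_atTop.1 (hx hxA)
    exact mem_iUnion.2 ⟨m, mem_iInter₂.2 hm⟩
  refine (measure_mono_ae h1).trans ?_
  rw [hmono.measure_iUnion]
  exact iSup_le fun m => (measure_mono (biInter_subset_of_mem (le_refl m))).trans (hB m)

end limit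

section

variable {μ : Measure ℝ} {w : ℝ → ℝ} {N s t : ℕ} {p : ℝ} {α : Dyadic → Dyadic → Dyadic → ℝ} {D : ℝ}

theorem stepFun_exhaust (n : ℕ) (c : Dyadic → ℝ) (x : ℝ) :
    stepFun μ s t α (exhaust n) c x = stepFun μ s t α (tree (2 * n) (topR n)) c x
      + stepFun μ s t α (tree (2 * n) (topL n)) c x :=
  Finset.sum_union (disjoint_tree_tops n _)

theorem eventually_le_maxFin {I J : Dyadic} (h : Near (N + 2) I J) (f : ℝ → ℝ) (x : ℝ) :
    ∀ᶠ n in Filter.atTop, J.toSet.indicator (fun _ => cb μ 1 I J * ⨍⁻ y in I.toSet, ‖f y‖ₑ ∂μ) x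
      ≤ max (maxFin μ N (2 * n) (topR n) f x) (maxFin μ N (2 * n) (topL n) f x) := by
  filter_upwards [Filter.eventually_ge_atTop (I.scale.natAbs + I.pos.natAbs + 1),
    Filter.eventually_ge_atTop (J.scale.natAbs + J.pos.natAbs + 1)] with n hI hJ
  rcases le_or_gt 0 I.pos with h0 | h0
  · exact (le_maxFin (mem_tree_topR h0 hI) (mem_tree_topR (h.pos_nonneg_iff.1 h0) hJ) h).trans
      (le_max_left _ _)
  · refine (le_maxFin (mem_tree_topL h0 hI) (mem_tree_topL ?_ hJ) h).trans (le_max_right _ _)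
    by_contra! hJ0
    exact not_le.2 h0 (h.pos_nonneg_iff.2 hJ0)

theorem maximal_le {f : ℝ → ℝ} {x : ℝ} {r : ℝ≥0∞} (h : ∀ I J, Near (N + 2) I J →
    J.toSet.indicator (fun _ => cb μ 1 I J * ⨍⁻ y in I.toSet, ‖f y‖ₑ ∂μ) x ≤ r) :
    maximal μ N f x ≤ r :=
  iSup_le fun I => iSup_le fun J => iSup_le fun hIJ => h I J (dist_le_iff.1 hIJ)

variable [IsLocallyFiniteMeasure μ]

theorem integrableOn_Lp_two (f : Lp ℝ 2 μ) (I : Dyadic) : IntegrableOn f I.toSet μ := by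
  have : IsFiniteMeasure (μ.restrict I.toSet) :=
    ⟨by rw [Measure.restrict_apply_univ]; exact measure_toSet_lt_top μ I⟩
  exact ((Lp.memLp f).restrict I.toSet).integrable (by norm_num)

theorem coeFn_sum_haarLp (T : Finset Dyadic) (c : Dyadic → ℝ) :
    ⇑(∑ I ∈ T, ∑ J ∈ I.descendants s, ∑ K ∈ I.descendants t, (α I J K * c J) • haarLp μ K)
      =ᵐ[μ] stepFun μ s t α T c := by
  have hK : ∀ I J K, ⇑((α I J K * c J) • haarLp μ K) =ᵐ[μ]
      fun x => α I J K * c J * haar μ K x := by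
    intro I J K
    filter_upwards [Lp.coeFn_smul (α I J K * c J) (haarLp μ K), (haar_memLp μ K).coeFn_toLp]
      with x h1 h2
    rw [h1, Pi.smul_apply, haarLp, h2, smul_eq_mul]
  have hsum : ∀ (T : Finset Dyadic) (F : Dyadic → Lp ℝ 2 μ) (g : Dyadic → ℝ → ℝ),
      (∀ I, F I =ᵐ[μ] g I) → ⇑(∑ I ∈ T, F I) =ᵐ[μ] fun x => ∑ I ∈ T, g I x := by
    intro T F g h
    have h1 : ∀ᵐ x ∂μ, ∀ I ∈ T, F I x = g I x := (Finset.eventually_all T).2 fun I _ => h I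
    filter_upwards [Lp.coeFn_finsetSum T F, h1] with x h2 h3
    rw [h2, Finset.sum_apply]
    exact Finset.sum_congr rfl h3
  exact hsum _ _ _ fun I => hsum _ _ _ fun J => hsum _ _ _ fun K => hK I J K

/-- Unconditional convergence in L²(μ) gives convergence along the exhaustion, and a subsequence
converges almost everywhere. Almost everywhere statements pass to w dμ, where L² convergence need
not be available. -/
theorem exists_seq_stepFun_tendsto (hμ : ∀ I : Dyadic, 0 < μ I.toSet)
    (hα : ∀ I J K, |α I J K| ≤ 1) (f : Lp ℝ 2 μ) :
    ∃ ns : ℕ → ℕ, ∀ᵐ x ∂μ, Filter.Tendsto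
      (fun k => stepFun μ s t α (exhaust (ns k)) (fun J => ∫ x, f x * haar μ J x ∂μ) x)
      Filter.atTop (nhds (haarShift μ s t α f x)) := by
  have h1 := (hasSum_haarShift hμ s t hα f).comp tendsto_exhaust
  obtain ⟨ns, -, h2⟩ := (tendstoInMeasure_of_tendsto_Lp h1).exists_seq_tendsto_ae
  refine ⟨ns, ?_⟩
  have h3 : ∀ᵐ x ∂μ, ∀ k, _ := ae_all_iff.2 fun k : ℕ =>
    coeFn_sum_haarLp (μ := μ) (s := s) (t := t) (α := α) (exhaust (ns k))
      (fun J => ∫ x, f x * haar μ J x ∂μ)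
  filter_upwards [h2, h3] with x h4 h5
  refine h4.congr fun k => ?_
  rw [← h5 k]
  rfl

theorem eLpNorm_eq (hp : 1 < p) {E : Type*} [ENorm E] (f : ℝ → E) (ν : Measure ℝ) :
    eLpNorm f (ENNReal.ofReal p) ν = (∫⁻ x, ‖f x‖ₑ ^ p ∂ν) ^ (1 / p) := by
  have hp0 : 0 < p := by linarith
  rw [eLpNorm_eq_lintegral_rpow_enorm_toReal (ENNReal.ofReal_pos.2 hp0).ne' ENNReal.ofReal_ne_top,
    ENNReal.toReal_ofReal hp0.le]

theorem eLpNorm_haarShift_le (hμ : ∀ I : Dyadic, 0 < μ I.toSet) (hp : 1 < p)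
    (hw : IsWeight μ w) (hB : apChar μ p w ≠ ∞) (hα : ∀ I J K, |α I J K| ≤ 1) (hD0 : 0 ≤ D)
    (hD : ∀ I J, Near (N + 2) I J → hm (vol μ) I ≤ D * hm (vol μ) J) (hst : s + t ≤ N)
    (f : Lp ℝ 2 μ) :
    eLpNorm (haarShift μ s t α f) (ENNReal.ofReal p) (weighted μ w)
      ≤ 2 * (ENNReal.ofReal (domConst N D) * formConst p N) *
        (apChar μ p w ^ (((p - 1) ^ 2 + 1) / (p * (p - 1))) * apNChar μ p N w ^ (1 / p))
        * eLpNorm f (ENNReal.ofReal p) (weighted μ w) := by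
  have hp0 : 0 < p := by linarith
  set ν := weighted μ w
  have hν : ν ≪ μ := withDensity_absolutelyContinuous _ _
  obtain ⟨ns, hns⟩ := exists_seq_stepFun_tendsto (s := s) (t := t) hμ hα f
  set c : Dyadic → ℝ := fun J => ∫ x, f x * haar μ J x ∂μ with hc
  have hone : ∀ n Q₀, eLpNorm (stepFun μ s t α (tree n Q₀) c) (ENNReal.ofReal p) ν
      ≤ ENNReal.ofReal (domConst N D) * (formConst p N *
        (apChar μ p w ^ (((p - 1) ^ 2 + 1) / (p * (p - 1))) * apNChar μ p N w ^ (1 / p)))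
        * eLpNorm f (ENNReal.ofReal p) ν := by
    intro n Q₀
    rw [eLpNorm_eq hp, eLpNorm_eq hp]
    refine (lintegral_stepFun_rpow_le hμ hp hw hB hα (Lp.aestronglyMeasurable f)
      (integrableOn_Lp_two f) hD0 hD hst (fun J => rfl)).trans ?_
    gcongr
    exact Measure.restrict_le_self
  refine (Lp.eLpNorm_lim_le_liminf_eLpNorm (fun k =>
    (measurable_stepFun (T := exhaust (ns k)) (c := c) (μ := μ) (s := s) (t := t)
      (α := α)).aestronglyMeasurable) _ (hν.ae_le hns)).trans ?_
  refine Filter.liminf_le_of_frequently_le' (Filter.Frequently.of_forall fun k => ?_)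
  have h1 : stepFun μ s t α (exhaust (ns k)) c
      = stepFun μ s t α (tree (2 * ns k) (topR (ns k))) c
        + stepFun μ s t α (tree (2 * ns k) (topL (ns k))) c :=
    funext fun x => stepFun_exhaust _ _ _
  rw [h1]
  refine (eLpNorm_add_le measurable_stepFun.aestronglyMeasurable
    measurable_stepFun.aestronglyMeasurable (by
      rw [← ENNReal.ofReal_one]; exact ENNReal.ofReal_le_ofReal hp.le)).trans ?_
  refine (add_le_add (hone _ _) (hone _ _)).trans (le_of_eq ?_)
  ring

theorem weakL1Norm_haarShift_le (hμ : ∀ I : Dyadic, 0 < μ I.toSet)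
    (hw : IsWeight μ w) (hA : a1NChar μ N w ≠ ∞) (hα : ∀ I J K, |α I J K| ≤ 1) (hD1 : 1 ≤ D)
    (hD : ∀ I J, Near (N + 2) I J → hm (vol μ) I ≤ D * hm (vol μ) J) (hst : s + t ≤ N)
    (f : Lp ℝ 2 μ) (hf : eLpNorm f 1 (weighted μ w) ≠ ∞) :
    weakL1Norm (haarShift μ s t α f) (weighted μ w)
      ≤ 2 * weakConst N D * a1NChar μ N w ^ 2 * eLpNorm f 1 (weighted μ w) := by
  set ν := weighted μ w
  have hν : ν ≪ μ := withDensity_absolutelyContinuous _ _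
  obtain ⟨ns, hns⟩ := exists_seq_stepFun_tendsto (s := s) (t := t) hμ hα f
  set c : Dyadic → ℝ := fun J => ∫ x, f x * haar μ J x ∂μ with hc
  rw [eLpNorm_one_eq_lintegral_enorm] at hf ⊢
  refine iSup_le fun l => ?_
  rcases eq_or_ne (l : ℝ≥0∞) 0 with h0 | h0
  · rw [h0]; simp
  have hone : ∀ n Q₀, ν {x | (l : ℝ≥0∞) < ‖stepFun μ s t α (tree n Q₀) c x‖ₑ}
      ≤ weakConst N D * a1NChar μ N w ^ 2 * (∫⁻ x, ‖f x‖ₑ ∂ν) / l := by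
    intro n Q₀
    rw [ENNReal.le_div_iff_mul_le (Or.inl h0) (Or.inl ENNReal.coe_ne_top), mul_comm]
    refine (mul_measure_stepFun_gt_le hμ hw hA hα (Lp.aestronglyMeasurable f)
      (integrableOn_Lp_two f) hf hD1 hD hst (fun J => rfl) ENNReal.coe_ne_top).trans ?_
    gcongr
    exact Measure.restrict_le_self
  have hmain : ν {x | (l : ℝ≥0∞) < ‖haarShift μ s t α f x‖ₑ}
      ≤ 2 * (weakConst N D * a1NChar μ N w ^ 2 * (∫⁻ x, ‖f x‖ₑ ∂ν) / l) := by
    refine measure_le_of_eventually_mem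
      (B := fun k => {x | (l : ℝ≥0∞) < ‖stepFun μ s t α (exhaust (ns k)) c x‖ₑ}) ?_ fun k => ?_
    · filter_upwards [hν.ae_le hns] with x hx hxl
      exact (continuous_enorm.tendsto _ |>.comp hx).eventually_const_lt hxl
    · have hsub : {x | (l : ℝ≥0∞) < ‖stepFun μ s t α (exhaust (ns k)) c x‖ₑ}
          ⊆ {x | (l : ℝ≥0∞) < ‖stepFun μ s t α (tree (2 * ns k) (topR (ns k))) c x‖ₑ}
            ∪ {x | (l : ℝ≥0∞) < ‖stepFun μ s t α (tree (2 * ns k) (topL (ns k))) c x‖ₑ} := by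
        intro x hx
        rw [mem_ofPred_eq, stepFun_exhaust] at hx
        -- The two trees have disjoint supports, so at each point only one of them is active and the
        -- level l need not be halved.
        by_cases hxL : x ∈ (topL (ns k)).toSet
        · right
          have hxR := disjoint_left.1 (disjoint_tops (ns k)) hxL
          rwa [stepFun_eq_zero (Q₀ := topR (ns k)) (fun I hI => (mem_tree_iff.1 hI).1) hxR,
            zero_add] at hx
        · left
          rwa [stepFun_eq_zero (Q₀ := topL (ns k)) (fun I hI => (mem_tree_iff.1 hI).1) hxL,
            add_zero] at hx
      refine (measure_mono hsub).trans ((measure_union_le _ _).trans ?_)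
      exact (add_le_add (hone _ _) (hone _ _)).trans (two_mul _).ge
  refine (mul_le_mul_right hmain _).trans (le_of_eq ?_)
  rw [mul_left_comm, ENNReal.mul_div_cancel h0 ENNReal.coe_ne_top]
  ring

theorem eLpNorm_maximal_le (hμ : ∀ I : Dyadic, 0 < μ I.toSet) (hp : 1 < p)
    (hw : IsWeight μ w) (hB : apChar μ p w ≠ ∞) (hD1 : 1 ≤ D)
    (hD : ∀ I J, Near (N + 2) I J → hm (vol μ) I ≤ D * hm (vol μ) J)
    {f : ℝ → ℝ} (hfm : AEStronglyMeasurable f μ)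
    (hf : eLpNorm f (ENNReal.ofReal p) (weighted μ w) ≠ ∞) :
    eLpNorm (maximal μ N f) (ENNReal.ofReal p) (weighted μ w)
      ≤ (2 * maxConst p N D) ^ (1 / p) *
        (apChar μ p w ^ (((p - 1) ^ 2 + 1) / (p * (p - 1))) * apNChar μ p N w ^ (1 / p))
        * eLpNorm f (ENNReal.ofReal p) (weighted μ w) := by
  have hp0 : 0 < p := by linarith
  have hp1 : 0 < p - 1 := by linarith
  set ν := weighted μ w
  rw [eLpNorm_eq hp] at hf
  have hfi : ∫⁻ x, ‖f x‖ₑ ^ p ∂ν ≠ ∞ := by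
    intro h
    rw [h, ENNReal.top_rpow_of_pos (by positivity)] at hf
    exact hf rfl
  have hloc := integrableOn_of_lintegral_rpow_lt_top hμ hp hw hB hfm hfi
  set K := maxConst p N D * (apChar μ p w ^ (1 / (p - 1)) * apNChar μ p N w) with hK
  set g : ℕ → ℝ → ℝ≥0∞ := fun n x =>
    maxFin μ N (2 * n) (topR n) f x ^ p + maxFin μ N (2 * n) (topL n) f x ^ p with hg
  have hpt : ∀ x, maximal μ N f x ^ p ≤ Filter.liminf (fun n => g n x) Filter.atTop := by
    intro x
    rw [← ENNReal.le_rpow_inv_iff hp0]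
    refine maximal_le fun I J hIJ => ?_
    rw [ENNReal.le_rpow_inv_iff hp0]
    refine Filter.le_liminf_of_le (by isBoundedDefault) ?_
    filter_upwards [eventually_le_maxFin (μ := μ) hIJ f x] with n hn
    rcases le_max_iff.1 hn with h | h
    · exact (ENNReal.rpow_le_rpow h hp0.le).trans le_self_add
    · exact (ENNReal.rpow_le_rpow h hp0.le).trans le_add_self
  have hone : ∀ n Q₀, ∫⁻ x, maxFin μ N n Q₀ f x ^ p ∂ν ≤ K * ∫⁻ x, ‖f x‖ₑ ^ p ∂ν := by
    intro n Q₀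
    refine (lintegral_maxFin_rpow_le hμ hp hw hB hfm hloc hD1 hD n Q₀).trans ?_
    gcongr
    exact Measure.restrict_le_self
  have hint : ∫⁻ x, maximal μ N f x ^ p ∂ν ≤ 2 * (K * ∫⁻ x, ‖f x‖ₑ ^ p ∂ν) := by
    refine (lintegral_mono hpt).trans ((lintegral_liminf_le fun n =>
      (measurable_maxFin.pow_const p).add (measurable_maxFin.pow_const p)).trans ?_)
    refine Filter.liminf_le_of_frequently_le' (Filter.Frequently.of_forall fun n => ?_)
    simp only [Pi.add_apply]
    rw [lintegral_add_left (measurable_maxFin.pow_const p)]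
    exact (add_le_add (hone _ _) (hone _ _)).trans (two_mul _).ge
  have h1p : 0 ≤ 1 / p := by positivity
  -- The maximal function needs only the smaller exponent 1/(p(p-1)); it can be raised because the
  -- characteristic is at least 1.
  have hpow : (apChar μ p w ^ (1 / (p - 1))) ^ (1 / p)
      ≤ apChar μ p w ^ (((p - 1) ^ 2 + 1) / (p * (p - 1))) := by
    rw [← ENNReal.rpow_mul]
    refine ENNReal.rpow_le_rpow_of_exponent_le (one_le_apChar hμ hp hw) ?_
    rw [div_mul_div_comm, mul_comm (p - 1) p]
    gcongr
    nlinarith [sq_nonneg (p - 1)]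
  rw [eLpNorm_eq hp, eLpNorm_eq hp]
  simp only [enorm_eq_self]
  calc _ ≤ (2 * (K * ∫⁻ x, ‖f x‖ₑ ^ p ∂ν)) ^ (1 / p) := ENNReal.rpow_le_rpow hint h1p
    _ = (2 * maxConst p N D) ^ (1 / p) * ((apChar μ p w ^ (1 / (p - 1))) ^ (1 / p)
        * apNChar μ p N w ^ (1 / p)) * (∫⁻ x, ‖f x‖ₑ ^ p ∂ν) ^ (1 / p) := by
        rw [hK]
        simp only [ENNReal.mul_rpow_of_nonneg _ _ h1p]
        ring
    _ ≤ _ := by gcongr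

theorem weakL1Norm_maximal_le (hμ : ∀ I : Dyadic, 0 < μ I.toSet)
    (hw : IsWeight μ w) (hD1 : 1 ≤ D)
    (hD : ∀ I J, Near (N + 2) I J → hm (vol μ) I ≤ D * hm (vol μ) J)
    {f : ℝ → ℝ} (hfm : AEStronglyMeasurable f μ) (hf : eLpNorm f 1 (weighted μ w) ≠ ∞) :
    weakL1Norm (maximal μ N f) (weighted μ w)
      ≤ 2 * (ENNReal.ofReal D + ((N + 2 + 1) ^ 2 * 2 ^ (N + 2) : ℕ) * (N + 2 : ℕ))
        * a1NChar μ N w ^ 2 * eLpNorm f 1 (weighted μ w) := by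
  set ν := weighted μ w
  have hA1 : 1 ≤ a1NChar μ N w := one_le_a1NChar hμ hw
  rw [eLpNorm_one_eq_lintegral_enorm] at hf ⊢
  set K := (ENNReal.ofReal D + ((N + 2 + 1) ^ 2 * 2 ^ (N + 2) : ℕ) * (N + 2 : ℕ)) with hK
  refine iSup_le fun l => ?_
  rcases eq_or_ne (l : ℝ≥0∞) 0 with h0 | h0
  · rw [h0]; simp
  have hone : ∀ n Q₀, ν {x | (l : ℝ≥0∞) < maxFin μ N n Q₀ f x}
      ≤ K * a1NChar μ N w ^ 2 * (∫⁻ x, ‖f x‖ₑ ∂ν) / l := by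
    intro n Q₀
    rw [ENNReal.le_div_iff_mul_le (Or.inl h0) (Or.inl ENNReal.coe_ne_top), mul_comm]
    refine (mul_measure_maxFin_gt_le hμ hw hfm hf hD1 hD n Q₀ l).trans ?_
    gcongr
    · exact le_self_pow₀ hA1 (by norm_num)
    · exact Measure.restrict_le_self
  have hmain : ν {x | (l : ℝ≥0∞) < ‖maximal μ N f x‖ₑ}
      ≤ 2 * (K * a1NChar μ N w ^ 2 * (∫⁻ x, ‖f x‖ₑ ∂ν) / l) := by
    refine measure_le_of_eventually_mem
      (B := fun n => {x | (l : ℝ≥0∞) < maxFin μ N (2 * n) (topR n) f x}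
        ∪ {x | (l : ℝ≥0∞) < maxFin μ N (2 * n) (topL n) f x}) ?_ fun n => ?_
    · refine Filter.Eventually.of_forall fun x hx => ?_
      rw [mem_ofPred_eq, enorm_eq_self] at hx
      simp only [maximal, lt_iSup_iff] at hx
      obtain ⟨I, J, hIJ, hlt⟩ := hx
      filter_upwards [eventually_le_maxFin (μ := μ) (dist_le_iff.1 hIJ) f x] with n hn
      exact lt_max_iff.1 (hlt.trans_le hn)
    · refine (measure_union_le _ _).trans ?_
      exact (add_le_add (hone _ _) (hone _ _)).trans (two_mul _).ge
  refine (mul_le_mul_right hmain _).trans (le_of_eq ?_)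
  rw [mul_left_comm, ENNReal.mul_div_cancel h0 ENNReal.coe_ne_top]
  ring

end

/-! ### Degenerate cases and assembly of the two estimates. -/

section

variable {μ : Measure ℝ} {w : ℝ → ℝ} {N s t : ℕ} {p : ℝ}

/-- With ∞ · 0 = 0 the inequality has content for functions of norm zero even if the characteristic
is infinite: the operator must annihilate them. -/
theorem maximal_eq_zero {f : ℝ → ℝ} (hf : f =ᵐ[μ] 0) (x : ℝ) : maximal μ N f x = 0 := by
  refine le_antisymm (maximal_le fun I J _ => ?_) zero_le
  have h : ⨍⁻ y in I.toSet, ‖f y‖ₑ ∂μ = 0 := by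
    rw [laverage_toSet, lintegral_congr_ae (g := 0)]
    · simp
    · filter_upwards [ae_restrict_of_ae hf] with y hy
      simp [hy]
  rw [h, mul_zero, indicator_zero]

theorem ae_eq_zero_of_eLpNorm_weighted (hw : IsWeight μ w) {q : ℝ≥0∞} (hq : q ≠ 0) {f : ℝ → ℝ}
    (hfm : AEStronglyMeasurable f μ) (hf : eLpNorm f q (weighted μ w) = 0) : f =ᵐ[μ] 0 :=
  hw.absolutelyContinuous.ae_le ((eLpNorm_eq_zero_iff
    (hfm.mono_ac (withDensity_absolutelyContinuous _ _)) hq).1 hf)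

/-- The two terms in the weighted strong type estimate. -/
def strongConst (μ : Measure ℝ) (p : ℝ) (N : ℕ) (w : ℝ → ℝ) : ℝ≥0∞ :=
  apChar μ p w ^ max 1 (1 / (p - 1))
    + apChar μ p w ^ (((p - 1) ^ 2 + 1) / (p * (p - 1))) * apNChar μ p N w ^ (1 / p)

theorem strongConst_eq_top (h : apChar μ p w = ∞) : strongConst μ p N w = ∞ := by
  rw [strongConst, h, ENNReal.top_rpow_of_pos (lt_of_lt_of_le one_pos (le_max_left _ _)), top_add]

variable [IsLocallyFiniteMeasure μ]

theorem haarShift_zero (α : Dyadic → Dyadic → Dyadic → ℝ) : haarShift μ s t α 0 = 0 := by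
  have h : ∀ J, ∫ x, (0 : Lp ℝ 2 μ) x * haar μ J x ∂μ = 0 := fun J => by
    rw [integral_congr_ae (g := 0), Pi.zero_def, integral_zero]
    filter_upwards [Lp.coeFn_zero ℝ 2 μ] with x hx
    rw [hx, Pi.zero_apply, zero_mul]
  simp only [haarShift, h, mul_zero, zero_smul, Finset.sum_const_zero, tsum_zero]

theorem one_le_strongConst (hμ : ∀ I : Dyadic, 0 < μ I.toSet) (hp : 1 < p) (hw : IsWeight μ w) :
    1 ≤ strongConst μ p N w :=
  (ENNReal.one_le_rpow (one_le_apChar hμ hp hw)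
    (lt_of_lt_of_le one_pos (le_max_left _ _))).trans le_self_add

theorem exists_strong_type (hμ : IsBalanced μ) (N : ℕ) (hp : 1 < p) :
    ∃ C : ℝ≥0, ∀ w : ℝ → ℝ, IsWeight μ w →
      (∀ s t : ℕ, s + t ≤ N → ∀ T ∈ HS μ s t, ∀ f : Lp ℝ 2 μ,
        eLpNorm (T f) (ENNReal.ofReal p) (weighted μ w) ≤
          C * strongConst μ p N w * eLpNorm f (ENNReal.ofReal p) (weighted μ w)) ∧
      (∀ f : ℝ → ℝ, AEStronglyMeasurable f μ →
        eLpNorm (maximal μ N f) (ENNReal.ofReal p) (weighted μ w) ≤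
          C * strongConst μ p N w * eLpNorm f (ENNReal.ofReal p) (weighted μ w)) := by
  obtain ⟨D, hD1, hD⟩ := hμ.exists_near (N + 2)
  have hp0 : 0 < p := by linarith
  have hq : ENNReal.ofReal p ≠ 0 := (ENNReal.ofReal_pos.2 hp0).ne'
  set K : ℝ≥0∞ := 1 + 2 * (ENNReal.ofReal (domConst N D) * formConst p N)
    + (2 * maxConst p N D) ^ (1 / p) with hK
  have hKt : K ≠ ∞ := by
    refine ENNReal.add_ne_top.2 ⟨ENNReal.add_ne_top.2 ⟨by norm_num, ENNReal.mul_ne_top (by norm_num)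
      (ENNReal.mul_ne_top ENNReal.ofReal_ne_top (formConst_ne_top hp N))⟩, ?_⟩
    exact ENNReal.rpow_ne_top_of_nonneg (by positivity)
      (ENNReal.mul_ne_top (by norm_num) (maxConst_ne_top hp N D))
  have hK1 : 1 ≤ K := le_add_right le_self_add
  refine ⟨K.toNNReal, fun w hw => ?_⟩
  rw [ENNReal.coe_toNNReal hKt]
  have hC1 : 1 ≤ strongConst μ p N w := one_le_strongConst hμ.pos hp hw
  have hsecond : apChar μ p w ^ (((p - 1) ^ 2 + 1) / (p * (p - 1))) * apNChar μ p N w ^ (1 / p)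
      ≤ strongConst μ p N w := le_add_self
  constructor
  · rintro s t hst T ⟨α, hα, rfl⟩ f
    rcases eq_or_ne (eLpNorm f (ENNReal.ofReal p) (weighted μ w)) 0 with h0 | h0
    · have hf : f = 0 := Lp.eq_zero_iff_ae_eq_zero.2
        (ae_eq_zero_of_eLpNorm_weighted hw hq (Lp.aestronglyMeasurable f) h0)
      rw [hf, haarShift_zero, ← hf, h0, mul_zero]
    rcases eq_or_ne (apChar μ p w) ∞ with hB | hB
    · rw [strongConst_eq_top hB, ENNReal.mul_top (zero_lt_one.trans_le hK1).ne', ENNReal.top_mul h0]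
      exact le_top
    refine (eLpNorm_haarShift_le hμ.pos hp hw hB hα (by linarith) hD hst f).trans ?_
    gcongr
    exact le_add_right le_add_self
  · intro f hfm
    rcases eq_or_ne (eLpNorm f (ENNReal.ofReal p) (weighted μ w)) 0 with h0 | h0
    · have hf := ae_eq_zero_of_eLpNorm_weighted hw hq hfm h0
      rw [show maximal μ N f = 0 from funext (maximal_eq_zero hf), eLpNorm_zero]
      exact zero_le
    rcases eq_or_ne (apChar μ p w) ∞ with hB | hB
    · rw [strongConst_eq_top hB, ENNReal.mul_top (zero_lt_one.trans_le hK1).ne', ENNReal.top_mul h0]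
      exact le_top
    rcases eq_or_ne (eLpNorm f (ENNReal.ofReal p) (weighted μ w)) ∞ with hft | hft
    · rw [hft, ENNReal.mul_top (mul_ne_zero (zero_lt_one.trans_le hK1).ne'
        (zero_lt_one.trans_le hC1).ne')]
      exact le_top
    refine (eLpNorm_maximal_le hμ.pos hp hw hB hD1 hD hfm hft).trans ?_
    gcongr
    exact le_add_self

theorem exists_weak_type (hμ : IsBalanced μ) (N : ℕ) :
    ∃ C : ℝ≥0, ∀ w : ℝ → ℝ, IsWeight μ w →
      (∀ s t : ℕ, s + t ≤ N → ∀ T ∈ HS μ s t, ∀ f : Lp ℝ 2 μ,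
        weakL1Norm (T f) (weighted μ w) ≤
          C * a1NChar μ N w ^ 2 * eLpNorm f 1 (weighted μ w)) ∧
      (∀ f : ℝ → ℝ, AEStronglyMeasurable f μ →
        weakL1Norm (maximal μ N f) (weighted μ w) ≤
          C * a1NChar μ N w ^ 2 * eLpNorm f 1 (weighted μ w)) := by
  obtain ⟨D, hD1, hD⟩ := hμ.exists_near (N + 2)
  set K : ℝ≥0∞ := 1 + 2 * weakConst N D
    + 2 * (ENNReal.ofReal D + ((N + 2 + 1) ^ 2 * 2 ^ (N + 2) : ℕ) * (N + 2 : ℕ)) with hK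
  have hKt : K ≠ ∞ := by
    refine ENNReal.add_ne_top.2 ⟨ENNReal.add_ne_top.2 ⟨by norm_num, ENNReal.mul_ne_top (by norm_num)
      (weakConst_ne_top N D)⟩, ENNReal.mul_ne_top (by norm_num) (ENNReal.add_ne_top.2
      ⟨ENNReal.ofReal_ne_top, ENNReal.mul_ne_top (ENNReal.natCast_ne_top _)
        (ENNReal.natCast_ne_top _)⟩)⟩
  have hK0 : K ≠ 0 := (zero_lt_one.trans_le (le_add_right le_self_add)).ne'
  refine ⟨K.toNNReal, fun w hw => ?_⟩
  rw [ENNReal.coe_toNNReal hKt]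
  have hA0 : a1NChar μ N w ≠ 0 := (zero_lt_one.trans_le (one_le_a1NChar hμ.pos hw)).ne'
  constructor
  · rintro s t hst T ⟨α, hα, rfl⟩ f
    rcases eq_or_ne (eLpNorm f 1 (weighted μ w)) 0 with h0 | h0
    · have hf : f = 0 := Lp.eq_zero_iff_ae_eq_zero.2
        (ae_eq_zero_of_eLpNorm_weighted hw one_ne_zero (Lp.aestronglyMeasurable f) h0)
      -- Since f = 0, the shift of f is f itself and inherits the vanishing norm.
      have h1 : eLpNorm (haarShift μ s t α f) 1 (weighted μ w) = 0 := by
        rw [hf, haarShift_zero, ← hf, h0]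
      rw [h0, mul_zero]
      have h2 := ae_eq_zero_of_eLpNorm_weighted hw one_ne_zero
        (Lp.aestronglyMeasurable (haarShift μ s t α f)) h1
      have h3 : ∀ r : ℝ≥0, weighted μ w {x | (r : ℝ≥0∞) < ‖haarShift μ s t α f x‖ₑ} = 0 := by
        intro r
        refine withDensity_absolutelyContinuous _ _ (measure_mono_null ?_ h2)
        intro x hx hx0
        rw [mem_ofPred_eq, show haarShift μ s t α f x = 0 from hx0] at hx
        simp at hx
      exact iSup_le fun r => by rw [h3, mul_zero]
    rcases eq_or_ne (a1NChar μ N w) ∞ with hA | hA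
    · rw [hA, ENNReal.top_pow two_ne_zero, ENNReal.mul_top hK0, ENNReal.top_mul h0]
      exact le_top
    rcases eq_or_ne (eLpNorm f 1 (weighted μ w)) ∞ with hft | hft
    · rw [hft, ENNReal.mul_top (mul_ne_zero hK0 (pow_ne_zero 2 hA0))]
      exact le_top
    refine (weakL1Norm_haarShift_le hμ.pos hw hA hα hD1 hD hst f hft).trans ?_
    gcongr
    exact le_add_right le_add_self
  · intro f hfm
    rcases eq_or_ne (eLpNorm f 1 (weighted μ w)) 0 with h0 | h0
    · have hf := ae_eq_zero_of_eLpNorm_weighted hw one_ne_zero hfm h0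
      rw [show maximal μ N f = 0 from funext (maximal_eq_zero hf)]
      simp [weakL1Norm]
    rcases eq_or_ne (eLpNorm f 1 (weighted μ w)) ∞ with hft | hft
    · rw [hft, ENNReal.mul_top (mul_ne_zero hK0 (pow_ne_zero 2 hA0))]
      exact le_top
    refine (weakL1Norm_maximal_le hμ.pos hw hD1 hD hfm hft).trans ?_
    gcongr
    exact le_add_self

end

end HaarShift

end

theorem corollary3p8 (μ : Measure ℝ) [IsLocallyFiniteMeasure μ]
    [NullSingletonClass μ] (hμ : HaarShift.IsBalanced μ) (N : ℕ) :
    (∀ p : ℝ, 1 < p → ∃ C : ℝ≥0, ∀ w : ℝ → ℝ, HaarShift.IsWeight μ w →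
      (∀ s t : ℕ, s + t ≤ N → ∀ T ∈ HaarShift.HS μ s t, ∀ f : Lp ℝ 2 μ,
        eLpNorm (T f) (ENNReal.ofReal p) (HaarShift.weighted μ w) ≤
          C * (HaarShift.apChar μ p w ^ max 1 (1 / (p - 1))
            + HaarShift.apChar μ p w ^ (((p - 1) ^ 2 + 1) / (p * (p - 1)))
              * HaarShift.apNChar μ p N w ^ (1 / p))
            * eLpNorm f (ENNReal.ofReal p) (HaarShift.weighted μ w)) ∧
      (∀ f : ℝ → ℝ, AEStronglyMeasurable f μ →
        eLpNorm (HaarShift.maximal μ N f) (ENNReal.ofReal p)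
            (HaarShift.weighted μ w) ≤
          C * (HaarShift.apChar μ p w ^ max 1 (1 / (p - 1))
            + HaarShift.apChar μ p w ^ (((p - 1) ^ 2 + 1) / (p * (p - 1)))
              * HaarShift.apNChar μ p N w ^ (1 / p))
            * eLpNorm f (ENNReal.ofReal p) (HaarShift.weighted μ w))) ∧
    (∃ C : ℝ≥0, ∀ w : ℝ → ℝ, HaarShift.IsWeight μ w →
      (∀ s t : ℕ, s + t ≤ N → ∀ T ∈ HaarShift.HS μ s t, ∀ f : Lp ℝ 2 μ,
        HaarShift.weakL1Norm (T f) (HaarShift.weighted μ w) ≤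
          C * HaarShift.a1NChar μ N w ^ 2
            * eLpNorm f 1 (HaarShift.weighted μ w)) ∧
      (∀ f : ℝ → ℝ, AEStronglyMeasurable f μ →
        HaarShift.weakL1Norm (HaarShift.maximal μ N f) (HaarShift.weighted μ w) ≤
          C * HaarShift.a1NChar μ N w ^ 2
            * eLpNorm f 1 (HaarShift.weighted μ w))) :=
  ⟨fun _ hp => HaarShift.exists_strong_type hμ N hp, HaarShift.exists_weak_type hμ N⟩
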